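/- Let $p$ be a prime and let $R$ be a commutative ring which is complete (and separated) for the $I$-adic topology of an ideal $I$ with $p\in I$ (so $R$ is $p$-complete; for instance $I=(p)$). Put $S_m=\operatorname{Spec}(R/I^{m+1})$ for $m\ge 0$. Objects over $\operatorname{Spf}R$ (curves, group schemes, morphisms) are systems of such objects over the schemes $S_m$, compatible under base change. A generalised elliptic curve over a scheme $S$ is a proper flat finitely presented $S$-scheme $E$ whose geometric fibres are elliptic curves or Néron $1$-gons ($\mathbf P^1$ with $0$ and $\infty$ glued), together with a commutative group scheme structure on the smooth locus $E^{\mathrm{sm}}$ and an action $E^{\mathrm{sm}}\times_S E\to E$ extending the group law of $E^{\mathrm{sm}}$. A homomorphism $f\colon E\to E'$ is an $S$-morphism that restricts to a group homomorphism $E^{\mathrm{sm}}\to E'^{\mathrm{sm}}$ and is compatible with the actions; it is an isogeny if it is surjective. Its kernel is $\ker(E^{\mathrm{sm}}\to E'^{\mathrm{sm}})$. The quasi $p$-divisible group $E[p^\infty]$ is the tower of group schemes $E^{\mathrm{sm}}[p^n]$, $n\ge 1$, with the inclusions $E^{\mathrm{sm}}[p^n]\subseteq E^{\mathrm{sm}}[p^{n+1}]$;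 morphisms of quasi $p$-divisible groups are levelwise group homomorphisms commuting with the inclusions. Let $f\colon E\to E'$ be an isogeny of generalised elliptic curves over $\operatorname{Spf}R$. Then the kernel of $f$ is finite locally free over every $S_m$, and its local rank, a locally constant $\mathbf N$-valued function on $\operatorname{Spf}R$, defines a unique element $\deg f\in R=\varprojlim_m R/I^{m+1}$. The induced morphism $E[p^\infty]\to E'[p^\infty]$ is an isomorphism of quasi $p$-divisible groups over $\operatorname{Spf}R$ if and only if $\deg f$ is invertible in $R$. -/

import Mathlib

open CategoryTheory Limits MonoidalCategory CartesianMonoidalCategory MonObj AlgebraicGeometry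

universe u

noncomputable section

namespace GenEll

/-! ### Group schemes: kernels, torsion, base change -/

section Kernel

variable {S : Scheme.{u}}

/-- The kernel `G ×_H S ⟶ S` of a homomorphism `f : G ⟶ H` of group schemes over `S`:
the pullback of the unit section of `H` along `f`. -/
def ker {G H : Over S} [GrpObj H] (f : G ⟶ H) : Over S :=
  Over.mk (Y := pullback f.left η[H].left) (pullback.snd f.left η[H].left)

lemma ker_w {G H : Over S} [GrpObj H] (f : G ⟶ H) :
    pullback.fst f.left η[H].left ≫ G.hom = pullback.snd f.left η[H].left := by
  have h := pullback.condition (f := f.left) (g := η[H].left) =≫ H.hom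
  have h1 : η[H].left ≫ H.hom = 𝟙 S := Over.w η[H]
  simp only [Category.assoc, Over.w f, h1] at h
  exact h.trans (Category.comp_id _)

/-- The inclusion of the kernel. -/
def kerι {G H : Over S} [GrpObj H] (f : G ⟶ H) : ker f ⟶ G :=
  Over.homMk (pullback.fst f.left η[H].left) (ker_w f)

instance {G H : Over S} [GrpObj H] (f : G ⟶ H) : Mono (kerι f).left := by
  have : IsSplitMono η[H].left := ⟨⟨⟨H.hom, Over.w η[H]⟩⟩⟩
  exact inferInstanceAs (Mono (pullback.fst f.left η[H].left))

instance {G H : Over S} [GrpObj H] (f : G ⟶ H) : Mono (kerι f) :=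
  Over.mono_of_mono_left _

lemma kerι_comp {G H : Over S} [GrpObj H] (f : G ⟶ H) : kerι f ≫ f = 1 := by
  ext1
  rw [Hom.one_def]
  exact pullback.condition (f := f.left) (g := η[H].left)

/-- A morphism killed by `f` factors through the kernel. -/
def kerLift {G H T : Over S} [GrpObj H] (f : G ⟶ H) (x : T ⟶ G) (h : x ≫ f = 1) : T ⟶ ker f :=
  Over.homMk (pullback.lift x.left T.hom (by
    rw [Hom.one_def] at h
    exact congr(($h).left))) (pullback.lift_snd _ _ _)

@[simp]
lemma kerLift_ι {G H T : Over S} [GrpObj H] (f : G ⟶ H) (x : T ⟶ G) (h : x ≫ f = 1) :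
    kerLift f x h ≫ kerι f = x := by
  ext1
  exact pullback.lift_fst _ _ _

variable {G H : Over S} [GrpObj G] [GrpObj H]

/-- The kernel of a homomorphism is a group scheme, with the group law of `G`. -/
instance (f : G ⟶ H) [IsMonHom f] : GrpObj (ker f) where
  one := kerLift f η[G] (by simp [one_eq_one])
  mul := kerLift f (fst _ _ ≫ kerι f * snd _ _ ≫ kerι f) (by
    rw [mul_comp, Category.assoc, Category.assoc, kerι_comp, comp_one, comp_one, _root_.one_mul])
  inv := kerLift f (kerι f)⁻¹ (by rw [GrpObj.inv_comp, kerι_comp, inv_one])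
  one_mul := by
    rw [← cancel_mono (kerι f)]
    simp [comp_mul, one_eq_one, leftUnitor_hom]
  mul_one := by
    rw [← cancel_mono (kerι f)]
    simp [comp_mul, one_eq_one, rightUnitor_hom]
  mul_assoc := by
    rw [← cancel_mono (kerι f)]
    simp [comp_mul, _root_.mul_assoc]
  left_inv := by
    rw [← cancel_mono (kerι f)]
    simp [comp_mul, one_eq_one]
  right_inv := by
    rw [← cancel_mono (kerι f)]
    simp [comp_mul, one_eq_one]

instance (f : G ⟶ H) [IsMonHom f] : IsMonHom (kerι f) where
  one_hom := kerLift_ι _ _ _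
  mul_hom := by
    refine (kerLift_ι _ _ _).trans ?_
    simp [Hom.mul_def]

instance (f : G ⟶ H) [IsMonHom f] [IsCommMonObj G] : IsCommMonObj (ker f) where
  mul_comm := by
    rw [← cancel_mono (kerι f), Category.assoc, IsMonHom.mul_hom, ← Category.assoc,
      ← BraidedCategory.braiding_naturality, Category.assoc, IsCommMonObj.mul_comm]

/-- Multiplication by `N` on a commutative group scheme. -/
abbrev mulBy (G : Over S) [GrpObj G] (N : ℕ) : G ⟶ G := 𝟙 G ^ N

lemma comp_mulBy {T : Over S} (x : T ⟶ G) (N : ℕ) : x ≫ mulBy G N = x ^ N := by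
  rw [mulBy, comp_pow, Category.comp_id]

instance (G : Over S) [GrpObj G] [IsCommMonObj G] (N : ℕ) : IsMonHom (mulBy G N) where
  one_hom := by rw [comp_mulBy, one_eq_one, one_pow]
  mul_hom := by
    have h : (mulBy G N ⊗ₘ mulBy G N) = lift (fst G G ≫ mulBy G N) (snd G G ≫ mulBy G N) := by
      ext1 <;> simp
    rw [comp_mulBy, h, ← Hom.mul_def, comp_mulBy, comp_mulBy, mul_eq_mul, mul_pow]

/-- The `N`-torsion `G[N]` of a commutative group scheme. -/
abbrev torsion (G : Over S) [GrpObj G] [IsCommMonObj G] (N : ℕ) : Over S := ker (mulBy G N)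

/-- The inclusion `G[N] ⟶ G`. -/
abbrev torsionι (G : Over S) [GrpObj G] [IsCommMonObj G] (N : ℕ) : torsion G N ⟶ G :=
  kerι (mulBy G N)

variable [IsCommMonObj G] [IsCommMonObj H]

lemma torsionι_pow (N : ℕ) : torsionι G N ^ N = 1 := by
  rw [← comp_mulBy, kerι_comp]

/-- A `T`-valued point of `G` killed by `N` is a `T`-valued point of `G[N]`. -/
def torsionLift {T : Over S} {N : ℕ} (x : T ⟶ G) (h : x ^ N = 1) : T ⟶ torsion G N :=
  kerLift _ x (by rw [comp_mulBy, h])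

@[simp]
lemma torsionLift_ι {T : Over S} {N : ℕ} (x : T ⟶ G) (h : x ^ N = 1) :
    torsionLift x h ≫ torsionι G N = x := kerLift_ι _ _ _

lemma isMonHom_of_comp_mono {A B C : Over S} [GrpObj A] [GrpObj B] [GrpObj C] (f : A ⟶ B)
    (g : B ⟶ C) [Mono g] [IsMonHom g] [IsMonHom (f ≫ g)] : IsMonHom f where
  one_hom := by
    rw [← cancel_mono g, Category.assoc, IsMonHom.one_hom, IsMonHom.one_hom]
  mul_hom := by
    rw [← cancel_mono g, Category.assoc, IsMonHom.mul_hom, Category.assoc, IsMonHom.mul_hom,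
      ← Category.assoc, tensorHom_comp_tensorHom]

/-- The inclusion `G[N] ⟶ G[M]` for `N ∣ M`. -/
def torsionIncl (G : Over S) [GrpObj G] [IsCommMonObj G] {N M : ℕ} (h : N ∣ M) :
    torsion G N ⟶ torsion G M :=
  torsionLift (torsionι G N) (by
    obtain ⟨k, rfl⟩ := h
    rw [pow_mul, torsionι_pow, one_pow])

@[simp]
lemma torsionIncl_ι {N M : ℕ} (h : N ∣ M) : torsionIncl G h ≫ torsionι G M = torsionι G N :=
  torsionLift_ι _ _

instance {N M : ℕ} (h : N ∣ M) : IsMonHom (torsionIncl G h) := by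
  have : IsMonHom (torsionIncl G h ≫ torsionι G M) := by rw [torsionIncl_ι]; infer_instance
  exact isMonHom_of_comp_mono _ (torsionι G M)

/-- The map `G[N] ⟶ H[N]` induced by a homomorphism `f : G ⟶ H`. -/
def torsionMap (f : G ⟶ H) [IsMonHom f] (N : ℕ) : torsion G N ⟶ torsion H N :=
  torsionLift (torsionι G N ≫ f) (by
    rw [← pow_comp, torsionι_pow, one_comp])

@[simp]
lemma torsionMap_ι (f : G ⟶ H) [IsMonHom f] (N : ℕ) :
    torsionMap f N ≫ torsionι H N = torsionι G N ≫ f :=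
  torsionLift_ι _ _

instance (f : G ⟶ H) [IsMonHom f] (N : ℕ) : IsMonHom (torsionMap f N) := by
  have : IsMonHom (torsionMap f N ≫ torsionι H N) := by rw [torsionMap_ι]; infer_instance
  exact isMonHom_of_comp_mono _ (torsionι H N)

lemma torsionMap_comp_torsionIncl (f : G ⟶ H) [IsMonHom f] {N M : ℕ} (h : N ∣ M) :
    torsionMap f N ≫ torsionIncl H h = torsionIncl G h ≫ torsionMap f M := by
  rw [← cancel_mono (torsionι H M), Category.assoc, Category.assoc, torsionIncl_ι, torsionMap_ι,
    torsionMap_ι, ← Category.assoc, torsionIncl_ι]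

/-- `G[N]` is the `N`-torsion of `G[M]` for `N ∣ M`. -/
def torsionIso (G : Over S) [GrpObj G] [IsCommMonObj G] {N M : ℕ} (h : N ∣ M) :
    torsion G N ≅ torsion (torsion G M) N where
  hom := torsionLift (torsionIncl G h) (by
    rw [← cancel_mono (torsionι G M), pow_comp, torsionIncl_ι, torsionι_pow, one_comp])
  inv := torsionLift (torsionι (torsion G M) N ≫ torsionι G M) (by
    rw [← pow_comp, torsionι_pow, one_comp])
  hom_inv_id := by
    rw [← cancel_mono (torsionι G N)]
    simp only [Category.assoc, torsionLift_ι, Category.id_comp]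
    rw [← Category.assoc, torsionLift_ι, torsionIncl_ι]
  inv_hom_id := by
    rw [← cancel_mono (torsionι (torsion G M) N), ← cancel_mono (torsionι G M)]
    simp only [Category.assoc, torsionLift_ι, Category.id_comp, torsionIncl_ι]

lemma torsionIso_hom_ι {N M : ℕ} (h : N ∣ M) :
    (torsionIso G h).hom ≫ torsionι (torsion G M) N = torsionIncl G h := by
  simp only [torsionIso, torsionLift_ι]

lemma isClosedImmersion_torsionι (N : ℕ) [IsSeparated G.hom] :
    IsClosedImmersion (torsionι G N).left := by
  have : IsClosedImmersion η[G].left := by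
    have : IsClosedImmersion (η[G].left ≫ G.hom) := by
      rw [Over.w]
      exact inferInstanceAs (IsClosedImmersion (𝟙 S))
    exact IsClosedImmersion.of_comp _ G.hom
  exact inferInstanceAs (IsClosedImmersion (pullback.fst (mulBy G N).left η[G].left))

lemma isClosedImmersion_torsionIncl {N M : ℕ} (h : N ∣ M) [IsSeparated G.hom] :
    IsClosedImmersion (torsionIncl G h).left := by
  have h1 := isClosedImmersion_torsionι (G := G) N
  have h2 := isClosedImmersion_torsionι (G := G) M
  rw [← torsionIncl_ι h, Over.comp_left] at h1
  exact IsClosedImmersion.of_comp _ (torsionι G M).left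

end Kernel

section BaseChange

variable {S T : Scheme.{u}}

lemma map_comp_map_eq {A B C D A' B' C' D' : Scheme.{u}} {a : A ⟶ A'} {b : B ⟶ B'} {c : C ⟶ C'}
    {d : D ⟶ D'} {i : A ⟶ B} {j : B ⟶ D} {k : A ⟶ C} {l : C ⟶ D} {i' : A' ⟶ B'} {j' : B' ⟶ D'}
    {k' : A' ⟶ C'} {l' : C' ⟶ D'} {hi : a ≫ i' = i ≫ b} {hj : b ≫ j' = j ≫ d}
    {hk : a ≫ k' = k ≫ c} {hl : c ≫ l' = l ≫ d} (h : i ≫ j = k ≫ l) :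
    pullback.map a a b b i i i' hi hi ≫ pullback.map b b d d j j j' hj hj =
      pullback.map a a c c k k k' hk hk ≫ pullback.map c c d d l l l' hl hl := by
  apply pullback.hom_ext <;>
    simp [pullback.map, pullback.lift_fst, pullback.lift_snd, pullback.lift_fst_assoc,
      pullback.lift_snd_assoc, h]

/-- `t : G ⟶ H`, lying over `g : S ⟶ T`, exhibits the group scheme `G` over `S` as the base change
along `g` of the group scheme `H` over `T`: the square is cartesian and `t` respects the group
laws. -/
structure IsGroupBaseChange (g : S ⟶ T) (G : Over S) (H : Over T) [GrpObj G] [GrpObj H]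
    (t : G.left ⟶ H.left) : Prop where
  isPullback : IsPullback t G.hom H.hom g
  mul : μ[G].left ≫ t =
    pullback.map G.hom G.hom H.hom H.hom t t g isPullback.w.symm isPullback.w.symm ≫ μ[H].left

namespace IsGroupBaseChange

variable {g : S ⟶ T} {G : Over S} {H : Over T} [GrpObj G] [GrpObj H] {t : G.left ⟶ H.left}

/-- The map on points `G(X) → H(X)` for `X` over `S`. -/
def onPoints (h : IsGroupBaseChange g G H t) (X : Over S) :
    (X ⟶ G) →* ((Over.map g).obj X ⟶ H) :=
  MonoidHom.mk' (fun x ↦ Over.homMk (x.left ≫ t) (by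
    rw [Category.assoc, h.isPullback.w, ← Category.assoc, Over.w]; rfl)) (by
    intro x y
    ext1
    change ((lift x y).left ≫ μ[G].left) ≫ t = (lift (Over.homMk (x.left ≫ t) _ :
      (Over.map g).obj X ⟶ H) (Over.homMk (y.left ≫ t) _)).left ≫ μ[H].left
    rw [Category.assoc, h.mul, ← Category.assoc]
    congr 1
    apply pullback.hom_ext
    · simp [pullback.map, pullback.lift_fst, pullback.lift_fst_assoc]
    · simp [pullback.map, pullback.lift_snd, pullback.lift_snd_assoc])

lemma onPoints_left (h : IsGroupBaseChange g G H t) {X : Over S} (x : X ⟶ G) :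
    (h.onPoints X x).left = x.left ≫ t := rfl

lemma mulBy_comp (h : IsGroupBaseChange g G H t) (N : ℕ) :
    (mulBy G N).left ≫ t = t ≫ (mulBy H N).left := by
  have h1 := map_pow (h.onPoints G) (𝟙 G) N
  rw [← comp_mulBy] at h1
  have h2 := congr(($h1).left)
  rw [onPoints_left, Category.id_comp, ← comp_mulBy, Over.comp_left, onPoints_left, Over.id_left,
    Category.id_comp] at h2
  exact h2

lemma one_comp (h : IsGroupBaseChange g G H t) : η[G].left ≫ t = g ≫ η[H].left := by
  have h1 := map_one (h.onPoints (𝟙_ (Over S)))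
  have h2 := congr(($h1).left)
  rw [onPoints_left, Hom.one_def, Hom.one_def, Over.comp_left, Over.comp_left] at h2
  have h3 : (toUnit (𝟙_ (Over S))).left = 𝟙 S := rfl
  have h4 : (toUnit ((Over.map g).obj (𝟙_ (Over S)))).left = g := Category.id_comp g
  rw [h3, h4] at h2
  exact (congrArg (· ≫ t) (Category.id_comp η[G].left)).symm.trans h2

/-- The map on `N`-torsion induced by a base change of commutative group schemes. -/
def torsionTrans [IsCommMonObj G] [IsCommMonObj H] (h : IsGroupBaseChange g G H t) (N : ℕ) :
    (torsion G N).left ⟶ (torsion H N).left :=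
  pullback.map (mulBy G N).left η[G].left (mulBy H N).left η[H].left t g t
    (h.mulBy_comp N) h.one_comp

lemma torsionTrans_ι [IsCommMonObj G] [IsCommMonObj H] (h : IsGroupBaseChange g G H t) (N : ℕ) :
    h.torsionTrans N ≫ (torsionι H N).left = (torsionι G N).left ≫ t :=
  pullback.lift_fst _ _ _

lemma isPullback_torsionTrans [IsCommMonObj G] [IsCommMonObj H] (h : IsGroupBaseChange g G H t)
    (N : ℕ) : IsPullback (h.torsionTrans N) (torsion G N).hom (torsion H N).hom g := by
  have hη : IsPullback g η[G].left η[H].left t := by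
    refine IsPullback.of_bot (v₂₁ := G.hom) (v₂₂ := H.hom) (h₃₁ := g) ?_ h.one_comp.symm
      h.isPullback
    have e1 : η[G].left ≫ G.hom = 𝟙 S := Over.w η[G]
    have e2 : η[H].left ≫ H.hom = 𝟙 T := Over.w η[H]
    rw [e1, e2]
    exact IsPullback.of_vert_isIso (by simp)
  have h1 : IsPullback (torsion G N).hom (torsionι G N).left η[G].left (mulBy G N).left :=
    (IsPullback.of_hasPullback (mulBy G N).left η[G].left).flip
  have h2 : IsPullback (torsion H N).hom (torsionι H N).left η[H].left (mulBy H N).left :=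
    (IsPullback.of_hasPullback (mulBy H N).left η[H].left).flip
  have h3 := h1.paste_horiz hη
  have h4 : IsPullback (h.torsionTrans N) (torsionι G N).left (torsionι H N).left t := by
    refine IsPullback.of_right (h₁₂ := (torsion H N).hom) (h₂₂ := (mulBy H N).left)
      (v₁₃ := η[H].left) ?_ (h.torsionTrans_ι N) h2
    have e : h.torsionTrans N ≫ (torsion H N).hom = (torsion G N).hom ≫ g :=
      pullback.lift_snd _ _ _
    rw [e, ← h.mulBy_comp N]
    exact h3
  have h5 := h4.paste_vert h.isPullback
  rwa [Over.w, Over.w] at h5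

lemma torsion [IsCommMonObj G] [IsCommMonObj H] (h : IsGroupBaseChange g G H t) (N : ℕ) :
    IsGroupBaseChange g (torsion G N) (torsion H N) (h.torsionTrans N) where
  isPullback := h.isPullback_torsionTrans N
  mul := by
    rw [← cancel_mono (torsionι H N).left, Category.assoc, torsionTrans_ι, ← Category.assoc,
      ← Over.comp_left, IsMonHom.mul_hom, Category.assoc, ← Over.comp_left, IsMonHom.mul_hom,
      Over.comp_left, Over.comp_left, Category.assoc, h.mul, ← Category.assoc, ← Category.assoc]
    congr 1
    exact map_comp_map_eq (i' := 𝟙 S) (l' := 𝟙 T) (hi := (Category.comp_id _).trans (Over.w _).symm)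
      (hl := (Category.comp_id _).trans (Over.w _).symm) (h.torsionTrans_ι N).symm

lemma torsionTrans_comp_torsionIncl [IsCommMonObj G] [IsCommMonObj H]
    (h : IsGroupBaseChange g G H t) {N M : ℕ} (hNM : N ∣ M) :
    h.torsionTrans N ≫ (torsionIncl H hNM).left =
      (torsionIncl G hNM).left ≫ h.torsionTrans M := by
  rw [← cancel_mono (torsionι H M).left, Category.assoc, Category.assoc, ← Over.comp_left,
    torsionIncl_ι, torsionTrans_ι, torsionTrans_ι, ← Category.assoc, ← Over.comp_left,
    torsionIncl_ι]

end IsGroupBaseChange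

end BaseChange

/-! ### Generalised elliptic curves with irreducible geometric fibres -/

section Curves

open Polynomial

/-- The projective line over a field `k`, presented by its two standard charts `𝔸¹`, glued along
`𝔾ₘ` by `T ↦ T⁻¹`. -/
structure ProjectiveLine (k : Type u) [Field k] where
  P : Scheme.{u}
  chart₀ : Spec (.of k[X]) ⟶ P
  chart₁ : Spec (.of k[X]) ⟶ P
  isOpenImmersion₀ : IsOpenImmersion chart₀
  isOpenImmersion₁ : IsOpenImmersion chart₁
  cover : Set.range chart₀ ∪ Set.range chart₁ = Set.univ
  glue : IsPullback (Spec.map (CommRingCat.ofHom (toLaurent (R := k))))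
    (Spec.map (CommRingCat.ofHom
      ((LaurentPolynomial.invert (R := k)).toRingEquiv.toRingHom.comp (toLaurent (R := k)))))
    chart₀ chart₁

/-- The origin of the affine line. -/
def origin (k : Type u) [Field k] : Spec (.of k) ⟶ Spec (.of k[X]) :=
  Spec.map (CommRingCat.ofHom (evalRingHom (0 : k)))

/-- `0 ∈ ℙ¹(k)`. -/
def ProjectiveLine.zero {k : Type u} [Field k] (L : ProjectiveLine k) : Spec (.of k) ⟶ L.P :=
  origin k ≫ L.chart₀

/-- `∞ ∈ ℙ¹(k)`. -/
def ProjectiveLine.infty {k : Type u} [Field k] (L : ProjectiveLine k) : Spec (.of k) ⟶ L.P :=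
  origin k ≫ L.chart₁

/-- `X` is a Néron `1`-gon over `k`: it is obtained from `ℙ¹` over `k` by gluing `0` and `∞`, that
is, it is the coequaliser of `0, ∞ : Spec k ⇉ ℙ¹` in locally ringed spaces. -/
def IsNeronOneGon {k : Type u} [Field k] {X : Scheme.{u}} (π : X ⟶ Spec (.of k)) : Prop :=
  ∃ (L : ProjectiveLine k) (c : L.P ⟶ X) (h : L.zero ≫ c = L.infty ≫ c),
    L.chart₀ ≫ c ≫ π = Spec.map (CommRingCat.ofHom (C (R := k))) ∧
    L.chart₁ ≫ c ≫ π = Spec.map (CommRingCat.ofHom (C (R := k))) ∧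
    Nonempty (IsColimit (Cofork.ofπ
      (f := Scheme.forgetToLocallyRingedSpace.map L.zero)
      (g := Scheme.forgetToLocallyRingedSpace.map L.infty)
      (Scheme.forgetToLocallyRingedSpace.map c)
      (by rw [← Functor.map_comp, ← Functor.map_comp, h])))

/-- The smooth locus `E^sm` of `E` over `S`, as a scheme over `S`. -/
def smOver {S : Scheme.{u}} (E : Over S) [LocallyOfFinitePresentation E.hom] : Over S :=
  Over.mk (E.hom.smoothLocus.ι ≫ E.hom)

/-- The open immersion `E^sm ⟶ E`. -/
def smι {S : Scheme.{u}} (E : Over S) [LocallyOfFinitePresentation E.hom] : smOver E ⟶ E :=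
  Over.homMk E.hom.smoothLocus.ι rfl

/-- A generalised elliptic curve over `S` with irreducible geometric fibres: a proper flat finitely
presented curve `E` over `S` whose geometric fibres are connected smooth curves or Néron `1`-gons,
with a commutative group scheme structure on `E^sm` and an action `E^sm ×_S E ⟶ E` extending the
group law of `E^sm`. The group law forces the smooth geometric fibres to be one-dimensional abelian
varieties, that is, elliptic curves. -/
structure GenEllCurve (S : Scheme.{u}) where
  E : Over S
  [flat : Flat E.hom]
  [proper : IsProper E.hom]
  [finPres : LocallyOfFinitePresentation E.hom]
  fibres : ∀ (k : Type u) [Field k] [IsAlgClosed k] (s : Spec (.of k) ⟶ S),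
    (SmoothOfRelativeDimension 1 (pullback.snd E.hom s) ∧
      ConnectedSpace (pullback E.hom s : Scheme.{u})) ∨
    IsNeronOneGon (pullback.snd E.hom s)
  [grp : GrpObj (smOver E)]
  [comm : IsCommMonObj (smOver E)]
  act : smOver E ⊗ E ⟶ E
  one_act : η[smOver E] ▷ E ≫ act = (λ_ E).hom
  mul_act : μ[smOver E] ▷ E ≫ act = (α_ _ _ _).hom ≫ smOver E ◁ act ≫ act
  act_sm : smOver E ◁ smι E ≫ act = μ[smOver E] ≫ smι E

namespace GenEllCurve

attribute [instance] flat proper finPres grp comm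

variable {S T : Scheme.{u}}

/-- The group scheme `E^sm`. -/
abbrev sm (X : GenEllCurve S) : Over S := smOver X.E

/-- The inclusion of `E^sm` into `E`. -/
abbrev incl (X : GenEllCurve S) : X.sm ⟶ X.E := smι X.E

instance (X : GenEllCurve S) : IsOpenImmersion X.incl.left :=
  inferInstanceAs (IsOpenImmersion X.E.hom.smoothLocus.ι)

instance (X : GenEllCurve S) : IsSeparated X.sm.hom :=
  inferInstanceAs (IsSeparated (X.E.hom.smoothLocus.ι ≫ X.E.hom))

instance (X : GenEllCurve S) : Smooth X.sm.hom := by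
  have h := Scheme.Hom.preimage_smoothLocus_eq X.E.hom.smoothLocus.ι X.E.hom
  change Smooth (X.E.hom.smoothLocus.ι ≫ X.E.hom)
  rw [← Scheme.Hom.smoothLocus_eq_top_iff, ← h]
  simp

/-- A homomorphism of generalised elliptic curves: an `S`-morphism `E ⟶ E'` which restricts to a
homomorphism of group schemes `E^sm ⟶ E'^sm` and is compatible with the actions. -/
structure Hom (X Y : GenEllCurve S) where
  hom : X.E ⟶ Y.E
  sm : X.sm ⟶ Y.sm
  sm_incl : sm ≫ Y.incl = X.incl ≫ hom
  [isMonHom : IsMonHom sm]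
  act : X.act ≫ hom = (sm ⊗ₘ hom) ≫ Y.act

attribute [instance] Hom.isMonHom

/-- An isogeny is a surjective homomorphism. -/
def Hom.IsIsogeny {X Y : GenEllCurve S} (f : X.Hom Y) : Prop := Surjective f.hom.left

/-- The kernel of a homomorphism of generalised elliptic curves. -/
def Hom.kernel {X Y : GenEllCurve S} (f : X.Hom Y) : Over S := ker f.sm

/-- An identification of `X` with the base change of `Y` along `g : S ⟶ T`, given by a cartesian
square compatible with the group laws on the smooth loci and with the actions. -/
structure BaseChange (g : S ⟶ T) (X : GenEllCurve S) (Y : GenEllCurve T) where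
  map : X.E.left ⟶ Y.E.left
  isPullback : IsPullback map X.E.hom Y.E.hom g
  sm : X.sm.left ⟶ Y.sm.left
  sm_incl : sm ≫ Y.incl.left = X.incl.left ≫ map
  sm_w : X.sm.hom ≫ g = sm ≫ Y.sm.hom
  mul : μ[X.sm].left ≫ sm =
    pullback.map X.sm.hom X.sm.hom Y.sm.hom Y.sm.hom sm sm g sm_w sm_w ≫ μ[Y.sm].left
  act : X.act.left ≫ map =
    pullback.map X.sm.hom X.E.hom Y.sm.hom Y.E.hom sm map g sm_w isPullback.w.symm ≫ Y.act.left

/-- The smooth locus is compatible with base change. -/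
lemma BaseChange.isPullback_sm {g : S ⟶ T} {X : GenEllCurve S} {Y : GenEllCurve T}
    (b : BaseChange g X Y) : IsPullback b.sm X.sm.hom Y.sm.hom g := by
  have h1 : IsPullback b.sm X.incl.left Y.incl.left b.map := by
    refine IsOpenImmersion.isPullback _ _ _ _ b.sm_incl.symm ?_
    have hX : X.incl.left.opensRange = X.E.hom.smoothLocus :=
      Scheme.Opens.opensRange_ι _
    have hY : Y.incl.left.opensRange = Y.E.hom.smoothLocus :=
      Scheme.Opens.opensRange_ι _
    rw [hX, hY]
    apply le_antisymm
    · have h2 := (isPullback_morphismRestrict b.map Y.E.hom.smoothLocus).paste_vert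
        b.isPullback
      have h3 : Smooth (Y.E.hom.smoothLocus.ι ≫ Y.E.hom) := inferInstanceAs (Smooth Y.sm.hom)
      have h4 : Smooth ((b.map ⁻¹ᵁ Y.E.hom.smoothLocus).ι ≫ X.E.hom) :=
        MorphismProperty.of_isPullback h2 h3
      have h5 := Scheme.Hom.preimage_smoothLocus_eq (b.map ⁻¹ᵁ Y.E.hom.smoothLocus).ι X.E.hom
      rw [Scheme.Hom.smoothLocus_eq_top ((b.map ⁻¹ᵁ Y.E.hom.smoothLocus).ι ≫ X.E.hom)] at h5
      intro x hx
      exact h5.ge (Set.mem_univ (⟨x, hx⟩ : (b.map ⁻¹ᵁ Y.E.hom.smoothLocus :)))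
    · rw [← hX, ← hY]
      rintro _ ⟨y, rfl⟩
      have h6 : Y.incl.left (b.sm y) = b.map (X.incl.left y) := by
        rw [← Scheme.Hom.comp_apply, ← Scheme.Hom.comp_apply, b.sm_incl]
      exact ⟨b.sm y, h6⟩
  have h2 := h1.paste_vert b.isPullback
  rwa [Over.w, Over.w] at h2

lemma BaseChange.isGroupBaseChange {g : S ⟶ T} {X : GenEllCurve S} {Y : GenEllCurve T}
    (b : BaseChange g X Y) : IsGroupBaseChange g X.sm Y.sm b.sm :=
  ⟨b.isPullback_sm, b.mul⟩

end GenEllCurve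

end Curves

/-! ### Quasi `p`-divisible groups -/

section Towers

/-- A tower of commutative group schemes `level n = 𝔾ₙ₊₁` over `S`, with closed immersive
homomorphisms `𝔾ₙ₊₁ ⟶ 𝔾ₙ₊₂` whose image is the `pⁿ⁺¹`-torsion of `𝔾ₙ₊₂`. The quasi `p`-divisible
groups over an affine scheme `S` are the towers all of whose levels are affine. They form a full
subcategory, so that morphisms and isomorphisms of quasi `p`-divisible groups are morphisms and
isomorphisms of towers. -/
structure PTower (p : ℕ) (S : Scheme.{u}) where
  level : ℕ → Over S
  [grp : ∀ n, GrpObj (level n)]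
  [comm : ∀ n, IsCommMonObj (level n)]
  incl : ∀ n, level n ⟶ level (n + 1)
  [isMonHom : ∀ n, IsMonHom (incl n)]
  isClosedImmersion : ∀ n, IsClosedImmersion (incl n).left
  image : ∀ n, ∃ e : level n ≅ torsion (level (n + 1)) (p ^ (n + 1)), e.hom ≫ torsionι _ _ = incl n

namespace PTower

attribute [instance] grp comm isMonHom

variable {p : ℕ} {S : Scheme.{u}}

/-- Morphisms of towers: levelwise homomorphisms commuting with the structure maps. -/
@[ext]
structure Hom (G H : PTower p S) where
  app : ∀ n, G.level n ⟶ H.level n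
  isMonHom : ∀ n, IsMonHom (app n)
  comm : ∀ n, app n ≫ H.incl n = G.incl n ≫ app (n + 1)

instance : Category (PTower p S) where
  Hom := Hom
  id G := ⟨fun _ ↦ 𝟙 _, fun _ ↦ inferInstance, fun _ ↦ by simp⟩
  comp f g := ⟨fun n ↦ f.app n ≫ g.app n,
    fun n ↦ by have := f.isMonHom n; have := g.isMonHom n; infer_instance,
    fun n ↦ by rw [Category.assoc, g.comm, ← Category.assoc, f.comm, Category.assoc]⟩
  id_comp f := Hom.ext (funext fun _ ↦ Category.id_comp _)
  comp_id f := Hom.ext (funext fun _ ↦ Category.comp_id _)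
  assoc f g h := Hom.ext (funext fun _ ↦ Category.assoc _ _ _)

end PTower

/-- The tower `E[p^∞]` of a generalised elliptic curve `E`, with levels `E^sm[pⁿ⁺¹]`. -/
def GenEllCurve.pTower {S : Scheme.{u}} (X : GenEllCurve S) (p : ℕ) : PTower p S where
  level n := torsion X.sm (p ^ (n + 1))
  incl n := torsionIncl X.sm (pow_dvd_pow p (Nat.le_succ (n + 1)))
  isClosedImmersion _ := isClosedImmersion_torsionIncl _
  image _ := ⟨torsionIso X.sm _, torsionIso_hom_ι _⟩

/-- The morphism `E[p^∞] ⟶ E'[p^∞]` induced by a homomorphism of generalised elliptic curves. -/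
def GenEllCurve.Hom.pTower {S : Scheme.{u}} {X Y : GenEllCurve S} (f : X.Hom Y) (p : ℕ) :
    X.pTower p ⟶ Y.pTower p where
  app n := torsionMap f.sm (p ^ (n + 1))
  isMonHom n := inferInstanceAs (IsMonHom (torsionMap f.sm (p ^ (n + 1))))
  comm n := torsionMap_comp_torsionIncl f.sm (pow_dvd_pow p (Nat.le_succ (n + 1)))

end Towers

/-! ### Objects over `Spf R` -/

section Formal

variable {R : Type u} [CommRing R]

/-- The `m`-th infinitesimal neighbourhood `Spec (R / Iᵐ⁺¹)` in `Spf R`, where `R` carries the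
`I`-adic topology. -/
def nbhd (I : Ideal R) (m : ℕ) : Scheme.{u} := Spec (.of (R ⧸ I ^ (m + 1)))

/-- The closed immersion `Spec (R / Iᵐ⁺¹) ⟶ Spec (R / Iᵐ⁺²)`. -/
def nbhdMap (I : Ideal R) (m : ℕ) : nbhd I m ⟶ nbhd I (m + 1) :=
  Spec.map (CommRingCat.ofHom (Ideal.Quotient.factor (Ideal.pow_le_pow_right (Nat.le_succ (m + 1)))))

/-- A tower over `Spf R`: a compatible system of towers over the schemes `Spec (R / Iᵐ⁺¹)`. -/
structure FormalPTower (p : ℕ) (I : Ideal R) where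
  tower : ∀ m, PTower p (nbhd I m)
  trans : ∀ m n, ((tower m).level n).left ⟶ ((tower (m + 1)).level n).left
  isBaseChange : ∀ m n, IsGroupBaseChange (nbhdMap I m) ((tower m).level n)
    ((tower (m + 1)).level n) (trans m n)
  trans_incl : ∀ m n, trans m n ≫ ((tower (m + 1)).incl n).left =
    ((tower m).incl n).left ≫ trans m (n + 1)

namespace FormalPTower

variable {p : ℕ} {I : Ideal R}

/-- Morphisms of towers over `Spf R`: compatible systems of morphisms of towers. -/
@[ext]
structure Hom (G H : FormalPTower p I) where
  app : ∀ m, G.tower m ⟶ H.tower m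
  comm : ∀ m n, ((app m).app n).left ≫ H.trans m n = G.trans m n ≫ ((app (m + 1)).app n).left

instance : Category (FormalPTower p I) where
  Hom := Hom
  id G := ⟨fun _ ↦ 𝟙 _, fun m n ↦ (Category.id_comp _).trans (Category.comp_id _).symm⟩
  comp {G H K} f g := ⟨fun m ↦ f.app m ≫ g.app m, fun m n ↦ by
    change (((f.app m).app n).left ≫ ((g.app m).app n).left) ≫ K.trans m n =
      G.trans m n ≫ ((f.app (m + 1)).app n).left ≫ ((g.app (m + 1)).app n).left
    rw [Category.assoc, g.comm, ← Category.assoc, f.comm, Category.assoc]⟩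
  id_comp f := Hom.ext (funext fun _ ↦ Category.id_comp _)
  comp_id f := Hom.ext (funext fun _ ↦ Category.comp_id _)
  assoc f g h := Hom.ext (funext fun _ ↦ Category.assoc _ _ _)

end FormalPTower

/-- A generalised elliptic curve over `Spf R`: a compatible system of generalised elliptic curves
over the schemes `Spec (R / Iᵐ⁺¹)`. -/
structure FormalGenEllCurve (I : Ideal R) where
  curve : ∀ m, GenEllCurve (nbhd I m)
  trans : ∀ m, GenEllCurve.BaseChange (nbhdMap I m) (curve m) (curve (m + 1))

namespace FormalGenEllCurve

variable {I : Ideal R}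

/-- A homomorphism of generalised elliptic curves over `Spf R`. -/
structure Hom (X Y : FormalGenEllCurve I) where
  app : ∀ m, (X.curve m).Hom (Y.curve m)
  comm : ∀ m, (app m).hom.left ≫ (Y.trans m).map = (X.trans m).map ≫ (app (m + 1)).hom.left

/-- Isogenies over `Spf R`: surjective homomorphisms. -/
def Hom.IsIsogeny {X Y : FormalGenEllCurve I} (f : X.Hom Y) : Prop := ∀ m, (f.app m).IsIsogeny

/-- `δ : R` is the degree of `f`, the local rank of its kernel: over each `Spec (R / Iᵐ⁺¹)` the
kernel is finite locally free, and the section of the structure sheaf given by its rank (a locally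
constant function with values in `ℕ`) is the image of `δ`. -/
def Hom.IsDegree {X Y : FormalGenEllCurve I} (f : X.Hom Y) (δ : R) : Prop :=
  ∀ m, IsFinite (f.app m).kernel.hom ∧ Flat (f.app m).kernel.hom ∧
    LocallyOfFinitePresentation (f.app m).kernel.hom ∧
    ∀ q : PrimeSpectrum (R ⧸ I ^ (m + 1)),
      algebraMap (R ⧸ I ^ (m + 1)) (Localization.AtPrime q.asIdeal) (Ideal.Quotient.mk _ δ) =
        ((f.app m).kernel.hom.finrank q : ℕ)

/-- The tower `E[p^∞]` over `Spf R`. -/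
def pTower (X : FormalGenEllCurve I) (p : ℕ) : FormalPTower p I where
  tower m := (X.curve m).pTower p
  trans m n := (X.trans m).isGroupBaseChange.torsionTrans (p ^ (n + 1))
  isBaseChange m n := (X.trans m).isGroupBaseChange.torsion (p ^ (n + 1))
  trans_incl m n := (X.trans m).isGroupBaseChange.torsionTrans_comp_torsionIncl
    (pow_dvd_pow p (Nat.le_succ (n + 1)))

lemma Hom.comm_sm {X Y : FormalGenEllCurve I} (f : X.Hom Y) (m : ℕ) :
    (f.app m).sm.left ≫ (Y.trans m).sm = (X.trans m).sm ≫ (f.app (m + 1)).sm.left := by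
  rw [← cancel_mono (Y.curve (m + 1)).incl.left, Category.assoc, Category.assoc,
    (Y.trans m).sm_incl, ← Over.comp_left, (f.app (m + 1)).sm_incl, ← Category.assoc,
    ← Over.comp_left, (f.app m).sm_incl, Over.comp_left, Over.comp_left, Category.assoc, f.comm,
    ← Category.assoc, ← Category.assoc, (X.trans m).sm_incl]

/-- The morphism `E[p^∞] ⟶ E'[p^∞]` over `Spf R` induced by a homomorphism. -/
def Hom.pTower {X Y : FormalGenEllCurve I} (f : X.Hom Y) (p : ℕ) : X.pTower p ⟶ Y.pTower p where
  app m := (f.app m).pTower p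
  comm m n := by
    change (torsionMap (f.app m).sm (p ^ (n + 1))).left ≫
        (Y.trans m).isGroupBaseChange.torsionTrans (p ^ (n + 1)) =
      (X.trans m).isGroupBaseChange.torsionTrans (p ^ (n + 1)) ≫
        (torsionMap (f.app (m + 1)).sm (p ^ (n + 1))).left
    rw [← cancel_mono (torsionι (Y.curve (m + 1)).sm (p ^ (n + 1))).left, Category.assoc,
      Category.assoc, IsGroupBaseChange.torsionTrans_ι, ← Over.comp_left, torsionMap_ι,
      ← Category.assoc, ← Over.comp_left, torsionMap_ι, Over.comp_left, Over.comp_left,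
      Category.assoc, f.comm_sm, ← Category.assoc, ← Category.assoc,
      IsGroupBaseChange.torsionTrans_ι]

end FormalGenEllCurve

end Formal

end GenEll

end

noncomputable section

namespace GenEll

/-! ### Finite group schemes over algebraically closed fields, through their points -/

section Points

/-! Everything happens over one `Spec (R / Iᵐ⁺¹)` at a time, and mostly on geometric fibres. Let `K`
be the kernel of `f` on the smooth loci.

`K` is finite locally free. The geometric fibres of `E^sm` are irreducible smooth curves with finite
complement in those of `E`. A nonsmooth point cannot map to a smooth one: its orbit under `E^sm`
stays among finitely many points, while the image of the orbit is a translate of `f(E^sm)`, which is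
infinite. So `E^sm` is the preimage of `E'^sm`, and `f` is proper with finite fibres on it, hence
finite (`isFinite_sm`). For flatness, the graph of `f` is the pullback of the diagonal of a smooth
curve, so it is cut out by one equation near itself, and this equation is a nonzerodivisor on the
integral fibres (`flat_of_noZeroDivisors_fibre`). The rank of `K` is a compatible system of
sections, and completeness turns it into an element of `R` (`existsUnique_isDegree`). As `p` is
nilpotent on each level, this element is a unit if and only if `p` divides none of the ranks
(`isUnit_mk_iff`).

Suppose `f` is an isomorphism on `p`-torsion. Then `K` has no `p`-torsion, with values in any
algebra. On a geometric fibre, in characteristic `p`, tangent vectors at the unit are killed by `p`,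
so there are none and `K` is étale; by Cauchy's theorem its group of points has order prime to `p`
(`not_dvd_finrank`).

Suppose the ranks are prime to `p`. A geometric fibre of `K` is closed in a smooth curve, so its
local ring at the unit is `k[t]/(t ^ n)`. If `n > 1`, an invariant derivation `D` with `D t` a unit
turns `t ^ n = 0` into `n t ^ (n - 1) = 0`, so `p` divides `n`. Hence `n = 1`, the fibre is étale of
order prime to `p`, and `[p]` is bijective on it (`bijective_pow`). By Nakayama's lemma `[p]` is an
automorphism of `K` (`isIso_mulBy_kernel`). Finally a torsion point of `E'^sm` lifts to some `g` on
a faithfully flat cover; dividing `g` by a root in `K` of its power gives a torsion lift, unique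
because `K` has no `p`-power torsion, and the isomorphism descends (`isIso_torsionMap`). -/

/-- The `B`-valued points of `Spec C`, for `k`-algebras `B` and `C`. -/
def Points (k C B : Type u) [CommRing k] [CommRing C] [Algebra k C] [CommRing B] [Algebra k B] :
    Type u :=
  C →ₐ[k] B

namespace Points

variable {k C B B' : Type u} [CommRing k] [CommRing C] [Algebra k C] [CommRing B] [Algebra k B]
  [CommRing B'] [Algebra k B']

/-- A point, as a homomorphism of algebras. -/
def hom (x : Points k C B) : C →ₐ[k] B := x

/-- The functoriality of points. -/
def map (φ : B →ₐ[k] B') (x : Points k C B) : Points k C B' := φ.comp x.hom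

/-- The point given by a homomorphism of algebras. -/
def of (x : C →ₐ[k] B) : Points k C B := x

@[simp] lemma of_hom (x : C →ₐ[k] B) : (of x).hom = x := rfl

lemma ext {x y : Points k C B} (h : ∀ c, x.hom c = y.hom c) : x = y := AlgHom.ext h

end Points

/-- A functorial group structure on the points of `Spec C`. -/
class PointGroup (k C : Type u) [CommRing k] [CommRing C] [Algebra k C] where
  grp : ∀ (B : Type u) [CommRing B] [Algebra k B], Group (Points k C B)
  grp_map_mul : ∀ {B B' : Type u} [CommRing B] [Algebra k B] [CommRing B'] [Algebra k B']
    (φ : B →ₐ[k] B') (x y : Points k C B),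
    Points.map φ ((grp B).mul x y) = (grp B').mul (Points.map φ x) (Points.map φ y)

attribute [reducible, instance] PointGroup.grp

namespace PointGroup

open Points

section Ring

variable {k C : Type u} [CommRing k] [CommRing C] [Algebra k C] [PointGroup k C]
  {B B' : Type u} [CommRing B] [Algebra k B] [CommRing B'] [Algebra k B']

/-- The homomorphism of groups of points induced by a homomorphism of algebras. -/
def mapHom (φ : B →ₐ[k] B') : Points k C B →* Points k C B' :=
  MonoidHom.mk' (Points.map φ) (PointGroup.grp_map_mul φ)

@[simp] lemma mapHom_hom (φ : B →ₐ[k] B') (x : Points k C B) :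
    (mapHom φ x).hom = φ.comp x.hom := rfl

variable (k C) in
/-- The unit section. -/
def unit : C →ₐ[k] k := (1 : Points k C k).hom

lemma one_hom : (1 : Points k C B).hom = (Algebra.ofId k B).comp (unit k C) := by
  have := map_one (mapHom (C := C) (Algebra.ofId k B))
  rw [← this]
  rfl

/-- Translation by a rational point. -/
def translate (g : Points k C k) : C →ₐ[k] C :=
  (of (AlgHom.id k C) * mapHom (Algebra.ofId k C) g).hom

/-- Applying `translate g` to the point `id * h` replaces `id` by `id * g` and leaves the rational
point `h` alone, hence the order `g * h`. -/
lemma translate_comp_translate (g h : Points k C k) :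
    (translate g).comp (translate h) = translate (g * h) := by
  have e : (mapHom (translate g)) (of (AlgHom.id k C) * mapHom (Algebra.ofId k C) h) =
      of (AlgHom.id k C) * mapHom (Algebra.ofId k C) (g * h) := by
    rw [map_mul, map_mul, ← _root_.mul_assoc]
    congr 1
    exact ext fun c ↦ by simp [Algebra.ofId_apply]
  exact congrArg Points.hom e

lemma translate_one : translate (1 : Points k C k) = AlgHom.id k C := by
  rw [translate, map_one, _root_.mul_one, of_hom]

/-- Translation by a rational point, as an automorphism. -/
def translateEquiv (g : Points k C k) : C ≃ₐ[k] C :=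
  AlgEquiv.ofAlgHom (translate g) (translate g⁻¹)
    (by rw [translate_comp_translate, mul_inv_cancel, translate_one])
    (by rw [translate_comp_translate, inv_mul_cancel, translate_one])

/-- Translation by `g` moves the unit to `g`; this is what later carries the local ring at `g` to
the one at the unit. -/
lemma unit_translate (g : Points k C k) (c : C) : unit k C (translate g c) = g.hom c := by
  have e : mapHom (unit k C) (of (AlgHom.id k C) * mapHom (Algebra.ofId k C) g) = g := by
    rw [map_mul]
    have h1 : mapHom (unit k C) (of (AlgHom.id k C)) = 1 := ext fun c ↦ rfl
    have h2 : mapHom (unit k C) (mapHom (Algebra.ofId k C) g) = g :=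
      ext fun c ↦ by simp [Algebra.ofId_apply]
    rw [h1, h2, _root_.one_mul]
  exact congrArg (fun x : Points k C k ↦ x.hom c) e

open TrivSqZeroExt in
/-- Multiplication of tangent vectors at the unit is addition. -/
lemma snd_mul_tangent (x y : Points k C (TrivSqZeroExt k k))
    (hx : ∀ c, (x.hom c).fst = unit k C c) (hy : ∀ c, (y.hom c).fst = unit k C c) (c : C) :
    ((x * y).hom c).snd = (x.hom c).snd + (y.hom c).snd := by
  -- The two vectors are placed along independent infinitesimals. The first projection, the second
  -- projection and their sum recover `x`, `y` and `x * y` from `z`, and the infinitesimal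
  -- coordinate depends linearly on the projection.
  let z : Points k C (TrivSqZeroExt k (k × k)) :=
    mapHom (TrivSqZeroExt.map (LinearMap.inl k k k)) x *
      mapHom (TrivSqZeroExt.map (LinearMap.inr k k k)) y
  have key (f : k × k →ₗ[k] k) : mapHom (TrivSqZeroExt.map f) z =
      mapHom (TrivSqZeroExt.map (f ∘ₗ LinearMap.inl k k k)) x *
      mapHom (TrivSqZeroExt.map (f ∘ₗ LinearMap.inr k k k)) y := by
    rw [map_mul]
    congr 1 <;> exact ext fun c ↦ by simp [TrivSqZeroExt.map_comp_map]
  have hid (w : Points k C (TrivSqZeroExt k k)) :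
      mapHom (TrivSqZeroExt.map (LinearMap.id : k →ₗ[k] k)) w = w :=
    ext fun c ↦ by simp
  have hzero (w : Points k C (TrivSqZeroExt k k)) (hw : ∀ c, (w.hom c).fst = unit k C c) :
      mapHom (TrivSqZeroExt.map (0 : k →ₗ[k] k)) w = 1 := by
    refine ext fun c ↦ ?_
    rw [one_hom]
    refine TrivSqZeroExt.ext ?_ ?_
    · simp [hw, Algebra.ofId_apply, TrivSqZeroExt.algebraMap_eq_inl]
    · simp [Algebra.ofId_apply, TrivSqZeroExt.algebraMap_eq_inl]
  have h1 : mapHom (TrivSqZeroExt.map (LinearMap.fst k k k)) z = x := by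
    rw [key, LinearMap.fst_comp_inl, LinearMap.fst_comp_inr, hid, hzero y hy, _root_.mul_one]
  have h2 : mapHom (TrivSqZeroExt.map (LinearMap.snd k k k)) z = y := by
    rw [key, LinearMap.snd_comp_inl, LinearMap.snd_comp_inr, hid, hzero x hx, _root_.one_mul]
  have h3 : mapHom (TrivSqZeroExt.map (LinearMap.fst k k k + LinearMap.snd k k k)) z = x * y := by
    rw [key]
    congr 1
    · rw [LinearMap.add_comp, LinearMap.fst_comp_inl, LinearMap.snd_comp_inl, add_zero, hid]
    · rw [LinearMap.add_comp, LinearMap.fst_comp_inr, LinearMap.snd_comp_inr, zero_add, hid]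
  have e1 := congrArg (fun w : Points k C (TrivSqZeroExt k k) ↦ (w.hom c).snd) h1
  have e2 := congrArg (fun w : Points k C (TrivSqZeroExt k k) ↦ (w.hom c).snd) h2
  have e3 := congrArg (fun w : Points k C (TrivSqZeroExt k k) ↦ (w.hom c).snd) h3
  simp only [mapHom_hom, AlgHom.comp_apply, snd_map] at e1 e2 e3
  rw [← e1, ← e2, ← e3]
  rfl

lemma snd_pow_tangent (x : Points k C (TrivSqZeroExt k k))
    (hx : ∀ c, (x.hom c).fst = unit k C c) (n : ℕ) (c : C) :
    ((x ^ n).hom c).fst = unit k C c ∧ ((x ^ n).hom c).snd = n • (x.hom c).snd := by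
  have h1 (n : ℕ) (c : C) : ((x ^ n).hom c).fst = unit k C c := by
    have e : mapHom (TrivSqZeroExt.fstHom k k k) x = 1 := ext hx
    have e2 := map_pow (mapHom (TrivSqZeroExt.fstHom k k k)) x n
    rw [e, one_pow] at e2
    exact congrArg (fun w : Points k C k ↦ w.hom c) e2
  refine ⟨h1 n c, ?_⟩
  induction n with
  | zero => simp [one_hom, Algebra.ofId_apply, TrivSqZeroExt.algebraMap_eq_inl]
  | succ n ih => rw [pow_succ, snd_mul_tangent _ _ (h1 n) hx, ih, succ_nsmul]

/-- In characteristic `p`, tangent vectors at the unit are killed by `p`. -/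
lemma tangent_pow_eq_one (p : ℕ) [CharP k p] (x : Points k C (TrivSqZeroExt k k))
    (hx : ∀ c, (x.hom c).fst = unit k C c) : x ^ p = 1 := by
  refine ext fun c ↦ ?_
  obtain ⟨h1, h2⟩ := snd_pow_tangent x hx p c
  rw [one_hom]
  refine TrivSqZeroExt.ext ?_ ?_
  · rw [h1]
    simp [Algebra.ofId_apply, TrivSqZeroExt.algebraMap_eq_inl]
  · rw [h2]
    simp [Algebra.ofId_apply, TrivSqZeroExt.algebraMap_eq_inl]

/-- The functoriality of dual numbers. -/
def dualNumberMap (φ : B →ₐ[k] B') : TrivSqZeroExt B B →ₐ[k] TrivSqZeroExt B' B' where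
  toFun z := (φ z.fst, φ z.snd)
  map_one' := TrivSqZeroExt.ext (_root_.map_one φ) (_root_.map_zero φ)
  map_mul' _ _ := TrivSqZeroExt.ext (_root_.map_mul φ _ _) <|
    (_root_.map_add φ _ _).trans (congr_arg₂ _ (_root_.map_mul φ _ _) (_root_.map_mul φ _ _))
  map_zero' := TrivSqZeroExt.ext (_root_.map_zero φ) (_root_.map_zero φ)
  map_add' _ _ := TrivSqZeroExt.ext (_root_.map_add φ _ _) (_root_.map_add φ _ _)
  commutes' r := TrivSqZeroExt.ext (φ.commutes r) (_root_.map_zero φ)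

lemma fst_dualNumberMap (φ : B →ₐ[k] B') (z : TrivSqZeroExt B B) :
    (dualNumberMap φ z).fst = φ z.fst := rfl

lemma snd_dualNumberMap (φ : B →ₐ[k] B') (z : TrivSqZeroExt B B) :
    (dualNumberMap φ z).snd = φ z.snd := rfl

/-- A tangent vector at the unit extends to an invariant derivation. -/
lemma exists_derivation (x : Points k C (TrivSqZeroExt k k))
    (hx : ∀ c, (x.hom c).fst = unit k C c) :
    ∃ D : C → C, (∀ a b, D (a * b) = a * D b + b * D a) ∧
      ∀ c, unit k C (D c) = (x.hom c).snd := by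
  -- The universal point times the tangent vector `x`, over `C[ε]`. Its first component is the
  -- identity, so it reads `c ↦ c + ε D c`: multiplicativity is the Leibniz rule, and specialisation
  -- at the unit gives back `x`.
  let z : Points k C (TrivSqZeroExt C C) :=
    mapHom (TrivSqZeroExt.inlAlgHom k C C) (of (AlgHom.id k C)) *
      mapHom (dualNumberMap (Algebra.ofId k C)) x
  have h1 : mapHom (TrivSqZeroExt.fstHom k C C) z = of (AlgHom.id k C) := by
    rw [_root_.map_mul]
    have e1 : mapHom (TrivSqZeroExt.fstHom k C C)
        (mapHom (dualNumberMap (Algebra.ofId k C)) x) = 1 := by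
      refine ext fun c ↦ ?_
      rw [one_hom]
      simp [fst_dualNumberMap, hx]
    rw [e1, _root_.mul_one]
    exact ext fun c ↦ by simp
  have hfst (c : C) : (z.hom c).fst = c :=
    congrArg (fun w : Points k C C ↦ w.hom c) h1
  refine ⟨fun c ↦ (z.hom c).snd, fun a b ↦ ?_, fun c ↦ ?_⟩
  · beta_reduce
    rw [_root_.map_mul, TrivSqZeroExt.snd_mul, hfst, hfst]
    simpa using mul_comm _ _
  · have h2 : mapHom (dualNumberMap (unit k C)) z = x := by
      rw [_root_.map_mul]
      have e1 : mapHom (dualNumberMap (unit k C))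
          (mapHom (TrivSqZeroExt.inlAlgHom k C C) (of (AlgHom.id k C))) = 1 := by
        refine ext fun c ↦ ?_
        rw [one_hom]
        refine TrivSqZeroExt.ext ?_ ?_ <;>
        simp [fst_dualNumberMap, snd_dualNumberMap, Algebra.ofId_apply,
          TrivSqZeroExt.algebraMap_eq_inl]
      have e2 : mapHom (dualNumberMap (unit k C))
          (mapHom (dualNumberMap (Algebra.ofId k C)) x) = x := by
        refine ext fun c ↦ ?_
        refine TrivSqZeroExt.ext ?_ ?_ <;>
        simp [fst_dualNumberMap, snd_dualNumberMap, Algebra.ofId_apply]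
      rw [e1, e2, _root_.one_mul]
    exact congrArg (fun w : Points k C (TrivSqZeroExt k k) ↦ (w.hom c).snd) h2

end Ring

end PointGroup

end Points

/-! ### Finite algebras over a field and the local ring at the unit -/

section Points

/-- A finite local algebra over a field, with trivial residue field extension and with maximal
ideal generated by an element `t` of nilpotency index `n`, has dimension `n`. -/
lemma finrank_of_maximalIdeal_eq_span {k L : Type*} [Field k] [CommRing L] [IsLocalRing L]
    [Algebra k L] (hres : ∀ x : L, ∃ a : k, x - algebraMap k L a ∈ IsLocalRing.maximalIdeal L)
    (t : L) (ht : IsLocalRing.maximalIdeal L = Ideal.span {t}) (n : ℕ) (hn : t ^ n = 0)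
    (hn' : ∀ i < n, t ^ i ≠ 0) : Module.finrank k L = n := by
  open Polynomial in
  -- Expansion of `x` in powers of `t` up to order `j`, with coefficients in `k` since the residue
  -- field is `k`.
  have hsurj (x : L) (j : ℕ) : ∃ (P : k[X]) (y : L), x = aeval t P + t ^ j * y := by
    induction j with
    | zero => exact ⟨0, x, by simp⟩
    | succ j ih =>
      obtain ⟨P, y, hy⟩ := ih
      obtain ⟨a, ha⟩ := hres y
      rw [ht, Ideal.mem_span_singleton'] at ha
      obtain ⟨z, hz⟩ := ha
      refine ⟨P + C a * X ^ j, z, ?_⟩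
      rw [hy, ← sub_add_cancel y (algebraMap k L a), ← hz]
      simp
      ring
  open Polynomial in
  -- Write `P = X ^ r * Q` with `Q` nonzero at `0`. Then `aeval t Q` is a unit, so `t ^ r = 0` and
  -- `n ≤ r`.
  have hinj (P : k[X]) (hP : aeval t P = 0) : X ^ n ∣ P := by
    by_cases hP0 : P = 0
    · simp [hP0]
    obtain ⟨Q, hQ, hQ'⟩ := exists_eq_pow_rootMultiplicity_mul_and_not_dvd P hP0 (0 : k)
    rw [C_0, sub_zero] at hQ hQ'
    by_cases hle : n ≤ rootMultiplicity 0 P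
    · rw [hQ]
      exact (pow_dvd_pow _ hle).mul_right _
    · exfalso
      refine hn' _ (not_le.1 hle) ?_
      have hu : IsUnit (aeval t Q) := by
        obtain ⟨Q', hQ''⟩ : X ∣ Q - C (Q.coeff 0) := by simp [X_dvd_iff]
        have h0 : Q.coeff 0 ≠ 0 := fun h ↦ hQ' (X_dvd_iff.2 h)
        have e : Q = C (Q.coeff 0) + X * Q' := by rw [← hQ'']; ring
        rw [e]
        by_contra hnu
        have h1 : aeval t (C (Q.coeff 0) + X * Q') ∈ IsLocalRing.maximalIdeal L := hnu
        have h2 : t * aeval t Q' ∈ IsLocalRing.maximalIdeal L := by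
          rw [ht]
          exact Ideal.mul_mem_right _ _ (Ideal.mem_span_singleton_self t)
        simp only [_root_.map_add, aeval_C, _root_.map_mul, aeval_X] at h1
        have h3 := (Submodule.add_mem_iff_left _ h2).1 h1
        exact h3 ((isUnit_iff_ne_zero.2 h0).map (algebraMap k L))
      rw [hQ, _root_.map_mul, _root_.map_pow, aeval_X] at hP
      exact (hu.mul_left_eq_zero).1 hP
  open Polynomial in
  have hbij : Function.Bijective ((aeval t : k[X] →ₐ[k] L).toLinearMap ∘ₗ
      (degreeLT k n).subtype) := by
    constructor
    · rw [← LinearMap.ker_eq_bot, LinearMap.ker_eq_bot']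
      rintro ⟨P, hP⟩ h
      have h1 := hinj P h
      rw [mem_degreeLT] at hP
      ext1
      by_contra h0
      have h2 := degree_le_of_dvd h1 h0
      rw [degree_X_pow] at h2
      exact absurd hP (not_lt.2 h2)
    · intro x
      obtain ⟨P, y, hy⟩ := hsurj x n
      refine ⟨⟨P %ₘ X ^ n, ?_⟩, ?_⟩
      · rw [mem_degreeLT]
        simpa using degree_modByMonic_lt P (monic_X_pow (R := k) n)
      · have := congrArg (aeval t) (modByMonic_add_div P (X ^ n))
        rw [hy, hn, zero_mul, add_zero, ← this]
        simp [hn]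
  rw [← (LinearEquiv.ofBijective _ hbij).finrank_eq]
  rw [(Polynomial.degreeLTEquiv k n).finrank_eq]
  simp

lemma isArtinianRing_of_finite (k C : Type*) [Field k] [CommRing C] [Algebra k C]
    [Module.Finite k C] : IsArtinianRing C := IsArtinianRing.of_finite k C

namespace Points

variable {k C : Type u} [Field k] [CommRing C] [Algebra k C]

lemma eq_of_ker_eq {g h : Points k C k} (e : RingHom.ker g.hom = RingHom.ker h.hom) : g = h := by
  refine ext fun c ↦ ?_
  have h1 : c - algebraMap k C (g.hom c) ∈ RingHom.ker g.hom := by simp [RingHom.mem_ker]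
  rw [e, RingHom.mem_ker, _root_.map_sub, AlgHom.commutes, sub_eq_zero] at h1
  exact h1.symm

instance (g : Points k C k) : (RingHom.ker g.hom).IsMaximal :=
  RingHom.ker_isMaximal_of_surjective _ fun a ↦ ⟨algebraMap k C a, by simp⟩

variable [Module.Finite k C]

lemma finite_localization (I : Ideal C) [I.IsPrime] :
    Module.Finite k (Localization.AtPrime I) := by
  have := isArtinianRing_of_finite k C
  exact Module.Finite.of_surjective
    (IsScalarTower.toAlgHom k C (Localization.AtPrime I)).toLinearMap
    (IsArtinianRing.localization_surjective I.primeCompl _)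

variable [IsAlgClosed k]

/-- The residue field at `M` is finite over the algebraically closed field `k`, hence equal to it,
so reduction modulo `M` is a rational point. -/
lemma exists_ker_eq (M : Ideal C) [M.IsMaximal] :
    ∃ g : Points k C k, RingHom.ker g.hom = M := by
  let _ : Field (C ⧸ M) := Ideal.Quotient.field M
  have hb : Function.Bijective (algebraMap k (C ⧸ M)) :=
    IsAlgClosed.algebraMap_bijective_of_isIntegral
  let e : k ≃ₐ[k] C ⧸ M := AlgEquiv.ofBijective (Algebra.ofId k (C ⧸ M)) hb
  refine ⟨of (e.symm.toAlgHom.comp (Ideal.Quotient.mkₐ k M)), ?_⟩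
  ext c
  simp [RingHom.mem_ker, Ideal.Quotient.eq_zero_iff_mem]

variable (k C) in
lemma bijective_ker : Function.Bijective
    (fun g : Points k C k ↦ (⟨RingHom.ker g.hom, inferInstance⟩ : MaximalSpectrum C)) :=
  ⟨fun _ _ e ↦ eq_of_ker_eq congr(($e).asIdeal), fun M ↦
    have := M.isMaximal
    let ⟨g, hg⟩ := exists_ker_eq (k := k) M.asIdeal
    ⟨g, MaximalSpectrum.ext hg⟩⟩

variable (k C) in
lemma finite_points : Finite (Points k C k) := by
  have := isArtinianRing_of_finite k C
  exact Finite.of_injective _ (bijective_ker k C).1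

end Points

namespace PointGroup

open Points

variable {k C : Type u} [Field k] [CommRing C] [Algebra k C] [PointGroup k C]

lemma unit_surjective : Function.Surjective (unit k C) := fun a ↦
  ⟨algebraMap k C a, by simp⟩

variable (k C) in
/-- The augmentation ideal. -/
abbrev augmentation : Ideal C := RingHom.ker (unit k C)

instance : (augmentation k C).IsMaximal :=
  RingHom.ker_isMaximal_of_surjective _ unit_surjective

instance : (augmentation k C).IsPrime := Ideal.IsMaximal.isPrime inferInstance

variable (k C) in
/-- The local ring of `Spec C` at the unit. -/
abbrev LocalRing : Type u := Localization.AtPrime (augmentation k C)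

lemma sub_unit_mem (c : C) : c - algebraMap k C (unit k C c) ∈ augmentation k C := by
  simp [RingHom.mem_ker]

/-- A function in the augmentation ideal but not in its square is detected by a tangent vector. -/
lemma exists_tangent (t : C) (ht : t ∈ augmentation k C) (ht' : t ∉ augmentation k C ^ 2) :
    ∃ x : Points k C (TrivSqZeroExt k k), (∀ c, (x.hom c).fst = unit k C c) ∧
      (x.hom t).snd ≠ 0 := by
  -- A functional `l` that vanishes on the square of the augmentation ideal but not at `t`. The
  -- tangent vector is `c ↦ unit c + ε l (c - unit c)`.
  obtain ⟨l, hl', hl⟩ := Submodule.exists_le_ker_of_notMem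
    (p := ((augmentation k C) ^ 2).restrictScalars k) (v := t) (by simpa using ht')
  let x : C →ₐ[k] TrivSqZeroExt k k :=
    { toFun c := (unit k C c, l (c - algebraMap k C (unit k C c)))
      map_one' := TrivSqZeroExt.ext (by exact _root_.map_one (unit k C)) (by
        change l (1 - algebraMap k C (unit k C 1)) = 0
        simp)
      map_zero' := TrivSqZeroExt.ext (by exact _root_.map_zero (unit k C)) (by
        change l (0 - algebraMap k C (unit k C 0)) = 0
        simp)
      map_add' a b := TrivSqZeroExt.ext (by exact _root_.map_add (unit k C) a b) (by
        change l (a + b - algebraMap k C (unit k C (a + b))) =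
          l (a - algebraMap k C (unit k C a)) + l (b - algebraMap k C (unit k C b))
        rw [← _root_.map_add, _root_.map_add, _root_.map_add]
        congr 1
        ring)
      map_mul' a b := TrivSqZeroExt.ext (by exact _root_.map_mul (unit k C) a b) (by
        change l (a * b - algebraMap k C (unit k C (a * b))) =
          unit k C a • l (b - algebraMap k C (unit k C b)) +
            MulOpposite.op (unit k C b) • l (a - algebraMap k C (unit k C a))
        have h1 :
            l ((a - algebraMap k C (unit k C a)) * (b - algebraMap k C (unit k C b))) = 0 := by
          refine hl ?_
          rw [Submodule.restrictScalars_mem, pow_two]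
          exact Ideal.mul_mem_mul (sub_unit_mem a) (sub_unit_mem b)
        have e : a * b - algebraMap k C (unit k C (a * b)) =
          (a - algebraMap k C (unit k C a)) * (b - algebraMap k C (unit k C b)) +
            (unit k C a • (b - algebraMap k C (unit k C b)) +
            unit k C b • (a - algebraMap k C (unit k C a))) := by
          rw [_root_.map_mul, _root_.map_mul, Algebra.smul_def, Algebra.smul_def]
          ring
        rw [e, _root_.map_add, h1, zero_add, _root_.map_add, _root_.map_smul, _root_.map_smul]
        simp [mul_comm])
      commutes' r := TrivSqZeroExt.ext (by exact (unit k C).commutes r) (by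
        change l (_ - algebraMap k C (unit k C _)) = _
        simp [TrivSqZeroExt.algebraMap_eq_inl]) }
  refine ⟨of x, fun c ↦ rfl, ?_⟩
  change l (t - algebraMap k C (unit k C t)) ≠ 0
  rw [RingHom.mem_ker] at ht
  have ht2 : unit k C t = 0 := ht
  rwa [ht2, _root_.map_zero, sub_zero]

/-- Translation by `g` is an automorphism of `C` that matches the complements of the two ideals. -/
lemma finrank_localization_ker (g : Points k C k) :
    Module.finrank k (Localization.AtPrime (RingHom.ker g.hom)) =
      Module.finrank k (LocalRing k C) := by
  refine LinearEquiv.finrank_eq (AlgEquiv.toLinearEquiv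
    (IsLocalization.algEquivOfAlgEquiv (M := (RingHom.ker g.hom).primeCompl)
      (T := (augmentation k C).primeCompl) _ _ (translateEquiv g) ?_))
  ext c
  constructor
  · rintro ⟨d, hd, rfl⟩ h
    refine hd ?_
    rw [SetLike.mem_coe, RingHom.mem_ker] at h ⊢
    rw [← unit_translate]
    exact h
  · intro hc
    refine ⟨(translateEquiv g).symm c, ?_, (translateEquiv g).apply_symm_apply c⟩
    intro h
    refine hc ?_
    rw [SetLike.mem_coe, RingHom.mem_ker] at h ⊢
    rw [← unit_translate] at h
    have e : translate g ((translateEquiv g).symm c) = c := (translateEquiv g).apply_symm_apply c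
    rwa [e] at h

variable [Module.Finite k C]

lemma exists_sub_mem_maximalIdeal (x : LocalRing k C) :
    ∃ a : k, x - algebraMap k _ a ∈ IsLocalRing.maximalIdeal (LocalRing k C) := by
  have := isArtinianRing_of_finite k C
  obtain ⟨c, rfl⟩ := IsArtinianRing.localization_surjective (augmentation k C).primeCompl
    (LocalRing k C) x
  refine ⟨unit k C c, ?_⟩
  rw [IsScalarTower.algebraMap_apply k C, ← _root_.map_sub,
    ← Localization.AtPrime.map_eq_maximalIdeal]
  exact Ideal.mem_map_of_mem _ (sub_unit_mem c)

/-- The case `t = 0`, `n = 1` of `finrank_of_maximalIdeal_eq_span`. -/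
lemma finrank_localRing_eq_one (h : IsLocalRing.maximalIdeal (LocalRing k C) = ⊥) :
    Module.finrank k (LocalRing k C) = 1 :=
  finrank_of_maximalIdeal_eq_span exists_sub_mem_maximalIdeal 0 (by simp [h]) 1 (by simp)
    (fun i hi ↦ by simp [Nat.lt_one_iff.1 hi])

/-- The local ring at the unit is a field if there are no tangent vectors. -/
lemma maximalIdeal_eq_bot_of_le (h : augmentation k C ≤ augmentation k C ^ 2) :
    IsLocalRing.maximalIdeal (LocalRing k C) = ⊥ := by
  have := finite_localization (k := k) (augmentation k C)
  have := isArtinianRing_of_finite k (LocalRing k C)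
  refine Submodule.eq_bot_of_le_smul_of_le_jacobson_bot (IsLocalRing.maximalIdeal (LocalRing k C)) _
    (IsNoetherian.noetherian _) ?_ (IsLocalRing.maximalIdeal_le_jacobson _)
  rw [smul_eq_mul, ← pow_two, ← Localization.AtPrime.map_eq_maximalIdeal, ← Ideal.map_pow]
  exact Ideal.map_mono h

/-- If the maximal ideal at the unit is principal, then the dimension of the local ring at the unit
is `1` or divisible by the characteristic. -/
lemma finrank_localRing_eq_one_or_cast_eq_zero
    (hprin : (IsLocalRing.maximalIdeal (LocalRing k C)).IsPrincipal) :
    Module.finrank k (LocalRing k C) = 1 ∨ (Module.finrank k (LocalRing k C) : k) = 0 := by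
  have := finite_localization (k := k) (augmentation k C)
  have := isArtinianRing_of_finite k C
  have := isArtinianRing_of_finite k (LocalRing k C)
  obtain ⟨t', ht'⟩ := hprin
  rw [Ideal.submodule_span_eq] at ht'
  obtain ⟨t, rfl⟩ := IsArtinianRing.localization_surjective (augmentation k C).primeCompl
    (LocalRing k C) t'
  set L := LocalRing k C
  have htM : t ∈ augmentation k C := by
    rw [← IsLocalization.AtPrime.to_map_mem_maximal_iff L (augmentation k C), ht']
    exact Ideal.mem_span_singleton_self _
  have hnil : IsNilpotent (algebraMap C L t) := by
    obtain ⟨n, hn⟩ := IsArtinianRing.isNilpotent_jacobson_bot (R := L)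
    refine ⟨n, ?_⟩
    have h1 : algebraMap C L t ∈ Ideal.jacobson (⊥ : Ideal L) := by
      rw [IsLocalRing.jacobson_eq_maximalIdeal ⊥ bot_ne_top, ht']
      exact Ideal.mem_span_singleton_self _
    have h2 := Ideal.pow_mem_pow h1 n
    rw [hn] at h2
    simpa using h2
  classical
  let n := Nat.find hnil
  have hn : algebraMap C L t ^ n = 0 := Nat.find_spec hnil
  have hn' : ∀ i < n, algebraMap C L t ^ i ≠ 0 := fun i hi ↦ Nat.find_min hnil hi
  have hdim : Module.finrank k L = n :=
    finrank_of_maximalIdeal_eq_span exists_sub_mem_maximalIdeal _ ht' n hn hn'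
  rw [hdim]
  by_contra! hcon
  obtain ⟨hn1, hn0⟩ := hcon
  have hnpos : n ≠ 0 := fun h ↦ hn0 (by simp [h])
  -- Otherwise Nakayama's lemma would kill the maximal ideal and make the dimension `1`.
  have htsq : t ∉ augmentation k C ^ 2 := by
    intro h
    have h1 : IsLocalRing.maximalIdeal L = ⊥ := by
      refine Submodule.eq_bot_of_le_smul_of_le_jacobson_bot (IsLocalRing.maximalIdeal L) _
        (IsNoetherian.noetherian _) ?_ (IsLocalRing.maximalIdeal_le_jacobson _)
      rw [smul_eq_mul, ← pow_two]
      conv_lhs => rw [ht']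
      rw [Ideal.span_le, Set.singleton_subset_iff, ← Localization.AtPrime.map_eq_maximalIdeal,
        ← Ideal.map_pow]
      exact Ideal.mem_map_of_mem _ h
    exact hn1 (hdim.symm.trans (finrank_localRing_eq_one h1))
  obtain ⟨x, hx, hxt⟩ := exists_tangent t htM htsq
  obtain ⟨D, hD, hDx⟩ := exists_derivation x hx
  have hDpow (m : ℕ) : D (t ^ (m + 1)) = (m + 1 : ℕ) * t ^ m * D t := by
    induction m with
    | zero => simp
    | succ m ih =>
      rw [pow_succ, hD, ih]
      push_cast
      ring
  obtain ⟨m, hm⟩ := Nat.exists_eq_succ_of_ne_zero hnpos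
  have hm' : n = m + 1 := hm
  -- The derivation lives on `C`, not on its localisation, so `t ^ n = 0` is first lifted to `s * t
  -- ^ n = 0` with `s` invertible at the unit.
  rw [← _root_.map_pow, IsLocalization.map_eq_zero_iff (augmentation k C).primeCompl] at hn
  obtain ⟨⟨s, hs⟩, hst⟩ := hn
  have hD0 : D 0 = 0 := by
    have := hD 0 0
    simpa using this
  -- Differentiating `s * t ^ n = 0` gives `s * D (t ^ n) + t ^ n * D s = 0`; a second factor `s`
  -- removes the last term.
  have h1 : s * s * ((n : ℕ) * t ^ m * D t) = 0 := by
    have h2 := hD s (t ^ n)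
    rw [hst, hD0, hm', hDpow, ← hm'] at h2
    have h3 := congrArg (s * ·) h2
    simp only [mul_zero, mul_add] at h3
    have h4 : s * (t ^ n * D s) = 0 := by
      rw [← _root_.mul_assoc]
      simp only at hst
      rw [hst, zero_mul]
    rw [h4, add_zero] at h3
    rw [_root_.mul_assoc]
    exact h3.symm
  have h2 := congrArg (algebraMap C L) h1
  simp only [_root_.map_mul, _root_.map_zero, _root_.map_pow, map_natCast] at h2
  have hsu : IsUnit (algebraMap C L s) :=
    IsLocalization.map_units L (⟨s, hs⟩ : (augmentation k C).primeCompl)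
  have hDu : IsUnit (algebraMap C L (D t)) := by
    refine IsLocalization.map_units L (⟨D t, ?_⟩ : (augmentation k C).primeCompl)
    intro h
    rw [SetLike.mem_coe, RingHom.mem_ker] at h
    exact hxt ((hDx t).symm.trans h)
  have hnu : IsUnit ((n : ℕ) : L) := by
    have := (isUnit_iff_ne_zero.2 hn0).map (algebraMap k L)
    rwa [map_natCast] at this
  -- In `L` the factors `s`, `D t` and `n` are units, which leaves `t ^ (n - 1) = 0`, against the
  -- minimality of `n`.
  rw [(hsu.mul hsu).mul_right_eq_zero, hDu.mul_left_eq_zero, hnu.mul_right_eq_zero] at h2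
  exact hn' m (by omega) h2

variable [IsAlgClosed k]

variable (k C) in
/-- The order of a finite group scheme is the number of its points times the order of its local
ring at the unit. -/
lemma finrank_eq_mul : Module.finrank k C =
    Nat.card (Points k C k) * Module.finrank k (LocalRing k C) := by
  have := isArtinianRing_of_finite k C
  have := Fintype.ofFinite (MaximalSpectrum C)
  have (I : MaximalSpectrum C) := finite_localization (k := k) I.asIdeal
  -- An Artinian ring is the product of its localisations; here they are indexed by the rational
  -- points and have equal dimensions.
  rw [((MaximalSpectrum.toPiLocalizationEquiv C).restrictScalars k).toLinearEquiv.finrank_eq]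
  change Module.finrank k (Π I : MaximalSpectrum C, Localization.AtPrime I.asIdeal) = _
  rw [Module.finrank_pi_fintype, Nat.card_congr (Equiv.ofBijective _ (bijective_ker k C)),
    Nat.card_eq_fintype_card, Finset.sum_congr rfl (g := fun _ ↦ Module.finrank k (LocalRing k C)),
    Finset.sum_const, Finset.card_univ, smul_eq_mul]
  intro I _
  obtain ⟨g, rfl⟩ := (bijective_ker k C).2 I
  exact finrank_localization_ker g

/-- A finite group scheme without `p`-torsion in characteristic `p` has order prime to `p`. -/
theorem not_dvd_finrank (p : ℕ) [Fact p.Prime] [CharP k p]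
    (h : ∀ (B : Type u) [CommRing B] [Algebra k B] (x : Points k C B), x ^ p = 1 → x = 1) :
    ¬ p ∣ Module.finrank k C := by
  -- A function outside the square would be detected by a tangent vector. Tangent vectors are
  -- `p`-torsion points, hence trivial.
  have hle : augmentation k C ≤ augmentation k C ^ 2 := by
    intro t ht
    by_contra ht'
    obtain ⟨x, hx, hxt⟩ := exists_tangent t ht ht'
    have := h _ x (tangent_pow_eq_one p x hx)
    subst this
    refine hxt ?_
    simp [one_hom, Algebra.ofId_apply, TrivSqZeroExt.algebraMap_eq_inl]
  rw [finrank_eq_mul, finrank_localRing_eq_one (maximalIdeal_eq_bot_of_le hle), _root_.mul_one]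
  intro hdvd
  have := finite_points k C
  -- Cauchy's theorem for the finite group of rational points.
  obtain ⟨x, hx⟩ := exists_prime_orderOf_dvd_card' p hdvd
  have h1 := h k x (by rw [← hx, pow_orderOf_eq_one])
  rw [h1, orderOf_one] at hx
  exact (Fact.out : p.Prime).one_lt.ne hx

/-- If the order is prime to the characteristic `p`, and the maximal ideal at the unit is
principal, then multiplication by `p` is an automorphism. -/
theorem bijective_pow (p : ℕ) [Fact p.Prime] [CharP k p]
    (hprin : (IsLocalRing.maximalIdeal (LocalRing k C)).IsPrincipal)
    (h : ¬ p ∣ Module.finrank k C) :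
    Function.Bijective (of (AlgHom.id k C) ^ p).hom := by
  have := isArtinianRing_of_finite k C
  have h1 : Module.finrank k (LocalRing k C) = 1 := by
    refine (finrank_localRing_eq_one_or_cast_eq_zero hprin).resolve_right fun h0 ↦ h ?_
    rw [finrank_eq_mul]
    exact ((CharP.cast_eq_zero_iff k p _).1 h0).mul_left _
  have h2 : ¬ p ∣ Nat.card (Points k C k) := by
    rwa [finrank_eq_mul, h1, _root_.mul_one] at h
  have hfin := finite_points k C
  have hsurj : Function.Surjective (fun g : Points k C k ↦ g ^ p) := by
    have hcop : (Nat.card (Points k C k)).Coprime p :=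
      ((Fact.out : p.Prime).coprime_iff_not_dvd.2 h2).symm
    exact (powCoprime hcop).surjective
  -- A function killed by the comorphism of `[p]` vanishes at all `p`-th powers, which are all the
  -- rational points. The local rings being `k` itself, such a function is zero. Surjectivity
  -- follows by dimension.
  have hinj : Function.Injective (of (AlgHom.id k C) ^ p).hom := by
    rw [injective_iff_map_eq_zero]
    intro c hc
    have hg (g : Points k C k) : g.hom c = 0 := by
      obtain ⟨g, rfl⟩ := hsurj g
      have e : mapHom g.hom (of (AlgHom.id k C) ^ p) = g ^ p := by
        rw [_root_.map_pow]
        rfl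
      have e2 := congrArg (fun x : Points k C k ↦ x.hom c) e
      simp only [mapHom_hom, AlgHom.comp_apply, hc, _root_.map_zero] at e2
      exact e2.symm
    refine MaximalSpectrum.toPiLocalization_injective C ?_
    rw [_root_.map_zero]
    funext I
    obtain ⟨g, rfl⟩ := (bijective_ker k C).2 I
    change algebraMap C (Localization.AtPrime (RingHom.ker g.hom)) c = 0
    have hf := finite_localization (k := k) (RingHom.ker g.hom)
    have hd : Module.finrank k (Localization.AtPrime (RingHom.ker g.hom)) = 1 :=
      (finrank_localization_ker g).trans h1
    have hm : algebraMap C (Localization.AtPrime (RingHom.ker g.hom)) c ∈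
        IsLocalRing.maximalIdeal _ := by
      rw [IsLocalization.AtPrime.to_map_mem_maximal_iff _ (RingHom.ker g.hom)]
      exact hg g
    obtain ⟨a, ha⟩ := (finrank_eq_one_iff_of_nonzero' (1 : Localization.AtPrime (RingHom.ker g.hom))
      one_ne_zero).1 hd (algebraMap C _ c)
    rw [← ha] at hm ⊢
    by_cases ha0 : a = 0
    · rw [ha0, zero_smul]
    · exfalso
      rw [← Algebra.algebraMap_eq_smul_one] at hm
      exact hm ((isUnit_iff_ne_zero.2 ha0).map _)
  exact ⟨hinj, LinearMap.surjective_of_injective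
    (f := (of (AlgHom.id k C) ^ p).hom.toLinearMap) hinj⟩

end PointGroup

end Points

/-! ### Flatness of maps to smooth curves -/

section Flatness

open scoped TensorProduct

/-- If the differentials are generated by one element, the diagonal is cut out by one equation in a
neighbourhood `u ≠ 0` of itself. -/
lemma exists_generator_near_diagonal {R A : Type*} [CommRing R] [CommRing A] [Algebra R A]
    [Algebra.FiniteType R A] (ω : Ω[A⁄R]) (hω : Submodule.span A {ω} = ⊤) :
    ∃ t u : A ⊗[R] A, t ∈ KaehlerDifferential.ideal R A ∧ u - 1 ∈ KaehlerDifferential.ideal R A ∧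
      ∀ x ∈ KaehlerDifferential.ideal R A, ∃ z, u * x = t * z := by
  set J := KaehlerDifferential.ideal R A
  obtain ⟨t, ht⟩ := J.toCotangent_surjective ω
  -- Lifting the fact that `ω` generates `J/J²` gives `J ⊆ (t) + J²`. As `J` is finitely generated,
  -- Nakayama's lemma provides `u ∈ 1 + J` with `u J ⊆ (t)`.
  have hle : J ≤ Ideal.span {(t : A ⊗[R] A)} ⊔ J • J := by
    intro x hx
    obtain ⟨a, ha⟩ := (Submodule.span_singleton_eq_top_iff A ω).1 hω (J.toCotangent ⟨x, hx⟩)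
    have h2 : J.toCotangent ((a ⊗ₜ[R] (1 : A)) • t) = J.toCotangent ⟨x, hx⟩ := by
      rw [_root_.map_smul, ht]
      exact (algebra_compatible_smul (A ⊗[R] A) a ω).symm.trans ha
    rw [Ideal.toCotangent_eq, pow_two] at h2
    have e : x = a ⊗ₜ[R] (1 : A) * t - (a ⊗ₜ[R] (1 : A) * t - x) := by ring
    rw [e]
    refine Submodule.sub_mem _ (Submodule.mem_sup_left ?_) (Submodule.mem_sup_right h2)
    exact Ideal.mul_mem_left _ _ (Ideal.mem_span_singleton_self _)
  obtain ⟨u, hu, hu'⟩ := Submodule.exists_sub_one_mem_and_smul_le_of_fg_of_le_sup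
    (KaehlerDifferential.ideal_fg R A) le_rfl hle
  refine ⟨t, u, t.2, hu, fun x hx ↦ ?_⟩
  have := hu' (Submodule.smul_mem_pointwise_smul x u J hx)
  rw [smul_eq_mul, Ideal.mem_span_singleton'] at this
  obtain ⟨z, hz⟩ := this
  exact ⟨z, by rw [← hz, mul_comm]⟩

/-- Let `C` be finitely presented as a module over a local ring `A`, and a quotient of a flat
`A`-algebra `B`, cut out by one equation `b` in a neighbourhood `u ≠ 0` of `Spec C`. If `b` is a
nonzerodivisor on the closed fibre of this neighbourhood, then `C` is free. -/
lemma free_of_isLocalRing {A B C : Type*} [CommRing A] [IsLocalRing A] [CommRing B] [Algebra A B]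
    [CommRing C] [Algebra A C] [Module.Flat A B] [Module.FinitePresentation A C]
    (π : B →ₐ[A] C) (hπ : Function.Surjective π) (b u : B) (hb : π b = 0) (hu : π u = 1)
    (hker : ∀ x, π x = 0 → ∃ z, u * x = b * z)
    (hnzd : ∀ z, b * z ∈ (IsLocalRing.maximalIdeal A).map (algebraMap A B) →
      ∃ N : ℕ, u ^ N * z ∈ (IsLocalRing.maximalIdeal A).map (algebraMap A B)) :
    Module.Free A C := by
  set 𝔪 := IsLocalRing.maximalIdeal A
  -- By flatness `i` is injective, and its image is `𝔪 B`: elements of `𝔪 ⊗ B` can be compared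
  -- inside `B`.
  let i : 𝔪 ⊗[A] B →ₗ[A] B := (TensorProduct.lid A B).toLinearMap ∘ₗ 𝔪.subtype.rTensor B
  have hi : Function.Injective i := (TensorProduct.lid A B).injective.comp
    (Module.Flat.rTensor_preserves_injective_linearMap 𝔪.subtype Subtype.val_injective)
  have hmul (c : B) (y : 𝔪 ⊗[A] B) : i ((LinearMap.mulLeft A c).lTensor 𝔪 y) = c * i y := by
    induction y with
    | zero => simp
    | add x y hx hy => simp only [_root_.map_add, mul_add, hx, hy]
    | tmul m x => simp [i]
  have hrange (z : B) (hz : z ∈ 𝔪.map (algebraMap A B)) : ∃ y, i y = z := by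
    rw [← Submodule.restrictScalars_mem A, ← Ideal.smul_top_eq_map] at hz
    induction hz using Submodule.smul_induction_on' with
    | smul m hm x _ => exact ⟨⟨m, hm⟩ ⊗ₜ x, by simp [i]⟩
    | add x hx y hy hx' hy' =>
      obtain ⟨x', rfl⟩ := hx'
      obtain ⟨y', rfl⟩ := hy'
      exact ⟨x' + y', _root_.map_add _ _ _⟩
  have himage (y : 𝔪 ⊗[A] B) : i y ∈ 𝔪.map (algebraMap A B) := by
    induction y with
    | zero => simp
    | add x y hx hy =>
      rw [_root_.map_add]
      exact Ideal.add_mem _ hx hy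
    | tmul m x =>
      have e : i (m ⊗ₜ x) = algebraMap A B m * x := by simp [i, Algebra.smul_def]
      rw [e]
      exact Ideal.mul_mem_right _ _ (Ideal.mem_map_of_mem _ m.2)
  have hπi (y : 𝔪 ⊗[A] B) : TensorProduct.lid A C (𝔪.subtype.rTensor C
      (π.toLinearMap.lTensor 𝔪 y)) = π (i y) := by
    induction y with
    | zero => simp
    | add x y hx hy => simp only [_root_.map_add, hx, hy]
    | tmul m x => simp [i]
  have hπmul (c : B) (y : 𝔪 ⊗[A] B) : π.toLinearMap.lTensor 𝔪 ((LinearMap.mulLeft A c).lTensor 𝔪 y)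
      = (LinearMap.mulLeft A (π c)).lTensor 𝔪 (π.toLinearMap.lTensor 𝔪 y) := by
    rw [← LinearMap.comp_apply, ← LinearMap.comp_apply, ← LinearMap.lTensor_comp,
      ← LinearMap.lTensor_comp]
    congr 2
    ext x
    simp
  -- It remains to see that `𝔪 ⊗ C → C` is injective. Lift a kernel element to `y` in `𝔪 ⊗ B`. Then
  -- `u * i y = b * z`, and the hypothesis on the closed fibre puts `u ^ N * z` in `𝔪 B`. Thus `u ^
  -- (N + 1) * y` is `b` times an element of `𝔪 ⊗ B`; now `π` sends `u` to `1` and `b` to `0`.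
  refine Module.free_of_maximalIdeal_rTensor_injective ?_
  rw [injective_iff_map_eq_zero]
  intro w hw
  obtain ⟨y, rfl⟩ := LinearMap.lTensor_surjective 𝔪 (g := π.toLinearMap) hπ w
  have h1 : π (i y) = 0 := by rw [← hπi, hw, _root_.map_zero]
  obtain ⟨z, hz⟩ := hker _ h1
  obtain ⟨N, hN⟩ := hnzd z (by
    rw [← hz]
    refine Ideal.mul_mem_left _ _ ?_
    exact himage y)
  obtain ⟨z', hz'⟩ := hrange _ hN
  have h2 : (LinearMap.mulLeft A (u ^ (N + 1))).lTensor 𝔪 y =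
      (LinearMap.mulLeft A b).lTensor 𝔪 z' := by
    refine hi ?_
    rw [hmul, hmul, hz', pow_succ, _root_.mul_assoc, hz]
    ring
  have h3 := congrArg (π.toLinearMap.lTensor 𝔪) h2
  rw [hπmul, hπmul, hb, _root_.map_pow, hu, one_pow, LinearMap.mulLeft_one,
    LinearMap.mulLeft_zero_eq_zero, LinearMap.lTensor_zero, LinearMap.lTensor_id] at h3
  exact h3

/-- Let `A` be an `R`-algebra whose differentials are generated by one element, and let `C` be
an `A`-algebra which is flat over `R` and finitely presented as an `A`-module. If the fibres
`κ(𝔭) ⊗[R] C`, for primes `𝔭` of `A`, have no zero divisors and are not finite over `κ(𝔭)` unless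
they vanish, then `C` is flat over `A`. -/
theorem flat_of_noZeroDivisors_fibre {R A C : Type u} [CommRing R] [CommRing A] [CommRing C]
    [Algebra R A] [Algebra R C] [Algebra A C] [IsScalarTower R A C] [Algebra.FiniteType R A]
    [Module.Flat R C] [Module.FinitePresentation A C]
    (ω : Ω[A⁄R]) (hω : Submodule.span A {ω} = ⊤)
    (h₁ : ∀ (p : Ideal A) [p.IsPrime], NoZeroDivisors (p.ResidueField ⊗[R] C))
    (h₂ : ∀ (p : Ideal A) [p.IsPrime], Module.Finite p.ResidueField (p.ResidueField ⊗[R] C) →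
      Subsingleton (p.ResidueField ⊗[R] C)) :
    Module.Flat A C := by
  obtain ⟨t, u, ht, hu, htu⟩ := exists_generator_near_diagonal ω hω
  -- Geometrically `φ` maps `Spec A' × Spec C` to `Spec A × Spec A` over `R`. The subscheme `Spec
  -- (A' ⊗[A] C)` is the preimage of the diagonal, so it inherits from it the single equation `φ t`
  -- near itself.
  let φ (A' : Type u) [CommRing A'] [Algebra A A'] [Algebra R A'] [IsScalarTower R A A'] :
      A ⊗[R] A →ₐ[R] A' ⊗[R] C :=
    Algebra.TensorProduct.map (IsScalarTower.toAlgHom R A A') (IsScalarTower.toAlgHom R A C)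
  let π (A' : Type u) [CommRing A'] [Algebra A A'] [Algebra R A'] [IsScalarTower R A A'] :
      A' ⊗[R] C →ₐ[A'] A' ⊗[A] C := Algebra.TensorProduct.mapOfCompatibleSMul A R A' A' C
  have hker (A' : Type u) [CommRing A'] [Algebra A A'] [Algebra R A'] [IsScalarTower R A A']
      (x : A' ⊗[R] C) : π A' x = 0 ↔ x ∈ (KaehlerDifferential.ideal R A).map (φ A') := by
    constructor
    · intro hx
      replace hx : x ∈ (TensorProduct.mapOfCompatibleSMul A R A A' C).ker := hx
      rw [TensorProduct.AlgebraTensorModule.ker_mapOfCompatibleSMul] at hx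
      induction hx using Submodule.span_induction with
      | zero => exact Submodule.zero_mem _
      | add x y _ _ hx hy => exact Ideal.add_mem _ hx hy
      | smul a x _ hx =>
        rw [Algebra.smul_def]
        exact Ideal.mul_mem_left _ _ hx
      | mem x hx =>
        obtain ⟨a, m, c, rfl⟩ := hx
        have e : (a • m) ⊗ₜ[R] c - m ⊗ₜ[R] (a • c) =
            m ⊗ₜ[R] c * -φ A' ((1 : A) ⊗ₜ[R] a - a ⊗ₜ[R] (1 : A)) := by
          simp [φ, mul_sub, Algebra.smul_def, mul_comm]
        rw [e]
        refine Ideal.mul_mem_left _ _ (Submodule.neg_mem _ (Ideal.mem_map_of_mem _ ?_))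
        rw [← KaehlerDifferential.span_range_eq_ideal]
        exact Ideal.subset_span ⟨a, rfl⟩
    · intro hx
      change x ∈ RingHom.ker (π A')
      revert x
      change Ideal.map (φ A') _ ≤ _
      rw [← KaehlerDifferential.span_range_eq_ideal, Ideal.map_span, Ideal.span_le]
      rintro _ ⟨_, ⟨a, rfl⟩, rfl⟩
      have e : (1 : A') ⊗ₜ[A] algebraMap A C a = algebraMap A A' a ⊗ₜ[A] (1 : C) := by
        rw [Algebra.algebraMap_eq_smul_one, Algebra.algebraMap_eq_smul_one,
          TensorProduct.tmul_smul, TensorProduct.smul_tmul']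
      simp [φ, π, RingHom.mem_ker, e]
  have hu' (A' : Type u) [CommRing A'] [Algebra A A'] [Algebra R A'] [IsScalarTower R A A'] :
      π A' (φ A' u) = 1 := by
    have := (hker A' _).2 (Ideal.mem_map_of_mem (φ A') hu)
    rwa [_root_.map_sub, _root_.map_one, _root_.map_sub, _root_.map_one, sub_eq_zero] at this
  have htu' (A' : Type u) [CommRing A'] [Algebra A A'] [Algebra R A'] [IsScalarTower R A A']
      (x : A' ⊗[R] C) (hx : π A' x = 0) : ∃ z, φ A' u * x = φ A' t * z := by
    rw [hker] at hx
    induction hx using Submodule.span_induction with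
    | zero => exact ⟨0, by simp⟩
    | add x y _ _ hx hy =>
      obtain ⟨z, hz⟩ := hx
      obtain ⟨w, hw⟩ := hy
      exact ⟨z + w, by rw [mul_add, mul_add, hz, hw]⟩
    | smul a x _ hx =>
      obtain ⟨z, hz⟩ := hx
      exact ⟨a * z, by rw [smul_eq_mul, mul_left_comm, hz, mul_left_comm]⟩
    | mem x hx =>
      obtain ⟨y, hy, rfl⟩ := hx
      obtain ⟨z, hz⟩ := htu y hy
      refine ⟨φ A' z, ?_⟩
      exact (_root_.map_mul (φ A') u y).symm.trans
        ((congrArg _ hz).trans (_root_.map_mul (φ A') t z))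
  -- Over a localisation `A'` of `A`, the algebra `A' ⊗[R] C` is flat by base change from `R`, and
  -- the free module criterion applies to its quotient `A' ⊗[A] C`.
  refine Module.flat_of_isLocalized_maximal (R := A) A C
    (fun P _ ↦ Localization.AtPrime P ⊗[A] C) (fun P _ ↦ TensorProduct.mk A _ C 1) fun P _ ↦ ?_
  set A' := Localization.AtPrime P
  have hfree : Module.Free A' (A' ⊗[A] C) := by
    refine free_of_isLocalRing (π A')
      (Algebra.TensorProduct.mapOfCompatibleSMul_surjective A R A' A' C) (φ A' t) (φ A' u)
      ((hker A' _).2 (Ideal.mem_map_of_mem _ ht)) (hu' A') (htu' A') fun z hz ↦ ?_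
    let κ := P.ResidueField
    let ρ₀ : A' →ₐ[R] κ := IsScalarTower.toAlgHom R A' κ
    have hρ₀ : Function.Surjective ρ₀ := IsLocalRing.residue_surjective
    let ρ : A' ⊗[R] C →ₐ[R] κ ⊗[R] C := Algebra.TensorProduct.map ρ₀ (AlgHom.id R C)
    have hρ (x : A' ⊗[R] C) : ρ x = 0 ↔
        x ∈ (IsLocalRing.maximalIdeal A').map (algebraMap A' (A' ⊗[R] C)) := by
      have h := Algebra.TensorProduct.rTensor_ker (R := R) (C := C) ρ₀ hρ₀
      have h0 : RingHom.ker ρ₀ = IsLocalRing.maximalIdeal A' := IsLocalRing.ker_residue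
      rw [h0] at h
      change x ∈ RingHom.ker ρ ↔ _
      rw [h]
      rfl
    have hρφ (y : A ⊗[R] A) : ρ (φ A' y) = φ κ y := by
      induction y with
      | zero => simp
      | add x y hx hy => simp only [_root_.map_add, hx, hy]
      | tmul a b => simp [ρ, φ, ρ₀, ← IsScalarTower.algebraMap_apply]
    have := h₁ P
    rw [← hρ, _root_.map_mul, hρφ, mul_eq_zero] at hz
    -- The fibre has no zero divisors, so `φ t` or `z` vanishes there. If `φ t` vanishes and `φ u`
    -- does not, then `π κ` is injective, the fibre is finite over `κ`, and `h₂` makes it trivial.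
    -- If `φ u` vanishes, one power of it suffices.
    rcases hz with hz | hz
    · by_cases hu0 : φ κ u = 0
      · exact ⟨1, by rw [← hρ, _root_.map_mul, _root_.map_pow, hρφ, hu0, pow_one, zero_mul]⟩
      · have hinj : Function.Injective (π κ) := by
          rw [injective_iff_map_eq_zero]
          intro x hx
          obtain ⟨w, hw⟩ := htu' κ x hx
          rw [hz, zero_mul, mul_eq_zero] at hw
          exact hw.resolve_left hu0
        have : Module.Finite κ (κ ⊗[R] C) :=
          Module.Finite.of_injective (π κ).toLinearMap hinj
        have := h₂ P this
        exact ⟨0, (hρ _).1 (Subsingleton.elim _ _)⟩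
    · exact ⟨0, by rw [← hρ, pow_zero, _root_.one_mul, hz]⟩
  exact Module.Flat.trans A A' _

end Flatness

/-! ### Local rings and topology of smooth curves over a field -/

section DiscreteValuation

open IsLocalRing Polynomial

/-- A Noetherian local ring whose maximal ideal is generated by a nonzerodivisor is a domain. -/
lemma isDomain_of_maximalIdeal_eq_span {A : Type*} [CommRing A] [IsLocalRing A]
    [IsNoetherianRing A] (t : A) (ht : maximalIdeal A = Ideal.span {t})
    (h : t ∈ nonZeroDivisors A) : IsDomain A := by
  -- By Krull's intersection theorem a nonzero element has a largest power of `t` dividing it.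
  have key (x : A) (hx : x ≠ 0) : ∃ (n : ℕ) (v : A), IsUnit v ∧ x = v * t ^ n := by
    have h1 : x ∉ ⨅ n : ℕ, maximalIdeal A ^ n := by
      rw [Ideal.iInf_pow_eq_bot_of_isLocalRing _ (Ideal.IsPrime.ne_top inferInstance)]
      simpa using hx
    have h2 : ∃ n : ℕ, x ∉ maximalIdeal A ^ n := by
      by_contra! h2
      exact h1 ((Submodule.mem_iInf _).2 h2)
    classical
    let n := Nat.find h2
    have hn : x ∉ maximalIdeal A ^ n := Nat.find_spec h2
    obtain ⟨m, hm⟩ : ∃ m, n = m + 1 := by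
      refine Nat.exists_eq_succ_of_ne_zero fun h0 ↦ hn ?_
      rw [h0]
      simp
    have h3 : x ∈ maximalIdeal A ^ m := not_not.1 (Nat.find_min h2 (m := m) (by omega))
    rw [ht, Ideal.span_singleton_pow, Ideal.mem_span_singleton'] at h3
    obtain ⟨v, rfl⟩ := h3
    refine ⟨m, v, ?_, rfl⟩
    by_contra hv
    have hv' : v ∈ maximalIdeal A := hv
    rw [ht, Ideal.mem_span_singleton'] at hv'
    obtain ⟨w, rfl⟩ := hv'
    apply hn
    rw [hm, ht, Ideal.span_singleton_pow, Ideal.mem_span_singleton']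
    exact ⟨w, by ring⟩
  have : NoZeroDivisors A := by
    refine ⟨fun {x y} hxy ↦ ?_⟩
    by_contra! hne
    obtain ⟨n, v, hv, rfl⟩ := key x hne.1
    obtain ⟨m, w, hw, rfl⟩ := key y hne.2
    have h4 : t ^ (n + m) = 0 := by
      refine (hv.mul hw).mul_left_cancel ?_
      rw [mul_zero, ← hxy]
      ring
    exact nonZeroDivisors.ne_zero (pow_mem h (n + m)) h4
  exact NoZeroDivisors.to_isDomain A

/-- The local rings of an étale algebra over a principal ideal domain. -/
lemma localization_of_etale {P B : Type*} [CommRing P] [IsDomain P] [IsPrincipalIdealRing P]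
    [CommRing B] [Algebra P B] [Algebra.Etale P B] (q : Ideal B) [q.IsPrime] :
    IsDomain (Localization.AtPrime q) ∧
      (maximalIdeal (Localization.AtPrime q)).IsPrincipal ∧
      (q.under P ≠ ⊥ → ¬ IsField (Localization.AtPrime q)) := by
  let m := q.under P
  let := Localization.AtPrime.algebraOfLiesOver m q
  have : IsNoetherianRing B := Algebra.FiniteType.isNoetherianRing P B
  have : Module.Flat (Localization.AtPrime m) (Localization.AtPrime q) := inferInstance
  have : Algebra.FormallyUnramified (Localization.AtPrime m) (Localization.AtPrime q) :=
    inferInstance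
  have : Algebra.EssFiniteType (Localization.AtPrime m) (Localization.AtPrime q) :=
    have : Algebra.EssFiniteType P (Localization.AtPrime q) := .comp P B _
    .of_comp P _ _
  -- Unramifiedness makes `m`, hence its generator `t`, generate the maximal ideal upstairs;
  -- flatness keeps `t` a nonzerodivisor if it is not zero.
  have h := Algebra.FormallyUnramified.map_maximalIdeal (R := Localization.AtPrime m)
    (S := Localization.AtPrime q)
  obtain ⟨t, ht⟩ := IsPrincipalIdealRing.principal m
  have ht' : m = Ideal.span {t} := ht
  have h1 : maximalIdeal (Localization.AtPrime q) =
      Ideal.span {algebraMap P (Localization.AtPrime q) t} := by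
    rw [← h, ← Localization.AtPrime.map_eq_maximalIdeal, Ideal.map_map,
      ← IsScalarTower.algebraMap_eq]
    conv_lhs => rw [ht']
    rw [Ideal.map_span, Set.image_singleton]
  have hdom : IsDomain (Localization.AtPrime q) := by
    by_cases h0 : t = 0
    · subst h0
      rw [map_zero, Ideal.span_singleton_eq_bot.2 rfl] at h1
      let := (isField_iff_maximalIdeal_eq.2 h1).toField
      infer_instance
    · refine isDomain_of_maximalIdeal_eq_span _ h1 ?_
      have : Module.Flat P (Localization.AtPrime q) := .trans P B _
      have h2 : IsSMulRegular (Localization.AtPrime q) (algebraMap P (Localization.AtPrime q) t) :=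
        .of_flat (.of_ne_zero h0)
      refine mem_nonZeroDivisors_iff_right.2 fun z hz ↦ h2 ?_
      simpa [_root_.mul_comm] using hz
  refine ⟨hdom, h1 ▸ ⟨⟨_, rfl⟩⟩, fun hm hf ↦ ?_⟩
  rw [isField_iff_maximalIdeal_eq, h1, Ideal.span_singleton_eq_bot] at hf
  have : Module.Flat P (Localization.AtPrime q) := .trans P B _
  refine hm (ht'.trans (Ideal.span_singleton_eq_bot.2 ?_))
  by_contra h0
  have h2 : IsSMulRegular (Localization.AtPrime q) (algebraMap P (Localization.AtPrime q) t) :=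
    .of_flat (.of_ne_zero h0)
  rw [hf] at h2
  exact one_ne_zero (h2 (by simp : (0 : Localization.AtPrime q) • (1 : Localization.AtPrime q) =
    (0 : Localization.AtPrime q) • 0))

/-- The local rings of a smooth curve over a field. -/
lemma localization_of_isStandardSmooth (k : Type u) {B : Type u} [Field k] [CommRing B]
    [Algebra k B]
    [Algebra.IsStandardSmoothOfRelativeDimension 1 k B] (q : Ideal B) [q.IsPrime] :
    IsDomain (Localization.AtPrime q) ∧
      (maximalIdeal (Localization.AtPrime q)).IsPrincipal ∧
      (q.IsMaximal → ¬ IsField (Localization.AtPrime q)) := by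
  obtain ⟨g, hg⟩ :=
    Algebra.IsStandardSmoothOfRelativeDimension.exists_etale_mvPolynomial 1 k B
  let e : k[X] ≃ₐ[k] MvPolynomial (Fin 1) k := (MvPolynomial.uniqueAlgEquiv k (Fin 1)).symm
  let φ : k[X] →+* B := g.toRingHom.comp e.toRingEquiv.toRingHom
  have hφ : φ.Etale :=
    RingHom.Etale.stableUnderComposition e.toRingEquiv.toRingHom g.toRingHom
      (.of_bijective e.bijective) hg
  let := φ.toAlgebra
  have : Algebra.Etale k[X] B := hφ
  -- `B` is étale over a coordinate line. If a maximal `q` contracted to zero, `k[X]` would embed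
  -- into the field `B ⧸ q`, finite over it, and would itself be a field.
  obtain ⟨h1, h2, h3⟩ := localization_of_etale (P := k[X]) q
  refine ⟨h1, h2, fun hq ↦ h3 fun h ↦ ?_⟩
  let := Ideal.Quotient.field q
  have : Module.Finite k[X] (B ⧸ q) := finite_of_finite_type_of_isJacobsonRing k[X] (B ⧸ q)
  refine Polynomial.not_isField k (isField_of_isIntegral_of_isField (S := B ⧸ q) ?_
    (Field.toIsField _))
  refine (RingHom.injective_iff_ker_eq_bot _).2 ?_
  rw [IsScalarTower.algebraMap_eq k[X] B (B ⧸ q), ← RingHom.comap_ker, Ideal.Quotient.algebraMap_eq,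
    Ideal.mk_ker]
  exact h

/-- The conditions on the stalk of a curve at a point used below, for a local ring `A`:
it is a field or a discrete valuation ring. -/
structure IsCurveStalk (A : Type*) [CommRing A] [IsLocalRing A] : Prop where
  isDomain : IsDomain A
  isPrincipal : (maximalIdeal A).IsPrincipal

lemma IsCurveStalk.of_ringEquiv {A B : Type*} [CommRing A] [IsLocalRing A] [CommRing B]
    [IsLocalRing B] (e : A ≃+* B) (h : IsCurveStalk A) : IsCurveStalk B where
  isDomain := have := h.isDomain; e.symm.toMulEquiv.isDomain _
  isPrincipal := by
    obtain ⟨t, ht⟩ := h.isPrincipal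
    refine ⟨⟨e t, ?_⟩⟩
    ext x
    have h1 : x ∈ maximalIdeal B ↔ e.symm x ∈ maximalIdeal A := by
      simp [mem_maximalIdeal, mem_nonunits_iff]
    rw [h1, ht]
    simp only [Ideal.submodule_span_eq, Ideal.mem_span_singleton]
    constructor
    · rintro ⟨c, hc⟩
      exact ⟨e c, by rw [← map_mul, ← hc, e.apply_symm_apply]⟩
    · rintro ⟨c, rfl⟩
      exact ⟨e.symm c, by simp⟩

/-- The stalks of a smooth curve over a field. -/
lemma isCurveStalk_of_smooth {k : Type u} [Field k] {X : Scheme.{u}} (f : X ⟶ Spec (.of k))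
    [SmoothOfRelativeDimension 1 f] (x : X) :
    IsCurveStalk (X.presheaf.stalk x) ∧ (IsClosed {x} → ¬ IsField (X.presheaf.stalk x)) := by
  obtain ⟨U, hU, V, hV, hx, hVU, h⟩ :=
    SmoothOfRelativeDimension.exists_isStandardSmoothOfRelativeDimension (n := 1) (f := f) x
  obtain rfl : U = ⊤ := by
    refine top_le_iff.1 fun y _ ↦ ?_
    rw [Subsingleton.elim y (f x)]
    exact hVU hx
  have hK : IsField Γ(Spec (.of k), ⊤) :=
    (Scheme.ΓSpecIso (.of k)).commRingCatIsoToRingEquiv.isField (Field.toIsField k)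
  let := hK.toField
  let := (f.appLE ⊤ V hVU).hom.toAlgebra
  have : Algebra.IsStandardSmoothOfRelativeDimension 1 Γ(Spec (.of k), ⊤) Γ(X, V) := h
  let q := (hV.primeIdealOf ⟨x, hx⟩).asIdeal
  obtain ⟨h1, h2, h3⟩ := localization_of_isStandardSmooth Γ(Spec (.of k), ⊤) q
  let := X.presheaf.algebra_section_stalk ⟨x, hx⟩
  have := hV.isLocalization_stalk ⟨x, hx⟩
  let e : Localization.AtPrime q ≃+* X.presheaf.stalk x :=
    (IsLocalization.algEquiv q.primeCompl (Localization.AtPrime q)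
      (X.presheaf.stalk x)).toRingEquiv
  refine ⟨.of_ringEquiv e ⟨h1, h2⟩, fun hc hf ↦ h3 ?_ (e.isField hf)⟩
  rw [← PrimeSpectrum.isClosed_singleton_iff_isMaximal]
  have h4 : IsClosed {(⟨x, hx⟩ : V)} := by
    have h5 : (V.ι ⁻¹' {x} : Set V) = {(⟨x, hx⟩ : V)} :=
      Set.ext fun y ↦ (Subtype.ext_iff (a1 := y) (a2 := ⟨x, hx⟩)).symm
    exact h5 ▸ hc.preimage V.ι.continuous
  have h5 := (Scheme.homeoOfIso hV.isoSpec).isClosedMap _ h4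
  have h6 : Scheme.homeoOfIso hV.isoSpec '' {(⟨x, hx⟩ : V)} = {hV.primeIdealOf ⟨x, hx⟩} :=
    Set.image_singleton
  exact h6 ▸ h5

section Curve

variable {X : Scheme.{u}}

/-- Two generisations of a point with integral stalk lie on a common irreducible component. -/
lemma exists_generization_of_isDomain (x : X) [IsDomain (X.presheaf.stalk x)] :
    ∃ g : X, ∀ y : X, y ⤳ x → g ⤳ y := by
  refine ⟨X.fromSpecStalk x (⊥ : PrimeSpectrum _), fun y hy ↦ ?_⟩
  have h : y ∈ Set.range (X.fromSpecStalk x) := by rw [Scheme.range_fromSpecStalk]; exact hy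
  obtain ⟨z, rfl⟩ := h
  refine Specializes.map ?_ (X.fromSpecStalk x).continuous
  exact (PrimeSpectrum.le_iff_specializes _ _).1 bot_le

/-- A connected Noetherian scheme with integral stalks is irreducible. -/
lemma irreducibleSpace_of_isDomain_stalk [IsNoetherian X] [ConnectedSpace X]
    (h : ∀ x : X, IsDomain (X.presheaf.stalk x)) : IrreducibleSpace X := by
  obtain ⟨x⟩ : Nonempty X := inferInstance
  let Z := irreducibleComponent x
  have hfin := TopologicalSpace.NoetherianSpace.finite_irreducibleComponents (α := X)
  -- All components through `y` are the closure of the same point `g`. So the finitely many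
  -- components are disjoint, hence open, and connectedness leaves only one.
  have hdisj (W₁ W₂ : Set X) (h₁ : W₁ ∈ irreducibleComponents X)
      (h₂ : W₂ ∈ irreducibleComponents X) (y : X) (hy₁ : y ∈ W₁) (hy₂ : y ∈ W₂) : W₁ = W₂ := by
    have := h y
    obtain ⟨g, hg⟩ := exists_generization_of_isDomain y
    have key (W : Set X) (hW : W ∈ irreducibleComponents X) (hy : y ∈ W) :
        W = closure {g} := by
      have hc := isClosed_of_mem_irreducibleComponents W hW
      obtain ⟨w, hw⟩ := QuasiSober.sober hW.1 hc
      have h1 : W ⊆ closure {g} := by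
        rw [← hw.def]
        refine closure_minimal ?_ isClosed_closure
        rw [Set.singleton_subset_iff, ← specializes_iff_mem_closure]
        refine hg w ?_
        rw [specializes_iff_mem_closure, hw.def]
        exact hy
      exact h1.antisymm (hW.2 isIrreducible_singleton.closure h1)
    rw [key W₁ h₁ hy₁, key W₂ h₂ hy₂]
  have hopen : IsOpen Z := by
    have h1 : Zᶜ = ⋃ W ∈ irreducibleComponents X \ {Z}, W := by
      ext y
      simp only [Set.mem_compl_iff, Set.mem_iUnion, exists_prop]
      constructor
      · intro hy
        refine ⟨irreducibleComponent y, ⟨irreducibleComponent_mem_irreducibleComponents y, ?_⟩,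
          mem_irreducibleComponent⟩
        rintro (h0 : irreducibleComponent y = Z)
        exact hy (h0 ▸ mem_irreducibleComponent)
      · rintro ⟨W, ⟨hW, hne⟩, hy⟩ hZ
        exact hne (hdisj W Z hW (irreducibleComponent_mem_irreducibleComponents x) y hy hZ)
    rw [← isClosed_compl_iff, h1]
    exact (hfin.subset Set.sdiff_subset).isClosed_biUnion fun W hW ↦
      isClosed_of_mem_irreducibleComponents W hW.1
  have hZ : Z = Set.univ :=
    IsClopen.eq_univ ⟨isClosed_irreducibleComponent, hopen⟩ ⟨x, mem_irreducibleComponent⟩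
  have : PreirreducibleSpace X := ⟨hZ ▸ isIrreducible_irreducibleComponent.2⟩
  exact ⟨⟨x⟩⟩

/-- The points of a curve are closed or generic. -/
lemma specializes_of_isCurveStalk [IsLocallyNoetherian X] (x y g : X)
    (hx : IsCurveStalk (X.presheaf.stalk x))
    (hg : ∀ z : X, g ⤳ z) (hy : y ⤳ x) : y = g ∨ y = x := by
  have h : y ∈ Set.range (X.fromSpecStalk x) := by rw [Scheme.range_fromSpecStalk]; exact hy
  obtain ⟨z, rfl⟩ := h
  have h0 : g ∈ Set.range (X.fromSpecStalk x) := by rw [Scheme.range_fromSpecStalk]; exact hg x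
  obtain ⟨w, rfl⟩ := h0
  have := hx.isDomain
  by_cases hz : z.asIdeal = ⊥
  · left
    refine (Specializes.antisymm ?_ (hg _)).eq
    refine Specializes.map ?_ (X.fromSpecStalk x).continuous
    refine (PrimeSpectrum.le_iff_specializes _ _).1 ?_
    change z.asIdeal ≤ _
    rw [hz]
    exact bot_le
  · right
    -- The stalk has a nonzero prime, so it is not a field; it is then a Dedekind domain, where
    -- nonzero primes are maximal.
    have hz' : z = closedPoint _ := by
      have hf : ¬ IsField (X.presheaf.stalk x) := fun hf ↦ by
        rw [isField_iff_maximalIdeal_eq] at hf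
        exact hz (le_bot_iff.1 (hf ▸ le_maximalIdeal z.2.ne_top))
      have h1 : IsDedekindDomain (X.presheaf.stalk x) :=
        ((IsDiscreteValuationRing.TFAE (X.presheaf.stalk x) hf).out 4 2).1 hx.isPrincipal
      exact PrimeSpectrum.ext (eq_maximalIdeal (Ring.DimensionLEOne.maximalOfPrime hz z.2))
    rw [hz', Scheme.fromSpecStalk_closedPoint]

/-- Proper closed subsets of a Noetherian irreducible curve are finite. -/
lemma finite_of_isClosed_of_isCurveStalk [IsNoetherian X] [IrreducibleSpace X]
    (h : ∀ x : X, IsCurveStalk (X.presheaf.stalk x)) (Z : Set X) (hZ : IsClosed Z)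
    (hne : Z ≠ Set.univ) : Z.Finite := by
  -- Each of the finitely many irreducible pieces of `Z` has a generic point other than that of `X`,
  -- and such a point has no further specialisation.
  obtain ⟨S, hS, hcl, hirr, hSZ⟩ :=
    TopologicalSpace.NoetherianSpace.exists_finite_set_isClosed_irreducible hZ
  choose! w hw using fun W hW ↦ QuasiSober.sober (hirr W hW) (hcl W hW)
  refine (hS.image w).subset fun x hx ↦ ?_
  rw [hSZ] at hx
  obtain ⟨W, hW, hxW⟩ := hx
  refine ⟨W, hW, ?_⟩
  have h1 : w W ⤳ x := by rw [specializes_iff_mem_closure, (hw W hW).def]; exact hxW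
  refine (specializes_of_isCurveStalk x (w W) (genericPoint X) (h x) genericPoint_specializes
    h1).resolve_left fun h2 ↦ hne ?_
  rw [hSZ, Set.eq_univ_iff_forall]
  intro y
  refine ⟨W, hW, ?_⟩
  rw [← (hw W hW).def, ← specializes_iff_mem_closure, h2]
  exact genericPoint_specializes y

/-- A nonempty smooth curve over a field has a nonclosed point. -/
lemma exists_not_isClosed_singleton {k : Type u} [Field k] (f : X ⟶ Spec (.of k))
    [SmoothOfRelativeDimension 1 f] [Nonempty X] : ∃ x : X, ¬ IsClosed {x} := by
  obtain ⟨y⟩ := ‹Nonempty X›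
  by_contra! h
  obtain ⟨h1, h2⟩ := isCurveStalk_of_smooth f y
  have := h1.isDomain
  refine h2 (h y) (isField_iff_maximalIdeal_eq.2 ?_)
  -- If every point is closed, the generic and the closed point of `Spec` of the stalk have the same
  -- image, so they agree and the stalk is a field.
  have h3 : X.fromSpecStalk y (⊥ : PrimeSpectrum _) = X.fromSpecStalk y (closedPoint _) := by
    have h4 : X.fromSpecStalk y (⊥ : PrimeSpectrum _) ⤳ X.fromSpecStalk y (closedPoint _) :=
      Specializes.map ((PrimeSpectrum.le_iff_specializes _ _).1 bot_le)
        (X.fromSpecStalk y).continuous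
    rw [specializes_iff_mem_closure, (h _).closure_eq] at h4
    exact (Set.mem_singleton_iff.1 h4).symm
  exact congrArg PrimeSpectrum.asIdeal ((X.fromSpecStalk y).isEmbedding.injective h3).symm

end Curve

end DiscreteValuation

/-! ### Gluing points of a scheme in locally ringed spaces -/

section Coequalizer

open Opposite TopologicalSpace

/-- Saturated open sets in a coequaliser of topological spaces. -/
lemma surjective_and_isOpen_image_of_isColimit {X Y Z : TopCat.{u}} {f g : X ⟶ Y} {c : Y ⟶ Z}
    {w : f ≫ c = g ≫ c} (h : IsColimit (Cofork.ofπ c w)) :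
    Function.Surjective c ∧ (∀ A : Set Y, f ⁻¹' A = g ⁻¹' A → c ⁻¹' (c '' A) = A) ∧
      ∀ A : Set Y, f ⁻¹' A = g ⁻¹' A → IsOpen A → IsOpen (c '' A) := by
  have hc : Epi c := Cofork.IsColimit.epi (s := Cofork.ofπ c w) h
  have h1 : ∀ A : Set Y, f ⁻¹' A = g ⁻¹' A → c ⁻¹' (c '' A) = A := fun A hA ↦
    Types.coequalizer_preimage_image_eq_of_preimage_eq ((forget TopCat).map f)
      ((forget TopCat).map g) ((forget TopCat).map c)
      (by rw [← Functor.map_comp, w, Functor.map_comp])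
      (isColimitCoforkMapOfIsColimit (forget TopCat) _ h) A hA
  refine ⟨(TopCat.epi_iff_surjective c).1 hc, h1, fun A hA hfA ↦ ?_⟩
  rw [TopCat.isOpen_iff_of_isColimit _ h]
  rintro (_ | _)
  · have h2 : ((Cofork.ofπ c w).ι.app WalkingParallelPair.zero : X ⟶ Z) = f ≫ c := by simp
    change IsOpen (((Cofork.ofπ c w).ι.app WalkingParallelPair.zero : X ⟶ Z) ⁻¹' (c '' A))
    rw [h2, TopCat.coe_comp, Set.preimage_comp, h1 A hA]
    exact hfA.preimage f.hom.continuous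
  · change IsOpen (c ⁻¹' (c '' A))
    rw [h1 A hA]
    exact hfA

/-- The projection from a limit over a diagram `A ⇉ B` with trivial target. -/
lemma isIso_limit_π_one (D : WalkingParallelPairᵒᵖ ⥤ CommRingCat.{u})
    (hD : Subsingleton (D.obj (op WalkingParallelPair.zero))) :
    IsIso (limit.π D (op WalkingParallelPair.one)) := by
  have hext {A : CommRingCat.{u}} (a b : A ⟶ D.obj (op WalkingParallelPair.zero)) : a = b := by
    ext x
    exact Subsingleton.elim _ _
  let s : Cone D :=
    { pt := D.obj (op WalkingParallelPair.one)
      π :=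
        { app := fun j ↦ match j with
            | op WalkingParallelPair.zero => D.map (Quiver.Hom.op WalkingParallelPairHom.left)
            | op WalkingParallelPair.one => 𝟙 _
          naturality := by
            rintro ⟨_ | _⟩ ⟨_ | _⟩ ⟨φ⟩
            · exact hext _ _
            · change WalkingParallelPairHom _ _ at φ
              cases φ
            · exact hext _ _
            · change WalkingParallelPairHom _ _ at φ
              cases φ
              exact (Category.id_comp _).trans
                ((D.map_id (op WalkingParallelPair.one)).symm.trans (Category.id_comp _).symm) } }
  refine ⟨limit.lift D s, ?_, ?_⟩
  · apply limit.hom_ext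
    rintro ⟨_ | _⟩
    · exact hext _ _
    · rw [Category.assoc, limit.lift_π, Category.id_comp]
      exact Category.comp_id _
  · exact limit.lift_π s (op WalkingParallelPair.one)

/-- Sections of a coequaliser of presheafed spaces away from the glued subspaces. -/
lemma isIso_c_app_of_isColimit {X Y Z : PresheafedSpace.{_, _, u} CommRingCat.{u}}
    {f g : X ⟶ Y} {c : Y ⟶ Z} {w : f ≫ c = g ≫ c} (h : IsColimit (Cofork.ofπ c w)) (V : Opens Z)
    (hV : ∀ U : Opens X, (∀ x ∈ U, c.base (f.base x) ∈ V) → Subsingleton (X.presheaf.obj (op U))) :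
    IsIso (c.c.app (op V)) := by
  obtain ⟨e, he⟩ : ∃ e : coequalizer f g ≅ Z, coequalizer.π f g ≫ e.hom = c :=
    ⟨(colimit.isColimit _).coconePointUniqueUpToIso h,
      (colimit.isColimit _).comp_coconePointUniqueUpToIso_hom h WalkingParallelPair.one⟩
  clear h
  subst he
  have h1 : IsIso ((coequalizer.π f g).c.app (op ((Opens.map e.hom.base).obj V))) := by
    have h2 := PresheafedSpace.colimitPresheafObjIsoComponentwiseLimit_hom_π (parallelPair f g)
      ((Opens.map e.hom.base).obj V) WalkingParallelPair.one
    -- Sections of the coequaliser form a limit over the sections on `X` and `Y`. Here `X`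
    -- contributes the zero ring, so only `Y` remains.
    have h3 := isIso_limit_π_one (PresheafedSpace.componentwiseDiagram (parallelPair f g)
      ((Opens.map e.hom.base).obj V)) ?_
    · change IsIso ((colimit.ι (parallelPair f g) WalkingParallelPair.one).c.app _)
      rw [← h2]
      exact IsIso.comp_isIso' inferInstance h3
    · refine hV _ fun x hx ↦ ?_
      have h4 : colimit.ι (parallelPair f g) WalkingParallelPair.zero = f ≫ coequalizer.π f g :=
        (colimit.w (parallelPair f g) WalkingParallelPairHom.left).symm
      change (colimit.ι (parallelPair f g) WalkingParallelPair.zero ≫ e.hom).base x ∈ V at hx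
      rw [h4] at hx
      exact hx
  have h5 : IsIso (e.hom.c) := inferInstance
  rw [PresheafedSpace.comp_c_app]
  exact IsIso.comp_isIso' inferInstance h1

/-- A coequaliser of schemes in locally ringed spaces is unchanged over the open sets which do not
meet the glued subspaces. -/
lemma isOpenImmersion_of_isColimit {T P X : Scheme.{u}} {a b : T ⟶ P} {c : P ⟶ X}
    {w : a ≫ c = b ≫ c}
    (h : IsColimit (Cofork.ofπ
      (f := Scheme.forgetToLocallyRingedSpace.map a)
      (g := Scheme.forgetToLocallyRingedSpace.map b)
      (Scheme.forgetToLocallyRingedSpace.map c)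
      (by rw [← Functor.map_comp, ← Functor.map_comp, w])))
    (U : P.Opens) (ha : ∀ t : T, a t ∉ U) (hb : ∀ t : T, b t ∉ U) :
    Function.Surjective c ∧ IsOpenImmersion (U.ι ≫ c) ∧ ∀ x y, c x = c y → x ∈ U → x = y := by
  -- The coequaliser is preserved on passing to presheafed spaces and to topological spaces, where
  -- it can be computed.
  have h1 := isColimitCoforkMapOfIsColimit LocallyRingedSpace.forgetToSheafedSpace _ h
  have h2 := isColimitCoforkMapOfIsColimit SheafedSpace.forgetToPresheafedSpace _ h1
  have h3 := isColimitCoforkMapOfIsColimit (SheafedSpace.forget _) _ h1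
  obtain ⟨hsurj, hsat, hopen⟩ := surjective_and_isOpen_image_of_isColimit h3
  have hempty (A : Set P) (hA : A ⊆ U) : a ⁻¹' A = b ⁻¹' A := by
    ext t
    exact ⟨fun ht ↦ (ha t (hA ht)).elim, fun ht ↦ (hb t (hA ht)).elim⟩
  have hinj (x y : P) (hxy : c x = c y) (hx : x ∈ U) : x = y := by
    have h4 := hsat {x} (hempty {x} (by simpa using hx))
    have h5 : y ∈ (c ⁻¹' (c '' {x}) : Set P) := ⟨x, rfl, hxy⟩
    exact (h4.le h5).symm
  refine ⟨hsurj, ?_, hinj⟩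
  have hemb : Topology.IsOpenEmbedding (U.ι ≫ c) := by
    refine .of_continuous_injective_isOpenMap (U.ι ≫ c).continuous (fun x y hxy ↦ ?_) fun A hA ↦ ?_
    · exact Subtype.ext (hinj x.1 y.1 hxy x.2)
    · have h4 : (U.ι ≫ c) '' A = c '' (U.ι '' A) := by
        rw [← Set.image_comp]
        rfl
      rw [h4]
      refine hopen _ (hempty _ ?_) (U.ι.isOpenEmbedding.isOpenMap _ hA)
      rintro _ ⟨x, -, rfl⟩
      exact x.2
  refine ⟨hemb, fun A ↦ ?_⟩
  have h5 : IsIso (c.toLRSHom.toShHom.hom.c.app (op (hemb.functor.obj A))) := by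
    refine isIso_c_app_of_isColimit h2 _ fun V hV ↦ ?_
    -- A point of `T` whose image lies in that of `A` would, by injectivity, be sent by `a` into
    -- `U`.
    have hV' : V = ⊥ := by
      refine le_bot_iff.1 fun t ht ↦ ?_
      obtain ⟨x, -, hx⟩ := hV t ht
      refine ha t ?_
      rw [← hinj x.1 (a t) hx x.2]
      exact x.2
    subst hV'
    exact CommRingCat.subsingleton_of_isTerminal T.sheaf.isTerminalOfEmpty
  have h6 : IsIso (U.ι.toLRSHom.toShHom.hom.c.app
      (op ((Opens.map c.base).obj (hemb.functor.obj A)))) := by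
    refine PresheafedSpace.IsOpenImmersion.c_iso' _ A ?_
    ext x
    constructor
    · rintro ⟨y, hy, hyx⟩
      exact ⟨y, hy, hinj y.1 x hyx y.2⟩
    · rintro ⟨y, hy, rfl⟩
      exact ⟨y, hy, rfl⟩
  change IsIso (c.toLRSHom.toShHom.hom.c.app (op (hemb.functor.obj A)) ≫
    U.ι.toLRSHom.toShHom.hom.c.app (op ((Opens.map c.base).obj (hemb.functor.obj A))))
  exact IsIso.comp_isIso' h5 h6

end Coequalizer

/-! ### The smooth part of a Néron 1-gon -/

section NeronPolygon

open Polynomial LaurentPolynomial TopologicalSpace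

lemma isStandardSmooth_polynomial (k : Type u) [Field k] :
    Algebra.IsStandardSmoothOfRelativeDimension 1 k k[X] := by
  have h : Algebra.IsStandardSmooth k (MvPolynomial (Fin 1) k) :=
    .of_basis_kaehlerDifferential (KaehlerDifferential.mvPolynomialBasis k (Fin 1)) (by
      rintro _ ⟨i, rfl⟩
      exact ⟨MvPolynomial.X i, by simp⟩)
  have h' : Algebra.IsStandardSmoothOfRelativeDimension 1 k (MvPolynomial (Fin 1) k) := by
    rw [Algebra.IsStandardSmoothOfRelativeDimension.iff_of_isStandardSmooth,
      rank_eq_card_basis (KaehlerDifferential.mvPolynomialBasis k (Fin 1))]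
    simp
  exact .of_algEquiv 1 (MvPolynomial.uniqueAlgEquiv k (Fin 1))

lemma isStandardSmooth_laurentPolynomial (k : Type u) [Field k] :
    Algebra.IsStandardSmoothOfRelativeDimension 1 k k[T;T⁻¹] := by
  have h1 := isStandardSmooth_polynomial k
  have h2 : Algebra.IsStandardSmoothOfRelativeDimension 0 k[X] k[T;T⁻¹] := .localization_away X
  have : IsScalarTower k k[X] k[T;T⁻¹] := .of_algebraMap_eq fun x ↦ (toLaurent_C x).symm
  exact .trans 1 0 k k[X] k[T;T⁻¹]

lemma mem_range_of_X_notMem {k : Type u} [Field k] (q : Spec (.of k[X]))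
    (hq : X ∉ q.asIdeal) :
    q ∈ Set.range (Spec.map (CommRingCat.ofHom (toLaurent (R := k)))) := by
  have h := PrimeSpectrum.localization_away_comap_range k[T;T⁻¹] (X : k[X])
  exact h.ge hq

lemma eq_origin_of_X_mem {k : Type u} [Field k] (q : Spec (.of k[X])) (hq : X ∈ q.asIdeal)
    (z : Spec (.of k)) : q = origin k z := by
  have hX (f : k[X]) (hf : f.eval 0 = 0) : f ∈ q.asIdeal := by
    obtain ⟨g, rfl⟩ := X_dvd_iff.2 ((coeff_zero_eq_eval_zero f).trans hf)
    exact q.asIdeal.mul_mem_right _ hq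
  refine PrimeSpectrum.ext (Ideal.ext fun f ↦ ?_)
  have hz : f ∈ (origin k z).asIdeal ↔ f.eval 0 = 0 := by
    change (evalRingHom (0 : k)) f ∈ z.asIdeal ↔ _
    rw [@Ideal.eq_bot_of_prime k _ z.asIdeal z.2]
    rfl
  refine ⟨fun hf ↦ hz.2 ?_, fun hf ↦ hX f (hz.1 hf)⟩
  by_contra h0
  refine q.2.ne_top (Ideal.eq_top_of_isUnit_mem _ (x := Polynomial.C (f.eval 0)) ?_ ?_)
  · have h1 := q.asIdeal.sub_mem hf (hX (f - Polynomial.C (f.eval 0)) (by simp))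
    simpa using h1
  · exact (isUnit_iff_ne_zero.2 h0).map Polynomial.C

lemma X_mem_origin {k : Type u} [Field k] (z : Spec (.of k)) : X ∈ (origin k z).asIdeal := by
  change (evalRingHom (0 : k)) X ∈ z.asIdeal
  simp

/-- A Néron `1`-gon over `k` is a copy of `𝔾ₘ` together with a point. -/
lemma exists_open_of_isNeronOneGon {k : Type u} [Field k] {E : Scheme.{u}} (π : E ⟶ Spec (.of k))
    (h : IsNeronOneGon π) :
    ∃ (W : Scheme.{u}) (j : W ⟶ E), IsOpenImmersion j ∧ SmoothOfRelativeDimension 1 (j ≫ π) ∧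
      IrreducibleSpace W ∧ DenseRange j ∧ (Set.range j)ᶜ.Finite := by
  obtain ⟨L, c, w, hπ₀, hπ₁, ⟨hc⟩⟩ := h
  have := L.isOpenImmersion₀
  have := L.isOpenImmersion₁
  let a₀ : Spec (.of k[T;T⁻¹]) ⟶ Spec (.of k[X]) :=
    Spec.map (CommRingCat.ofHom (toLaurent (R := k)))
  let a₁ : Spec (.of k[T;T⁻¹]) ⟶ Spec (.of k[X]) := Spec.map (CommRingCat.ofHom
      ((LaurentPolynomial.invert (R := k)).toRingEquiv.toRingHom.comp (toLaurent (R := k))))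
  have hglue : IsPullback a₀ a₁ L.chart₀ L.chart₁ := L.glue
  have : IsOpenImmersion a₀ := MorphismProperty.of_isPullback hglue.flip L.isOpenImmersion₁
  let i : Spec (.of k[T;T⁻¹]) ⟶ L.P := a₀ ≫ L.chart₀
  have hi : i = a₁ ≫ L.chart₁ := hglue.w
  have hu₀ (y : Spec (.of k[T;T⁻¹])) : X ∉ (a₀ y).asIdeal := fun hy ↦
    y.2.ne_top (Ideal.eq_top_of_isUnit_mem _ hy (by
      change IsUnit (toLaurent (X : k[X]))
      rw [toLaurent_X]
      exact isUnit_T 1))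
  have hu₁ (y : Spec (.of k[T;T⁻¹])) : X ∉ (a₁ y).asIdeal := fun hy ↦
    y.2.ne_top (Ideal.eq_top_of_isUnit_mem _ hy (by
      change IsUnit (invert (toLaurent (X : k[X])))
      rw [toLaurent_X, invert_T]
      exact isUnit_T _))
  -- The coordinate vanishes at the origin of a chart, while on `𝔾ₘ` it becomes the unit `T` or its
  -- inverse.
  have h₀ (t : Spec (.of k)) : L.zero t ∉ i.opensRange := by
    rintro ⟨y, hy⟩
    have h1 : a₀ y = origin k t := L.chart₀.isOpenEmbedding.injective (by
      simpa [i, ProjectiveLine.zero] using hy)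
    exact hu₀ y (h1 ▸ X_mem_origin t)
  have h₁ (t : Spec (.of k)) : L.infty t ∉ i.opensRange := by
    rintro ⟨y, hy⟩
    rw [hi] at hy
    have h1 : a₁ y = origin k t := L.chart₁.isOpenEmbedding.injective (by
      simpa [ProjectiveLine.infty] using hy)
    exact hu₁ y (h1 ▸ X_mem_origin t)
  obtain ⟨hsurj, hopen, -⟩ := isOpenImmersion_of_isColimit (w := w) hc i.opensRange h₀ h₁
  have hj : IsOpenImmersion (i ≫ c) := by
    have h2 : i ≫ c = (i.isoOpensRange).hom ≫ i.opensRange.ι ≫ c := by simp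
    rw [h2]
    infer_instance
  have hdom : IsDomain k[T;T⁻¹] := inferInstance
  have hirr : IrreducibleSpace (Spec (.of k[T;T⁻¹])) :=
    inferInstanceAs (IrreducibleSpace (PrimeSpectrum k[T;T⁻¹]))
  refine ⟨_, i ≫ c, hj, ?_, hirr, ?_, ?_⟩
  · have h4 : (i ≫ c) ≫ π = Spec.map (CommRingCat.ofHom (algebraMap k k[T;T⁻¹])) := by
      simp only [i, Category.assoc, hπ₀, a₀]
      rw [← Spec.map_comp]
      congr 1
      ext1
      exact RingHom.ext toLaurent_C
    rw [h4, HasRingHomProperty.Spec_iff (P := @SmoothOfRelativeDimension 1)]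
    refine RingHom.locally_of
      RingHom.isStandardSmoothOfRelativeDimension_respectsIso _ ?_
    exact (RingHom.isStandardSmoothOfRelativeDimension_algebraMap 1).2
      (isStandardSmooth_laurentPolynomial k)
  · have hd (a : Spec (.of k[T;T⁻¹]) ⟶ Spec (.of k[X])) [IsOpenImmersion a] : DenseRange a := by
      have : IrreducibleSpace (Spec (.of k[X])) :=
        inferInstanceAs (IrreducibleSpace (PrimeSpectrum k[X]))
      exact a.opensRange.isOpen.dense ⟨_, Set.mem_range_self (f := a) (genericPoint _)⟩
    have : IsOpenImmersion a₁ := MorphismProperty.of_isPullback hglue L.isOpenImmersion₀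
    have hdi : DenseRange i := by
      intro p
      rcases L.cover.ge (Set.mem_univ p) with ⟨q, rfl⟩ | ⟨q, rfl⟩
      · have := image_closure_subset_closure_image L.chart₀.continuous ⟨q, hd a₀ q, rfl⟩
        rw [← Set.range_comp] at this
        exact this
      · have := image_closure_subset_closure_image L.chart₁.continuous ⟨q, hd a₁ q, rfl⟩
        rw [← Set.range_comp] at this
        rw [hi]
        exact this
    exact hsurj.denseRange.comp hdi c.continuous
  -- A point of `ℙ¹` outside `𝔾ₘ` is the origin of one of the two charts.
  · let z : Spec (.of k) := IsLocalRing.closedPoint k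
    refine (Set.toFinite {c (L.zero z), c (L.infty z)}).subset fun x hx ↦ ?_
    obtain ⟨p, rfl⟩ := hsurj x
    rcases L.cover.ge (Set.mem_univ p) with ⟨q, rfl⟩ | ⟨q, rfl⟩
    · by_cases hq : X ∈ q.asIdeal
      · left
        rw [eq_origin_of_X_mem q hq z]
        rfl
      · obtain ⟨y, rfl⟩ := mem_range_of_X_notMem q hq
        exact (hx ⟨y, rfl⟩).elim
    · by_cases hq : X ∈ q.asIdeal
      · right
        rw [eq_origin_of_X_mem q hq z]
        rfl
      · obtain ⟨y, rfl⟩ := mem_range_of_X_notMem q hq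
        let v : Spec (.of k[T;T⁻¹]) ⟶ Spec (.of k[T;T⁻¹]) := Spec.map (CommRingCat.ofHom
          (LaurentPolynomial.invert (R := k)).toRingEquiv.toRingHom)
        have hv : v ≫ a₁ = a₀ := by
          simp only [v, a₁, a₀]
          rw [← Spec.map_comp]
          congr 1
          ext1
          exact RingHom.ext fun f ↦ involutive_invert (toLaurent f)
        refine (hx ⟨v y, ?_⟩).elim
        rw [hi, ← Scheme.Hom.comp_apply, ← Category.assoc, ← Category.assoc, hv]
        rfl

end NeronPolygon

/-! ### Relative dimension of smooth morphisms -/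

section RelativeDimension

/-- The relative dimension is the rank of the module of differentials. -/
lemma _root_.RingHom.IsStandardSmoothOfRelativeDimension.unique {A B : Type u} [CommRing A]
    [CommRing B] [Nontrivial B] {f : A →+* B} {n m : ℕ}
    (hn : f.IsStandardSmoothOfRelativeDimension n) (hm : f.IsStandardSmoothOfRelativeDimension m) :
    n = m := by
  algebraize [f]
  have h1 := Algebra.IsStandardSmoothOfRelativeDimension.rank_kaehlerDifferential
    (R := A) (S := B) n
  have h2 := Algebra.IsStandardSmoothOfRelativeDimension.rank_kaehlerDifferential
    (R := A) (S := B) m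
  exact_mod_cast h1.symm.trans h2

/-- Each hypothesis holds on a basic neighbourhood of a chosen prime; the two are compared on the
intersection, whose ring is not zero. -/
lemma locally_isStandardSmoothOfRelativeDimension_unique {A B : Type u} [CommRing A]
    [CommRing B] [Nontrivial B] {f : A →+* B} {n m : ℕ}
    (hn : RingHom.Locally (RingHom.IsStandardSmoothOfRelativeDimension n) f)
    (hm : RingHom.Locally (RingHom.IsStandardSmoothOfRelativeDimension m) f) : n = m := by
  obtain ⟨q⟩ : Nonempty (PrimeSpectrum B) := inferInstance
  have key {n : ℕ} (hn : RingHom.Locally (RingHom.IsStandardSmoothOfRelativeDimension n) f) :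
      ∃ a ∉ q.asIdeal, ((algebraMap B (Localization.Away a)).comp f
        ).IsStandardSmoothOfRelativeDimension n := by
    obtain ⟨s, hs, h⟩ := hn
    by_contra! hc
    refine q.2.ne_top (top_le_iff.1 (hs ▸ Ideal.span_le.2 fun a ha ↦ ?_))
    by_contra ha'
    exact hc a ha' (h a ha)
  obtain ⟨a, ha, ha'⟩ := key hn
  obtain ⟨b, hb, hb'⟩ := key hm
  have hab : a * b ∉ q.asIdeal := fun h ↦ (q.2.mem_or_mem h).elim ha hb
  have : Nontrivial (Localization.Away (a * b)) :=
    nontrivial_of_ne 0 1 fun h ↦ by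
      rw [← _root_.map_zero (algebraMap B _), ← _root_.map_one (algebraMap B _)] at h
      obtain ⟨k, hk⟩ := IsLocalization.Away.exists_of_eq (a * b) h
      rw [mul_zero, _root_.mul_one] at hk
      exact hab (q.2.mem_of_pow_mem k (hk ▸ q.asIdeal.zero_mem))
  have loc (x y : B) (n : ℕ) (h : ((algebraMap B (Localization.Away x)).comp f
      ).IsStandardSmoothOfRelativeDimension n) :
      ((algebraMap B (Localization.Away (x * y))).comp
        f).IsStandardSmoothOfRelativeDimension n := by
    let T := Localization.Away (algebraMap B (Localization.Away x) y)
    have : IsLocalization.Away (x * y) T := .mul' (Localization.Away x) T x y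
    have h1 : ((algebraMap (Localization.Away x) T).comp ((algebraMap B (Localization.Away x)).comp
        f)).IsStandardSmoothOfRelativeDimension n :=
      (RingHom.isStandardSmoothOfRelativeDimension_stableUnderCompositionWithLocalizationAway
        n).2 T (algebraMap B (Localization.Away x) y) _ h
    rw [← RingHom.comp_assoc, ← IsScalarTower.algebraMap_eq] at h1
    let e : T ≃ₐ[B] Localization.Away (x * y) :=
      IsLocalization.algEquiv (Submonoid.powers (x * y)) _ _
    have h2 := RingHom.isStandardSmoothOfRelativeDimension_respectsIso.1 _ e.toRingEquiv h1
    have h3 : e.toRingEquiv.toRingHom.comp ((algebraMap B T).comp f) =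
        (algebraMap B (Localization.Away (x * y))).comp f :=
      RingHom.ext fun z ↦ e.commutes (f z)
    rwa [h3] at h2
  have h1 := loc a b n ha'
  have h2 := loc b a m hb'
  rw [_root_.mul_comm] at h2
  exact h1.unique h2

lemma smoothOfRelativeDimension_unique {X Y : Scheme.{u}} (f : X ⟶ Y) [Nonempty X] {n m : ℕ}
    (hn : SmoothOfRelativeDimension n f) (hm : SmoothOfRelativeDimension m f) : n = m := by
  obtain ⟨x⟩ := ‹Nonempty X›
  obtain ⟨_, ⟨U, hU, rfl⟩, hxU, -⟩ :=
    Y.isBasis_affineOpens.exists_subset_of_mem_open (Set.mem_univ (f x)) isOpen_univ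
  obtain ⟨_, ⟨V, hV, rfl⟩, hxV, hVU⟩ :=
    X.isBasis_affineOpens.exists_subset_of_mem_open hxU (U.2.preimage f.continuous)
  have : Nonempty V := ⟨⟨x, hxV⟩⟩
  exact locally_isStandardSmoothOfRelativeDimension_unique
    (HasRingHomProperty.appLE (@SmoothOfRelativeDimension n) f hn ⟨U, hU⟩ ⟨V, hV⟩ hVU)
    (HasRingHomProperty.appLE (@SmoothOfRelativeDimension m) f hm ⟨U, hU⟩ ⟨V, hV⟩ hVU)

/-- A smooth morphism has a relative dimension in a neighbourhood of every point. -/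
lemma exists_smoothOfRelativeDimension {X Y : Scheme.{u}} (f : X ⟶ Y) [Smooth f] (x : X) :
    ∃ (m : ℕ) (V : X.Opens), x ∈ V ∧ SmoothOfRelativeDimension m (V.ι ≫ f) := by
  obtain ⟨U, hU, V, hV, hx, e, h⟩ := Smooth.exists_isStandardSmooth f x
  obtain ⟨m, hm⟩ : ∃ m, (f.appLE U V e).hom.IsStandardSmoothOfRelativeDimension m := by
    algebraize [(f.appLE U V e).hom]
    obtain ⟨ι₁, σ₁, h1, h2, ⟨P⟩⟩ := Algebra.IsStandardSmooth.out (R := Γ(Y, U)) (S := Γ(X, V))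
    exact ⟨P.dimension, P.isStandardSmoothOfRelativeDimension rfl⟩
  refine ⟨m, V, hx, ?_⟩
  have h1 : SmoothOfRelativeDimension m (f.resLE U V e) := by
    have : IsAffine _ := hU
    have : IsAffine _ := hV
    rw [HasRingHomProperty.iff_of_isAffine (P := @SmoothOfRelativeDimension m)]
    refine RingHom.locally_of RingHom.isStandardSmoothOfRelativeDimension_respectsIso _ ?_
    exact ((RingHom.isStandardSmoothOfRelativeDimension_respectsIso (n := m)).arrow_mk_iso_iff
      (arrowResLEAppIso f U V e)).mpr hm
  rw [← Scheme.Hom.resLE_comp_ι f e]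
  exact smoothOfRelativeDimension_comp m 0 _ _

/-- Some relative dimension exists near each point, so only its value has to be identified. -/
lemma smoothOfRelativeDimension_of_forall_opens {X Y : Scheme.{u}} (f : X ⟶ Y) [Smooth f] (n : ℕ)
    (h : ∀ x : X, ∀ V : X.Opens, x ∈ V → ∀ m, SmoothOfRelativeDimension m (V.ι ≫ f) → m = n) :
    SmoothOfRelativeDimension n f := by
  choose m V hx hV using fun x ↦ exists_smoothOfRelativeDimension f x
  have hP : HasRingHomProperty (@SmoothOfRelativeDimension n)
    (RingHom.Locally (RingHom.IsStandardSmoothOfRelativeDimension n)) := inferInstance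
  refine (((fun (P : MorphismProperty Scheme.{u}) (_ : HasRingHomProperty P _) ↦
    IsZariskiLocalAtSource.iff_of_iSup_eq_top (P := P) (f := f) V) _ hP)
      (top_le_iff.1 fun x _ ↦ TopologicalSpace.Opens.mem_iSup.2 ⟨x, hx x⟩)).2 fun x ↦ ?_
  exact h x (V x) (hx x) (m x) (hV x) ▸ hV x

/-- A smooth morphism from an irreducible scheme whose relative dimension is `n` on a nonempty open
subscheme has relative dimension `n`. -/
lemma smoothOfRelativeDimension_of_isOpenImmersion {X Y W : Scheme.{u}} (f : X ⟶ Y) (j : W ⟶ X)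
    [Smooth f] [IrreducibleSpace X] [IsOpenImmersion j] [Nonempty W] (n : ℕ)
    [hj : SmoothOfRelativeDimension n (j ≫ f)] : SmoothOfRelativeDimension n f := by
  refine smoothOfRelativeDimension_of_forall_opens f n fun x V hx m hV ↦ ?_
  have hne : Nonempty (pullback V.ι j : Scheme.{u}) := by
    obtain ⟨w⟩ := ‹Nonempty W›
    obtain ⟨y, ⟨hy, hy'⟩⟩ :=
      nonempty_preirreducible_inter V.2 j.opensRange.2 ⟨x, hx⟩ ⟨j w, ⟨w, rfl⟩⟩
    obtain ⟨w, rfl⟩ := hy'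
    obtain ⟨z, -, -⟩ := Scheme.Pullback.exists_preimage_pullback (f := V.ι) (g := j) ⟨_, hy⟩ w rfl
    exact ⟨z⟩
  have h1 : SmoothOfRelativeDimension (0 + m) (pullback.fst V.ι j ≫ V.ι ≫ f) :=
    smoothOfRelativeDimension_comp 0 m _ _
  have h2 : SmoothOfRelativeDimension (0 + n) (pullback.fst V.ι j ≫ V.ι ≫ f) := by
    rw [pullback.condition_assoc]
    exact smoothOfRelativeDimension_comp 0 n _ _
  have h3 := smoothOfRelativeDimension_unique _ h1 h2
  rwa [zero_add, zero_add] at h3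

/-- The relative dimension of a smooth morphism can be computed on fibres. -/
lemma smoothOfRelativeDimension_of_fibre {X Y : Scheme.{u}} (f : X ⟶ Y) [Smooth f] (n : ℕ)
    (h : ∀ y : Y, ∃ (T : Scheme.{u}) (t : T ⟶ Y), y ∈ Set.range t ∧
      SmoothOfRelativeDimension n (pullback.snd f t)) : SmoothOfRelativeDimension n f := by
  refine smoothOfRelativeDimension_of_forall_opens f n fun x V hx m hV ↦ ?_
  obtain ⟨T, t, ⟨y, hy⟩, ht⟩ := h (f x)
  have hne : Nonempty (pullback (V.ι ≫ f) t : Scheme.{u}) := by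
    obtain ⟨z, -, -⟩ := Scheme.Pullback.exists_preimage_pullback (f := V.ι ≫ f) (g := t) ⟨x, hx⟩ y
      hy.symm
    exact ⟨z⟩
  have h1 : SmoothOfRelativeDimension m (pullback.snd (V.ι ≫ f) t) :=
    (smoothOfRelativeDimension_isStableUnderBaseChange m).of_isPullback
      (IsPullback.of_hasPullback _ _) hV
  let i : pullback (V.ι ≫ f) t ⟶ pullback f t :=
    pullback.map _ _ _ _ V.ι (𝟙 _) (𝟙 _) (by simp) (by simp)
  have h2 : SmoothOfRelativeDimension (0 + n) (i ≫ pullback.snd f t) :=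
    smoothOfRelativeDimension_comp 0 n _ _
  have h3 : i ≫ pullback.snd f t = pullback.snd (V.ι ≫ f) t :=
    (pullback.lift_snd _ _ _).trans (Category.comp_id _)
  rw [h3] at h2
  have h4 := smoothOfRelativeDimension_unique _ h1 h2
  rwa [zero_add] at h4

end RelativeDimension

/-! ### Smooth open subschemes of a curve -/

section Curve

variable {k : Type u} [Field k]

lemma isNoetherian_of_quasiCompact {E : Scheme.{u}} (π : E ⟶ Spec (.of k)) [LocallyOfFiniteType π]
    [QuasiCompact π] : IsNoetherian E :=
  have := LocallyOfFiniteType.isLocallyNoetherian π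
  have : CompactSpace E := QuasiCompact.compactSpace_of_compactSpace π
  {}

lemma isNoetherian_of_isOpenImmersion {E W : Scheme.{u}} [IsNoetherian E] (j : W ⟶ E)
    [IsOpenImmersion j] : IsNoetherian W :=
  have := isLocallyNoetherian_of_isOpenImmersion j
  have : TopologicalSpace.NoetherianSpace W := j.isOpenEmbedding.isInducing.noetherianSpace
  {}

/-- `E` is a curve over a field with a dense irreducible smooth open subscheme. Then any nonempty
smooth open subscheme of `E` has the same property. -/
lemma isCurve_of_dense_open {E W G : Scheme.{u}} (π : E ⟶ Spec (.of k)) [LocallyOfFiniteType π]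
    [QuasiCompact π] (j : W ⟶ E) [IsOpenImmersion j] [SmoothOfRelativeDimension 1 (j ≫ π)]
    [IrreducibleSpace W] (hj : DenseRange j) (hfin : (Set.range j)ᶜ.Finite) (i : G ⟶ E)
    [IsOpenImmersion i] [Nonempty G] [Smooth (i ≫ π)] :
    IrreducibleSpace G ∧ DenseRange i ∧ SmoothOfRelativeDimension 1 (i ≫ π) ∧
      (Set.range i)ᶜ.Finite := by
  have := isNoetherian_of_quasiCompact π
  have := isNoetherian_of_isOpenImmersion j
  have hE : IrreducibleSpace E := by
    have h1 : IsIrreducible (closure (Set.range j)) :=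
      (Set.image_univ (f := j) ▸ (IrreducibleSpace.isIrreducible_univ W).image j
        j.continuous.continuousOn).closure
    rw [hj.closure_range] at h1
    have : PreirreducibleSpace E := ⟨h1.2⟩
    exact ⟨⟨h1.1.some⟩⟩
  have hG : IrreducibleSpace G := by
    have : PreirreducibleSpace G := i.isOpenEmbedding.preirreducibleSpace
    exact ⟨inferInstance⟩
  obtain ⟨g⟩ := ‹Nonempty G›
  have hne : ((Set.range i) ∩ Set.range j).Nonempty :=
    nonempty_preirreducible_inter i.opensRange.2 j.opensRange.2 ⟨i g, g, rfl⟩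
      (Set.range_nonempty j)
  refine ⟨hG, ?_, ?_, ?_⟩
  · exact i.opensRange.2.dense ⟨i g, g, rfl⟩
  · have : Nonempty (pullback i j : Scheme.{u}) := by
      obtain ⟨_, ⟨a, rfl⟩, ⟨b, hb⟩⟩ := hne
      obtain ⟨z, -, -⟩ := Scheme.Pullback.exists_preimage_pullback (f := i) (g := j) a b hb.symm
      exact ⟨z⟩
    have h2 : SmoothOfRelativeDimension (0 + 1) (pullback.fst i j ≫ i ≫ π) := by
      rw [pullback.condition_assoc]
      exact smoothOfRelativeDimension_comp 0 1 _ _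
    exact smoothOfRelativeDimension_of_isOpenImmersion (i ≫ π) (pullback.fst i j) 1
  -- `G` meets `W`, so its complement in the curve `W` is a proper closed subset, hence finite.
  · have h3 : (j ⁻¹' (Set.range i)ᶜ).Finite := by
      refine finite_of_isClosed_of_isCurveStalk
        (fun x ↦ (isCurveStalk_of_smooth (j ≫ π) x).1) _
        (i.opensRange.2.isClosed_compl.preimage j.continuous) fun h4 ↦ ?_
      obtain ⟨_, ha, ⟨b, rfl⟩⟩ := hne
      exact h4.ge (Set.mem_univ b) ha
    refine (hfin.union (h3.image j)).subset fun x hx ↦ ?_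
    by_cases hxj : x ∈ Set.range j
    · obtain ⟨y, rfl⟩ := hxj
      exact Or.inr ⟨y, hx, rfl⟩
    · exact Or.inl hxj

end Curve

/-! ### Geometric fibres and their rational points -/

section FibreMap

variable {S T : Scheme.{u}} (t : T ⟶ S) {P Q R : Over S}

/-- The base change of a morphism over `S` along `t : T ⟶ S`. -/
def fibreMap (φ : P ⟶ Q) : pullback P.hom t ⟶ pullback Q.hom t :=
  pullback.lift (pullback.fst _ _ ≫ φ.left) (pullback.snd _ _) (by
    rw [Category.assoc, Over.w, pullback.condition])

lemma fibreMap_fst (φ : P ⟶ Q) :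
    fibreMap t φ ≫ pullback.fst _ _ = pullback.fst _ _ ≫ φ.left :=
  pullback.lift_fst _ _ _

lemma fibreMap_snd (φ : P ⟶ Q) : fibreMap t φ ≫ pullback.snd _ _ = pullback.snd _ _ :=
  pullback.lift_snd _ _ _

lemma isPullback_fibreMap (φ : P ⟶ Q) :
    IsPullback (fibreMap t φ) (pullback.fst P.hom t) (pullback.fst Q.hom t) φ.left := by
  refine IsPullback.of_right (h₁₂ := pullback.snd _ _) (h₂₂ := Q.hom) (v₁₃ := t) ?_
    (fibreMap_fst t φ) (IsPullback.of_hasPullback Q.hom t).flip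
  rw [fibreMap_snd, Over.w]
  exact (IsPullback.of_hasPullback P.hom t).flip

instance (φ : P ⟶ Q) [IsOpenImmersion φ.left] : IsOpenImmersion (fibreMap t φ) :=
  MorphismProperty.of_isPullback (P := @IsOpenImmersion) (isPullback_fibreMap t φ).flip ‹_›

instance (φ : P ⟶ Q) [Surjective φ.left] : Surjective (fibreMap t φ) :=
  MorphismProperty.of_isPullback (P := @Surjective) (isPullback_fibreMap t φ).flip ‹_›

end FibreMap

section GeometricPoints

variable {S : Scheme.{u}} {k : Type u} [Field k] (t : Spec (.of k) ⟶ S) {P Q : Over S}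

/-- The point of the spectrum of a field. -/
def specPoint (k : Type u) [Field k] : Spec (.of k) := IsLocalRing.closedPoint k

/-- The section of the fibre of `P` defined by a point of `P`. -/
def fibreSection (e : Over.mk t ⟶ P) : Spec (.of k) ⟶ pullback P.hom t :=
  pullback.lift e.left (𝟙 _) (by rw [Over.w, Category.id_comp]; rfl)

lemma fibreSection_fst (e : Over.mk t ⟶ P) : fibreSection t e ≫ pullback.fst _ _ = e.left :=
  pullback.lift_fst _ _ _

lemma fibreSection_snd (e : Over.mk t ⟶ P) : fibreSection t e ≫ pullback.snd _ _ = 𝟙 _ :=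
  pullback.lift_snd _ _ _

lemma fibreSection_comp (φ : P ⟶ Q) (e : Over.mk t ⟶ P) :
    fibreSection t e ≫ fibreMap t φ = fibreSection t (e ≫ φ) := by
  apply pullback.hom_ext
  · rw [Category.assoc, fibreMap_fst, ← Category.assoc, fibreSection_fst, fibreSection_fst,
      Over.comp_left]
  · rw [Category.assoc, fibreMap_snd, fibreSection_snd, fibreSection_snd]

/-- The point of the fibre of `P` defined by a point of `P` with values in a field. -/
def fibrePoint (e : Over.mk t ⟶ P) : (pullback P.hom t : Scheme.{u}) :=
  fibreSection t e (specPoint k)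

lemma fst_fibrePoint (e : Over.mk t ⟶ P) :
    pullback.fst P.hom t (fibrePoint t e) = e.left (specPoint k) := by
  rw [fibrePoint, ← Scheme.Hom.comp_apply, fibreSection_fst]

lemma fibreMap_fibrePoint (φ : P ⟶ Q) (e : Over.mk t ⟶ P) :
    fibreMap t φ (fibrePoint t e) = fibrePoint t (e ≫ φ) := by
  rw [fibrePoint, fibrePoint, ← Scheme.Hom.comp_apply, fibreSection_comp]

variable [IsAlgClosed k]

lemma fibrePoint_injective [LocallyOfFiniteType P.hom] :
    Function.Injective (fibrePoint t : (Over.mk t ⟶ P) → _) := by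
  intro e e' h
  have h1 : fibreSection t e = fibreSection t e' :=
    ext_of_apply_closedPoint_eq (pullback.snd P.hom t) (fibreSection_snd t e)
      (fibreSection_snd t e') h
  ext1
  rw [← fibreSection_fst t e, h1, fibreSection_fst]

lemma exists_fibrePoint_eq [LocallyOfFiniteType P.hom] (z : (pullback P.hom t : Scheme.{u}))
    (hz : IsClosed {z}) : ∃ e : Over.mk t ⟶ P, fibrePoint t e = z := by
  let s := pointOfClosedPoint (pullback.snd P.hom t) z hz
  have hs : s ≫ pullback.snd P.hom t = 𝟙 _ := pointOfClosedPoint_comp _ _ _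
  refine ⟨Over.homMk (s ≫ pullback.fst P.hom t) ?_, ?_⟩
  · rw [Category.assoc, pullback.condition, reassoc_of% hs]
    rfl
  · have h1 : s (specPoint k) = z := pointOfClosedPoint_apply _ _ _ _
    rw [← h1, fibrePoint]
    refine congrArg (fun a : Spec (.of k) ⟶ pullback P.hom t ↦ a (specPoint k)) ?_
    apply pullback.hom_ext
    · rw [fibreSection_fst]
      rfl
    · rw [fibreSection_snd, hs]

end GeometricPoints

/-! ### Geometric fibres of generalised elliptic curves -/

section Fibres

variable {S : Scheme.{u}} {k : Type u} [Field k]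

namespace GenEllCurve

variable (X : GenEllCurve S) (t : Spec (.of k) ⟶ S)

variable [IsAlgClosed k]

/-- A smooth fibre is irreducible as a whole, being connected with integral stalks; a Néron `1`-gon
contains a copy of `𝔾ₘ`. -/
lemma exists_dense_open : ∃ (W : Scheme.{u}) (j : W ⟶ pullback X.E.hom t), IsOpenImmersion j ∧
    SmoothOfRelativeDimension 1 (j ≫ pullback.snd X.E.hom t) ∧ IrreducibleSpace W ∧
    DenseRange j ∧ (Set.range j)ᶜ.Finite := by
  rcases X.fibres k t with ⟨h1, h2⟩ | h
  · refine ⟨_, 𝟙 _, inferInstance, by rwa [Category.id_comp], ?_, ?_, ?_⟩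
    · have := isNoetherian_of_quasiCompact (pullback.snd X.E.hom t)
      exact irreducibleSpace_of_isDomain_stalk fun x ↦
        (isCurveStalk_of_smooth (pullback.snd X.E.hom t) x).1.isDomain
    · exact Function.surjective_id.denseRange
    · convert Set.finite_empty
      simp
  · exact exists_open_of_isNeronOneGon _ h

/-- The fibre of `E^sm` is open in that of `E`, smooth, and nonempty because of the unit section; it
need not be identified with the smooth locus of the fibre. -/
lemma fibre_isCurve : IrreducibleSpace (pullback X.sm.hom t : Scheme.{u}) ∧
    DenseRange (fibreMap t X.incl) ∧ SmoothOfRelativeDimension 1 (pullback.snd X.sm.hom t) ∧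
    (Set.range (fibreMap t X.incl))ᶜ.Finite := by
  obtain ⟨W, j, h1, h2, h3, h4, h5⟩ := X.exists_dense_open t
  have : Smooth (fibreMap t X.incl ≫ pullback.snd X.E.hom t) := by
    rw [fibreMap_snd]; infer_instance
  have : Nonempty (pullback X.sm.hom t : Scheme.{u}) := by
    let z : Spec (.of k) := specPoint k
    obtain ⟨y, -, -⟩ := Scheme.Pullback.exists_preimage_pullback (f := X.sm.hom) (g := t)
      (η[X.sm].left (t z)) z (by
        rw [← Scheme.Hom.comp_apply, Over.w]
        rfl)
    exact ⟨y⟩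
  have h6 := isCurve_of_dense_open (pullback.snd X.E.hom t) j h4 h5 (fibreMap t X.incl)
  rwa [fibreMap_snd] at h6

instance : IrreducibleSpace (pullback X.sm.hom t : Scheme.{u}) := (X.fibre_isCurve t).1

instance : SmoothOfRelativeDimension 1 (pullback.snd X.sm.hom t) := (X.fibre_isCurve t).2.2.1

instance : IsNoetherian (pullback X.sm.hom t : Scheme.{u}) :=
  have := isNoetherian_of_quasiCompact (pullback.snd X.E.hom t)
  isNoetherian_of_isOpenImmersion (fibreMap t X.incl)

instance : IsIntegral (pullback X.sm.hom t : Scheme.{u}) := by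
  have : ∀ x : (pullback X.sm.hom t : Scheme.{u}),
      _root_.IsReduced ((pullback X.sm.hom t : Scheme.{u}).presheaf.stalk x) := fun x ↦ by
    have := (isCurveStalk_of_smooth (pullback.snd X.sm.hom t) x).1.isDomain
    infer_instance
  have := isReduced_of_isReduced_stalk (pullback X.sm.hom t)
  exact isIntegral_of_irreducibleSpace_of_isReduced _

lemma finite_of_isClosed_fibre (Z : Set (pullback X.sm.hom t : Scheme.{u})) (hZ : IsClosed Z)
    (hne : Z ≠ Set.univ) : Z.Finite :=
  finite_of_isClosed_of_isCurveStalk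
    (fun x ↦ (isCurveStalk_of_smooth (pullback.snd X.sm.hom t) x).1) Z hZ hne

end GenEllCurve

end Fibres

lemma exists_geometricPoint {Z : Scheme.{u}} (x : Z) :
    ∃ (k : Type u) (_ : Field k) (_ : IsAlgClosed k) (a : Spec (.of k) ⟶ Z), ∀ z, a z = x := by
  let κ := Z.residueField x
  refine ⟨AlgebraicClosure κ, inferInstance, inferInstance,
    Spec.map (CommRingCat.ofHom (algebraMap κ (AlgebraicClosure κ))) ≫ Z.fromSpecResidueField x,
    fun z ↦ ?_⟩
  rw [Scheme.Hom.comp_apply]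
  exact Scheme.fromSpecResidueField_apply x _

lemma GenEllCurve.exists_comp_incl_eq {S : Scheme.{u}} (X : GenEllCurve S) {k : Type u}
    [Field k] {t : Spec (.of k) ⟶ S} (e : Over.mk t ⟶ X.E)
    (he : e.left (specPoint k) ∈ Set.range X.incl.left) :
    ∃ z : Over.mk t ⟶ X.sm, z ≫ X.incl = e := by
  have h : Set.range e.left ⊆ Set.range X.incl.left := by
    rintro _ ⟨a, rfl⟩
    obtain rfl : a = specPoint k := Subsingleton.elim (α := Spec (.of k)) _ _
    exact he
  refine ⟨Over.homMk (IsOpenImmersion.lift X.incl.left e.left h) ?_, ?_⟩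
  · rw [← Over.w X.incl, IsOpenImmersion.lift_fac_assoc, Over.w]
  · ext1
    exact IsOpenImmersion.lift_fac _ _ _

/-! ### Isogenies respect the smooth loci -/

section Isogeny

variable {S : Scheme.{u}} {k : Type u} [Field k] [IsAlgClosed k] (t : Spec (.of k) ⟶ S)
  {X Y : GenEllCurve S} (f : X.Hom Y)

namespace GenEllCurve.Hom

instance isProper_left : IsProper f.hom.left := by
  have : IsProper (f.hom.left ≫ Y.E.hom) := by rw [Over.w]; infer_instance
  exact IsProper.of_comp f.hom.left Y.E.hom

/-- An isogeny has infinitely many values at the points of a geometric fibre of `E^sm`. -/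
lemma infinite_range_sm (hf : f.IsIsogeny) :
    (Set.range fun g : Over.mk t ⟶ X.sm ↦ g ≫ f.sm).Infinite := by
  intro hfin
  have : Surjective f.hom.left := hf
  have hJ : JacobsonSpace (pullback X.sm.hom t : Scheme.{u}) :=
    LocallyOfFiniteType.jacobsonSpace (pullback.snd X.sm.hom t)
  have hJE : JacobsonSpace (pullback X.E.hom t : Scheme.{u}) :=
    LocallyOfFiniteType.jacobsonSpace (pullback.snd X.E.hom t)
  -- If the range were finite, its image `F` would be a finite set of closed points, hence closed.
  let F : Set (pullback Y.E.hom t : Scheme.{u}) :=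
    (fun e ↦ fibrePoint t (e ≫ Y.incl)) '' Set.range fun g : Over.mk t ⟶ X.sm ↦ g ≫ f.sm
  have hF : F.Finite := hfin.image _
  have hclosed (y) (hy : y ∈ F) : IsClosed {y} := by
    obtain ⟨e, -, rfl⟩ := hy
    exact ((pointEquivClosedPoint (pullback.snd Y.E.hom t))
      ⟨fibreSection t (e ≫ Y.incl), fibreSection_snd t _⟩).2
  have hFc : IsClosed F := by
    rw [← Set.biUnion_of_singleton F]
    exact hF.isClosed_biUnion hclosed
  have hsub (z : (pullback X.sm.hom t : Scheme.{u})) (hz : z ∈ closedPoints _) :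
      fibreMap t f.hom (fibreMap t X.incl z) ∈ F := by
    obtain ⟨e, rfl⟩ := exists_fibrePoint_eq t z hz
    rw [fibreMap_fibrePoint, fibreMap_fibrePoint]
    refine ⟨e ≫ f.sm, ⟨e, rfl⟩, ?_⟩
    simp only [Category.assoc, f.sm_incl]
  -- The closed points of the fibre of `E^sm` are dense in that of `E` and map into `F`, so by
  -- surjectivity the fibre of `E'` is `F`. Then all its points are closed, which fails on the curve
  -- inside it.
  have hall (y : (pullback Y.E.hom t : Scheme.{u})) : y ∈ F := by
    obtain ⟨x, rfl⟩ := (fibreMap t f.hom).surjective y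
    have h1 : x ∈ closure (fibreMap t X.incl '' closedPoints _) := by
      have h2 : Dense (closedPoints (pullback X.sm.hom t : Scheme.{u})) :=
        dense_iff_closure_eq.2 closure_closedPoints
      exact (X.fibre_isCurve t).2.1.dense_image (fibreMap t X.incl).continuous h2 x
    have h3 := image_closure_subset_closure_image (fibreMap t f.hom).continuous ⟨x, h1, rfl⟩
    refine (closure_minimal ?_ hFc) h3
    rintro _ ⟨_, ⟨z, hz, rfl⟩, rfl⟩
    exact hsub z hz
  obtain ⟨w, hw⟩ := exists_not_isClosed_singleton (pullback.snd Y.sm.hom t)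
  refine hw ?_
  have h4 := (hclosed _ (hall (fibreMap t Y.incl w))).preimage (fibreMap t Y.incl).continuous
  convert h4 using 1
  ext z
  simp [(fibreMap t Y.incl).isOpenEmbedding.injective.eq_iff]

/-- The action of `E^sm` on `E` at the level of points. -/
lemma _root_.GenEll.GenEllCurve.act_incl {T : Over S} (g x : T ⟶ X.sm) :
    lift g (x ≫ X.incl) ≫ X.act = (g * x) ≫ X.incl := by
  have h := congrArg (lift g x ≫ ·) X.act_sm
  simpa [Hom.mul_def] using h

lemma _root_.GenEll.GenEllCurve.mul_act_apply {T : Over S} (g g' : T ⟶ X.sm) (x : T ⟶ X.E) :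
    lift (g * g') x ≫ X.act = lift g (lift g' x ≫ X.act) ≫ X.act := by
  have h := congrArg (lift (lift g g') x ≫ ·) X.mul_act
  simpa [Hom.mul_def] using h

lemma _root_.GenEll.GenEllCurve.one_act_apply {T : Over S} (x : T ⟶ X.E) :
    lift 1 x ≫ X.act = x := by
  have h := congrArg (lift (toUnit T) x ≫ ·) X.one_act
  simpa [Hom.one_def] using h

lemma act_apply {T : Over S} (g : T ⟶ X.sm) (x : T ⟶ X.E) :
    (lift g x ≫ X.act) ≫ f.hom = lift (g ≫ f.sm) (x ≫ f.hom) ≫ Y.act := by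
  rw [Category.assoc, f.act, lift_map_assoc]

/-- The preimage of the smooth locus under an isogeny is the smooth locus. -/
lemma mem_range_incl (hf : f.IsIsogeny) (x : X.E.left)
    (hx : f.hom.left x ∈ Set.range Y.incl.left) : x ∈ Set.range X.incl.left := by
  by_contra hx'
  obtain ⟨k, _, _, a, ha⟩ := exists_geometricPoint x
  let t : Spec (.of k) ⟶ S := a ≫ X.E.hom
  let e : Over.mk t ⟶ X.E := Over.homMk a rfl
  obtain ⟨y, hy⟩ := Y.exists_comp_incl_eq (e ≫ f.hom) (by
    change f.hom.left (a (specPoint k)) ∈ _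
    rwa [ha])
  -- The nonsmooth rational points: finite in number and stable under `E^sm`. Their images contain
  -- `f(g) * y` for all `g`, and these are infinitely many.
  let B : Set (Over.mk t ⟶ X.E) := {b | b.left (specPoint k) ∉ Set.range X.incl.left}
  have hB : B.Finite := by
    refine Set.Finite.of_finite_image (f := fibrePoint t)
      ((X.fibre_isCurve t).2.2.2.subset ?_) (fibrePoint_injective t).injOn
    rintro _ ⟨b, hb, rfl⟩ ⟨z, hz⟩
    refine hb ⟨pullback.fst X.sm.hom t z, ?_⟩
    rw [← fst_fibrePoint, ← hz, ← Scheme.Hom.comp_apply, ← Scheme.Hom.comp_apply, fibreMap_fst]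
  have hact (g : Over.mk t ⟶ X.sm) : lift g e ≫ X.act ∈ B := by
    intro hmem
    obtain ⟨z, hz⟩ := X.exists_comp_incl_eq _ hmem
    apply hx'
    have h1 : (g⁻¹ * z) ≫ X.incl = e := by
      rw [← X.act_incl, hz, ← X.mul_act_apply, inv_mul_cancel, X.one_act_apply]
    have h2 := ha (specPoint k)
    change e.left (specPoint k) = x at h2
    rw [← h1] at h2
    exact ⟨(g⁻¹ * z).left (specPoint k), h2⟩
  refine f.infinite_range_sm t hf (Set.Finite.of_finite_image (f := fun r ↦ (r * y) ≫ Y.incl)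
    ((hB.image (· ≫ f.hom)).subset ?_) ?_)
  · rintro _ ⟨_, ⟨g, rfl⟩, rfl⟩
    refine ⟨_, hact g, ?_⟩
    change (lift g e ≫ X.act) ≫ f.hom = (g ≫ f.sm * y) ≫ Y.incl
    rw [f.act_apply, ← hy, Y.act_incl]
  · intro r _ r' _ hr
    have : Mono Y.incl := Over.mono_of_mono_left _
    exact mul_right_cancel ((cancel_mono Y.incl).1 hr)

/-- An isogeny restricts to a morphism `E^sm ⟶ E'^sm` by base change. -/
lemma isPullback_sm (hf : f.IsIsogeny) :
    IsPullback f.sm.left X.incl.left Y.incl.left f.hom.left := by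
  refine IsOpenImmersion.isPullback _ _ _ _ ?_ ?_
  · rw [← Over.comp_left, ← Over.comp_left, f.sm_incl]
  · ext x
    constructor
    · exact f.mem_range_incl hf x
    · rintro ⟨y, rfl⟩
      refine ⟨f.sm.left y, ?_⟩
      rw [← Scheme.Hom.comp_apply, ← Over.comp_left, f.sm_incl]
      rfl

lemma isProper_sm (hf : f.IsIsogeny) : IsProper f.sm.left :=
  MorphismProperty.of_isPullback (P := @IsProper) (f.isPullback_sm hf).flip inferInstance

lemma surjective_sm (hf : f.IsIsogeny) : Surjective f.sm.left :=
  MorphismProperty.of_isPullback (P := @Surjective) (f.isPullback_sm hf).flip hf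

end GenEllCurve.Hom
end Isogeny

/-! ### Isogenies are finite and flat on the smooth loci -/

open TensorProduct

lemma exists_preimage_of_isPullback {P X Y Z : Scheme.{u}} {fst : P ⟶ X} {snd : P ⟶ Y} {f : X ⟶ Z}
    {g : Y ⟶ Z} (h : IsPullback fst snd f g) (x : X) (y : Y) (hxy : f x = g y) :
    ∃ w, fst w = x ∧ snd w = y := by
  obtain ⟨z, rfl, rfl⟩ := Scheme.Pullback.exists_preimage_pullback x y hxy
  refine ⟨h.isoPullback.inv z, ?_, ?_⟩
  · rw [← Scheme.Hom.comp_apply, h.isoPullback_inv_fst]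
  · rw [← Scheme.Hom.comp_apply, h.isoPullback_inv_snd]

/-- Turns a base change over a chart of `S` into a base change over `S`. -/
lemma isPullback_comp_mono {C : Type*} [Category C] {P X Y Z W : C} {fst : P ⟶ X} {snd : P ⟶ Y}
    {f : X ⟶ Z} {g : Y ⟶ Z} (h : IsPullback fst snd f g) (i : Z ⟶ W) [Mono i] :
    IsPullback fst snd (f ≫ i) (g ≫ i) :=
  ⟨⟨by rw [h.w_assoc]⟩, ⟨PullbackCone.IsLimit.mk _
    (fun s ↦ h.lift s.fst s.snd (by simpa [← cancel_mono i] using s.condition))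
    (fun s ↦ h.lift_fst _ _ _) (fun s ↦ h.lift_snd _ _ _)
    (fun s m h1 h2 ↦ h.hom_ext (by simpa using h1) (by simpa using h2))⟩⟩

namespace GenEllCurve

variable {S : Scheme.{u}}

instance (X : GenEllCurve S) : SmoothOfRelativeDimension 1 X.sm.hom :=
  smoothOfRelativeDimension_of_fibre _ 1 fun y ↦ by
    obtain ⟨k, _, _, a, ha⟩ := exists_geometricPoint y
    exact ⟨_, a, ⟨specPoint k, ha _⟩, inferInstance⟩

section Affine

variable (X : GenEllCurve S) {R C k : Type u} [CommRing R] [CommRing C] [Field k]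
  [IsAlgClosed k] [Algebra R C] [Algebra R k] (i : Spec (.of C) ⟶ X.sm.left) [IsOpenImmersion i]
  (j : Spec (.of R) ⟶ S) [Mono j]

/-- `Spec (k ⊗[R] C)` is open in a geometric fibre of `E^sm`, which is integral. If finite over `k`
and nonempty, it would have only closed points, unlike a smooth curve. -/
lemma noZeroDivisors_fibre
    (w : i ≫ X.sm.hom = Spec.map (CommRingCat.ofHom (algebraMap R C)) ≫ j) :
    NoZeroDivisors (k ⊗[R] C) ∧
    (Module.Finite k (k ⊗[R] C) → Subsingleton (k ⊗[R] C)) := by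
  let t : Spec (.of k) ⟶ S := Spec.map (CommRingCat.ofHom (algebraMap R k)) ≫ j
  let Q : Over S := Over.mk (i ≫ X.sm.hom)
  let φ : Q ⟶ X.sm := Over.homMk i rfl
  have : IsOpenImmersion φ.left := ‹IsOpenImmersion i›
  have h1 : IsPullback (Spec.map (CommRingCat.ofHom (S := k ⊗[R] C)
      Algebra.TensorProduct.includeRight.toRingHom))
      (Spec.map (CommRingCat.ofHom (S := k ⊗[R] C) Algebra.TensorProduct.includeLeftRingHom))
      Q.hom t := by
    have h2 := isPullback_comp_mono (isPullback_SpecMap_of_isPushout _ _ _ _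
      (CommRingCat.isPushout_tensorProduct R k C)) j
    rw [← w] at h2
    exact h2.flip
  let e : Spec (.of (k ⊗[R] C)) ⟶ pullback X.sm.hom t := h1.isoPullback.hom ≫ fibreMap t φ
  have he : e ≫ pullback.snd _ _ = Spec.map (CommRingCat.ofHom (S := k ⊗[R] C)
      Algebra.TensorProduct.includeLeftRingHom) := by
    rw [Category.assoc, fibreMap_snd, h1.isoPullback_hom_snd]
  rcases subsingleton_or_nontrivial (k ⊗[R] C) with h | h
  · exact ⟨inferInstance, fun _ ↦ h⟩
  · have : Nonempty (Spec (.of (k ⊗[R] C))) := inferInstanceAs (Nonempty (PrimeSpectrum (k ⊗[R] C)))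
    have hI : IsIntegral (Spec (.of (k ⊗[R] C))) := isIntegral_of_isOpenImmersion e
    have hD : IsDomain (k ⊗[R] C) := (affine_isIntegral_iff (.of (k ⊗[R] C))).1 hI
    refine ⟨inferInstance, fun hfin ↦ ?_⟩
    have : SmoothOfRelativeDimension (0 + 1) (e ≫ pullback.snd X.sm.hom t) :=
      smoothOfRelativeDimension_comp 0 1 _ _
    obtain ⟨x, hx⟩ := exists_not_isClosed_singleton (e ≫ pullback.snd X.sm.hom t)
    refine (hx ?_).elim
    have : IsArtinianRing (k ⊗[R] C) := IsArtinianRing.of_finite k _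
    have hx' (x : PrimeSpectrum (k ⊗[R] C)) : IsClosed {x} :=
      (PrimeSpectrum.isClosed_singleton_iff_isMaximal x).2 inferInstance
    exact hx' x

lemma flat_chart {A : Type u} [CommRing A] [Algebra R A] [Algebra A C] [IsScalarTower R A C]
    [Algebra.IsStandardSmoothOfRelativeDimension 1 R A] [Module.Finite A C] [Module.Flat R C]
    [Algebra.FinitePresentation R C]
    (w : i ≫ X.sm.hom = Spec.map (CommRingCat.ofHom (algebraMap R C)) ≫ j) :
    Module.Flat A C := by
  have : Algebra.IsStandardSmooth R A :=
    Algebra.IsStandardSmoothOfRelativeDimension.isStandardSmooth 1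
  rcases subsingleton_or_nontrivial A with hA | hA
  · have : Subsingleton C := Module.subsingleton A C
    infer_instance
  have : Algebra.FinitePresentation A C :=
    Algebra.FinitePresentation.of_restrict_scalars_finitePresentation R A C
  have : Module.FinitePresentation A C := .of_finite_of_finitePresentation A C
  obtain ⟨ω, hω⟩ : ∃ ω : Ω[A⁄R], Submodule.span A {ω} = ⊤ := by
    have h1 := Algebra.IsStandardSmoothOfRelativeDimension.rank_kaehlerDifferential (R := R)
      (S := A) 1
    let b := Module.Free.chooseBasis A Ω[A⁄R]
    have h2 : Cardinal.mk (Module.Free.ChooseBasisIndex A Ω[A⁄R]) = 1 := by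
      rw [← Module.Free.rank_eq_card_chooseBasisIndex, h1, Nat.cast_one]
    obtain ⟨hs, ⟨x⟩⟩ := Cardinal.eq_one_iff_unique.1 h2
    refine ⟨b x, ?_⟩
    rw [← b.span_eq]
    congr 1
    ext y
    constructor
    · rintro rfl
      exact ⟨x, rfl⟩
    · rintro ⟨z, rfl⟩
      rw [Subsingleton.elim z x]
      rfl
  -- Residue fields need not be algebraically closed; flatness of `C` over `R` embeds the fibre into
  -- a geometric one.
  have key (p : Ideal A) [p.IsPrime] : ∃ φ : p.ResidueField ⊗[R] C →+*
      AlgebraicClosure p.ResidueField ⊗[R] C, Function.Injective φ := by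
    let g : p.ResidueField →ₐ[R] AlgebraicClosure p.ResidueField :=
      IsScalarTower.toAlgHom R p.ResidueField _
    refine ⟨(Algebra.TensorProduct.map g (AlgHom.id R C)).toRingHom, ?_⟩
    exact Module.Flat.rTensor_preserves_injective_linearMap (M := C) g.toLinearMap
      g.toRingHom.injective
  refine flat_of_noZeroDivisors_fibre (R := R) ω hω ?_ ?_
  · intro p _
    obtain ⟨φ, hφ⟩ := key p
    have := (X.noZeroDivisors_fibre (k := AlgebraicClosure p.ResidueField) i j w).1
    exact hφ.noZeroDivisors φ (map_zero φ) (_root_.map_mul φ)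
  · intro p _ hfin
    obtain ⟨φ, hφ⟩ := key p
    have hK : Module.Finite (AlgebraicClosure p.ResidueField)
        (AlgebraicClosure p.ResidueField ⊗[R] C) :=
      Module.Finite.equiv (TensorProduct.AlgebraTensorModule.cancelBaseChange R p.ResidueField
        (AlgebraicClosure p.ResidueField) (AlgebraicClosure p.ResidueField) C)
    have := (X.noZeroDivisors_fibre (k := AlgebraicClosure p.ResidueField) i j w).2 hK
    exact hφ.subsingleton

end Affine

lemma flat_chart_hom (X : GenEllCurve S) {R A C : CommRingCat.{u}} (α : R ⟶ A) (β : A ⟶ C)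
    (i : Spec C ⟶ X.sm.left) [IsOpenImmersion i] (j : Spec R ⟶ S) [Mono j]
    (w : i ≫ X.sm.hom = Spec.map (α ≫ β) ≫ j)
    (hα : α.hom.IsStandardSmoothOfRelativeDimension 1) (hβ : β.hom.Finite)
    (hflat : (α ≫ β).hom.Flat) (hfp : (α ≫ β).hom.FinitePresentation) :
    β.hom.Flat ∧ β.hom.FinitePresentation := by
  refine ⟨?_, hfp.of_comp_finiteType α.hom ?_⟩
  · rw [CommRingCat.hom_comp] at hflat hfp
    algebraize [α.hom, β.hom, β.hom.comp α.hom]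
    exact X.flat_chart (R := R) (A := A) (C := C) i j w
  · algebraize [α.hom]
    have : Algebra.IsStandardSmooth R A :=
      Algebra.IsStandardSmoothOfRelativeDimension.isStandardSmooth 1
    exact inferInstanceAs (Algebra.FiniteType R A)

namespace Hom

variable {X Y : GenEllCurve S} (f : X.Hom Y)

/-- A proper morphism with finite fibres is finite. The preimage of a geometric point is closed in a
curve, and is not the whole curve because an isogeny takes infinitely many values. -/
lemma isFinite_sm (hf : f.IsIsogeny) : IsFinite f.sm.left := by
  have := f.isProper_sm hf
  have : LocallyQuasiFinite f.sm.left := .of_finite_preimage_singleton _ fun y ↦ by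
    obtain ⟨k, _, _, a, ha⟩ := exists_geometricPoint y
    let t : Spec (.of k) ⟶ S := a ≫ Y.sm.hom
    let e : Over.mk t ⟶ Y.sm := Over.homMk a rfl
    have hcl : IsClosed {fibrePoint t e} := ((pointEquivClosedPoint (pullback.snd Y.sm.hom t))
      ⟨fibreSection t e, fibreSection_snd t _⟩).2
    have h1 : (fibreMap t f.sm ⁻¹' {fibrePoint t e}).Finite := by
      refine X.finite_of_isClosed_fibre t _ (hcl.preimage (fibreMap t f.sm).continuous) fun h ↦ ?_
      refine f.infinite_range_sm t hf ((Set.finite_singleton e).subset ?_)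
      rintro _ ⟨g, rfl⟩
      apply fibrePoint_injective t
      have h2 := h.ge (Set.mem_univ (fibrePoint t g))
      rwa [← fibreMap_fibrePoint]
    refine (h1.image (pullback.fst X.sm.hom t)).subset fun x hx ↦ ?_
    obtain ⟨w, h3, h4⟩ := exists_preimage_of_isPullback (isPullback_fibreMap t f.sm)
      (fibrePoint t e) x (by
        rw [fst_fibrePoint]
        exact (ha _).trans hx.symm)
    exact ⟨w, h3, h4⟩
  exact .of_isProper_of_locallyQuasiFinite _

/-- Near any point `E'^sm` is standard smooth of relative dimension one over the base; by finiteness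
the preimage of such an affine chart is affine, and `flat_chart_hom` applies. -/
lemma flat_sm (hf : f.IsIsogeny) :
    Flat f.sm.left ∧ LocallyOfFinitePresentation f.sm.left := by
  have := f.isFinite_sm hf
  have key (x : X.sm.left) : ∃ (V : Y.sm.left.affineOpens) (W : X.sm.left.affineOpens)
      (_ : x ∈ W.1) (e : W.1 ≤ f.sm.left ⁻¹ᵁ V.1), (f.sm.left.appLE V W e).hom.Flat ∧
        (f.sm.left.appLE V W e).hom.FinitePresentation := by
    obtain ⟨U, hU, V, hV, hx, e, he⟩ :=
      SmoothOfRelativeDimension.exists_isStandardSmoothOfRelativeDimension (n := 1)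
        (f := Y.sm.hom) (f.sm.left x)
    let W := f.sm.left ⁻¹ᵁ V
    have hW : IsAffineOpen W := hV.preimage f.sm.left
    have e' : W ≤ X.sm.hom ⁻¹ᵁ U := by
      rw [← Over.w f.sm]
      exact fun x hx ↦ e hx
    have h1 : (f.sm.left.appLE V W le_rfl).hom.Finite := by
      rw [Scheme.Hom.appLE_eq_app]
      exact f.sm.left.finite_app V hV
    have h2 : Y.sm.hom.appLE U V e ≫ f.sm.left.appLE V W le_rfl = X.sm.hom.appLE U W e' := by
      rw [Scheme.Hom.appLE_comp_appLE]
      simp only [Over.w]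
    have h3 : (X.sm.hom.appLE U W e').hom.Flat := X.sm.hom.flat_appLE hU hW e'
    have h4 : (X.sm.hom.appLE U W e').hom.FinitePresentation :=
      X.sm.hom.finitePresentation_appLE hU hW e'
    have h5 := hU.SpecMap_appLE_fromSpec X.sm.hom hW e'
    rw [← h2] at h3 h4 h5
    exact ⟨⟨V, hV⟩, ⟨W, hW⟩, hx, le_rfl, X.flat_chart_hom _ _ hW.fromSpec hU.fromSpec h5.symm
      he h1 h3 h4⟩
  constructor
  · rw [HasRingHomProperty.iff_exists_appLE (P := @Flat)
      (RingHom.Flat.stableUnderComposition.stableUnderCompositionWithLocalizationAway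
        RingHom.Flat.holdsForLocalizationAway).1]
    intro x
    obtain ⟨V, W, hx, e, h, -⟩ := key x
    exact ⟨V, W, hx, e, h⟩
  · rw [HasRingHomProperty.iff_exists_appLE (P := @LocallyOfFinitePresentation)
      (RingHom.finitePresentation_stableUnderComposition.stableUnderCompositionWithLocalizationAway
        RingHom.finitePresentation_holdsForLocalizationAway).1]
    intro x
    obtain ⟨V, W, hx, e, -, h⟩ := key x
    exact ⟨V, W, hx, e, h⟩

end Hom
end GenEllCurve

/-! ### Locally constant functions as sections, and the degree -/

section LocallyConstant

variable {A : Type*} [CommRing A]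

/-- The element `a` of `A` is the section of the structure sheaf of `Spec A` given by the function
`r` with values in `ℕ`. -/
def IsSection (r : PrimeSpectrum A → ℕ) (a : A) : Prop :=
  ∀ q : PrimeSpectrum A, algebraMap A (Localization.AtPrime q.asIdeal) a = (r q : ℕ)

lemma IsSection.unique {r : PrimeSpectrum A → ℕ} {a b : A} (ha : IsSection r a)
    (hb : IsSection r b) : a = b :=
  PrimeSpectrum.toPiLocalization_injective A (funext fun q ↦ (ha q).trans (hb q).symm)

/-- By quasi-compactness there are finitely many values `n`, each taken on the locus of an
idempotent `e n`; the section is the sum of the `n * e n`. -/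
lemma exists_isSection {r : PrimeSpectrum A → ℕ} (hr : IsLocallyConstant r) :
    ∃ a, IsSection r a := by
  have hfin : (Set.range r).Finite := hr.range_finite
  have h1 (n : ℕ) : ∃ e : A, IsIdempotentElem e ∧ r ⁻¹' {n} = PrimeSpectrum.basicOpen e :=
    PrimeSpectrum.isClopen_iff.1 (hr.isClopen_fiber n)
  choose e he hre using h1
  refine ⟨∑ n ∈ hfin.toFinset, n * e n, fun q ↦ ?_⟩
  rw [map_sum, Finset.sum_eq_single (r q)]
  · have h2 : q ∈ PrimeSpectrum.basicOpen (e (r q)) := by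
      rw [← SetLike.mem_coe, ← hre]
      rfl
    have h3 : IsUnit (algebraMap A (Localization.AtPrime q.asIdeal) (e (r q))) :=
      IsLocalization.map_units (M := q.asIdeal.primeCompl) _ ⟨_, h2⟩
    have h4 := (he (r q)).map (algebraMap A (Localization.AtPrime q.asIdeal))
    rw [_root_.map_mul, map_natCast, h3.mul_eq_left.1 h4, _root_.mul_one]
  · intro n _ hn
    have h2 : q ∉ PrimeSpectrum.basicOpen (e n) := by
      rw [← SetLike.mem_coe, ← hre]
      exact fun h ↦ hn h.symm
    have h5 : e n ∈ q.asIdeal := by simpa using h2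
    have h6 : 1 - e n ∉ q.asIdeal := fun h ↦
      q.2.ne_top ((Ideal.eq_top_iff_one _).2 (by simpa using q.asIdeal.add_mem h h5))
    rw [_root_.map_mul]
    convert mul_zero _
    refine (IsLocalization.map_eq_zero_iff q.asIdeal.primeCompl _ _).2 ⟨⟨_, h6⟩, ?_⟩
    rw [sub_mul, (he n).eq, _root_.one_mul, sub_self]
  · intro h
    exact (h (by simp)).elim

lemma IsSection.map {B : Type*} [CommRing B] {r : PrimeSpectrum A → ℕ} {a : A}
    (ha : IsSection r a) (φ : A →+* B) : IsSection (r ∘ PrimeSpectrum.comap φ) (φ a) := by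
  intro q
  have h := congrArg (Localization.localRingHom (PrimeSpectrum.comap φ q).asIdeal q.asIdeal φ rfl)
    (ha (PrimeSpectrum.comap φ q))
  rw [map_natCast] at h
  exact (Localization.localRingHom_to_map _ _ φ rfl a).symm.trans h

/-- In the local ring at `q` the section equals the integer `r q`, so it lies in `q` exactly when
that integer does. -/
lemma IsSection.isUnit {r : PrimeSpectrum A → ℕ} {a : A} (ha : IsSection r a) :
    IsUnit a ↔ ∀ q : PrimeSpectrum A, (r q : A) ∉ q.asIdeal := by
  have h (q : PrimeSpectrum A) : a ∈ q.asIdeal ↔ (r q : A) ∈ q.asIdeal := by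
    have h1 (b : A) : algebraMap A (Localization.AtPrime q.asIdeal) b ∈
        IsLocalRing.maximalIdeal (Localization.AtPrime q.asIdeal) ↔ b ∈ q.asIdeal :=
      IsLocalization.AtPrime.to_map_mem_maximal_iff _ q.asIdeal b
    rw [← h1, ha q, ← h1, map_natCast]
  constructor
  · intro hu q hq
    exact q.2.ne_top (Ideal.eq_top_of_isUnit_mem _ ((h q).2 hq) hu)
  · intro hq
    by_contra hu
    obtain ⟨m, hm, hmem⟩ := exists_max_ideal_of_mem_nonunits hu
    exact hq ⟨m, hm.isPrime⟩ ((h ⟨m, hm.isPrime⟩).1 hmem)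

end LocallyConstant

namespace GenEllCurve.Hom

variable {S T : Scheme.{u}} {X Y : GenEllCurve S} (f : X.Hom Y)

lemma isPullback_kernel : IsPullback (kerι f.sm).left f.kernel.hom f.sm.left η[Y.sm].left :=
  IsPullback.of_hasPullback _ _

lemma isFinite_kernel (hf : f.IsIsogeny) : IsFinite f.kernel.hom :=
  MorphismProperty.of_isPullback (P := @IsFinite) f.isPullback_kernel (f.isFinite_sm hf)

lemma flat_kernel (hf : f.IsIsogeny) : Flat f.kernel.hom :=
  MorphismProperty.of_isPullback (P := @Flat) f.isPullback_kernel (f.flat_sm hf).1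

lemma locallyOfFinitePresentation_kernel (hf : f.IsIsogeny) :
    LocallyOfFinitePresentation f.kernel.hom :=
  MorphismProperty.of_isPullback (P := @LocallyOfFinitePresentation) f.isPullback_kernel
    (f.flat_sm hf).2

lemma finrank_kernel (hf : f.IsIsogeny) (s : S) :
    f.kernel.hom.finrank s = f.sm.left.finrank (η[Y.sm].left s) :=
  have := f.isFinite_sm hf
  have := (f.flat_sm hf).1
  Scheme.Hom.finrank_of_isPullback _ _ _ _ f.isPullback_kernel s

/-- The rank of the kernel is that of the finite flat map of smooth loci along the unit section, and
such ranks are stable under base change. -/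
lemma finrank_kernel_of_baseChange {g : S ⟶ T} {X' Y' : GenEllCurve T} (f' : X'.Hom Y')
    (hf : f.IsIsogeny) (hf' : f'.IsIsogeny) (bX : BaseChange g X X') (bY : BaseChange g Y Y')
    (h : f.sm.left ≫ bY.sm = bX.sm ≫ f'.sm.left) (s : S) :
    f.kernel.hom.finrank s = f'.kernel.hom.finrank (g s) := by
  have := f'.isFinite_sm hf'
  have := (f'.flat_sm hf').1
  have h1 : IsPullback bX.sm f.sm.left f'.sm.left bY.sm := by
    refine IsPullback.of_bot (v₂₁ := Y.sm.hom) (v₂₂ := Y'.sm.hom) (h₃₁ := g) ?_ h.symm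
      bY.isPullback_sm
    rw [Over.w, Over.w]
    exact bX.isPullback_sm
  rw [f.finrank_kernel hf, f'.finrank_kernel hf', Scheme.Hom.finrank_of_isPullback _ _ _ _ h1,
    ← Scheme.Hom.comp_apply, bY.isGroupBaseChange.one_comp]
  rfl

end GenEllCurve.Hom

lemma exists_of_isAdicComplete {R : Type*} [CommRing R] (I : Ideal R) [IsAdicComplete I R]
    (a : ∀ m : ℕ, R ⧸ I ^ (m + 1))
    (h : ∀ m, Ideal.Quotient.factor (Ideal.pow_le_pow_right (Nat.le_succ (m + 1))) (a (m + 1)) =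
      a m) : ∃ δ : R, ∀ m, Ideal.Quotient.mk _ δ = a m := by
  choose x hx using fun m ↦ Ideal.Quotient.mk_surjective (a m)
  have h1 (m : ℕ) : x (m + 1) - x m ∈ I ^ (m + 1) := by
    rw [← Ideal.Quotient.eq, hx m, ← h m, ← hx (m + 1)]
    rfl
  have h2 {m n : ℕ} (hmn : m ≤ n) : x n - x m ∈ I ^ (m + 1) := by
    induction n, hmn using Nat.le_induction with
    | base => simp
    | succ n hmn ih =>
      rw [← sub_add_sub_cancel _ (x n)]
      exact add_mem (Ideal.pow_le_pow_right (by lia) (h1 n)) ih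
  -- The shift `n - 1` is due to `a m` living modulo `I ^ (m + 1)`, whereas the `m`-th condition
  -- here is modulo `I ^ m` and is empty for `m = 0`.
  obtain ⟨L, hL⟩ := IsPrecomplete.prec' (I := I) (M := R) (fun n ↦ x (n - 1)) (by
    intro m n hmn
    rw [SModEq.sub_mem, ← neg_mem_iff, neg_sub, smul_eq_mul, Ideal.mul_top]
    rcases m with - | m
    · simp
    · exact h2 (by lia))
  refine ⟨L, fun m ↦ ?_⟩
  have h3 := hL (m + 1)
  rw [SModEq.sub_mem, smul_eq_mul, Ideal.mul_top] at h3
  rw [← hx m]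
  exact (Ideal.Quotient.eq.2 h3).symm

namespace FormalGenEllCurve.Hom

variable {R : Type u} [CommRing R] {I : Ideal R} {X Y : FormalGenEllCurve I} (f : X.Hom Y)

/-- The rank of the kernel of `f` over `Spec (R / Iᵐ⁺¹)`. -/
def rank (m : ℕ) (q : PrimeSpectrum (R ⧸ I ^ (m + 1))) : ℕ := (f.app m).kernel.hom.finrank q

lemma isDegree_iff (hf : f.IsIsogeny) (δ : R) :
    f.IsDegree δ ↔ ∀ m, IsSection (f.rank m) (Ideal.Quotient.mk _ δ) :=
  forall_congr' fun m ↦ ⟨fun h ↦ h.2.2.2, fun h ↦ ⟨(f.app m).isFinite_kernel (hf m),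
    (f.app m).flat_kernel (hf m), (f.app m).locallyOfFinitePresentation_kernel (hf m), h⟩⟩

lemma rank_comap (hf : f.IsIsogeny) (m : ℕ) (q : PrimeSpectrum (R ⧸ I ^ (m + 1))) :
    f.rank (m + 1) (PrimeSpectrum.comap
      (Ideal.Quotient.factor (Ideal.pow_le_pow_right (Nat.le_succ (m + 1)))) q) = f.rank m q :=
  ((f.app m).finrank_kernel_of_baseChange (f.app (m + 1)) (hf m) (hf (m + 1)) (X.trans m)
    (Y.trans m) (f.comm_sm m) q).symm

lemma isLocallyConstant_rank (hf : f.IsIsogeny) (m : ℕ) : IsLocallyConstant (f.rank m) :=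
  have := (f.app m).isFinite_kernel (hf m)
  have := (f.app m).flat_kernel (hf m)
  have := (f.app m).locallyOfFinitePresentation_kernel (hf m)
  (f.app m).kernel.hom.isLocallyConstant_finrank

/-- The sections given by the ranks are compatible because a section is determined by its function.
Completeness provides `δ`, and separatedness makes it unique. -/
lemma existsUnique_isDegree [IsAdicComplete I R] (hf : f.IsIsogeny) :
    ∃! δ : R, f.IsDegree δ := by
  choose a ha using fun m ↦ exists_isSection (f.isLocallyConstant_rank hf m)
  obtain ⟨δ, hδ⟩ := exists_of_isAdicComplete I a fun m ↦ by
    have h := (ha (m + 1)).map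
      (Ideal.Quotient.factor (Ideal.pow_le_pow_right (I := I) (Nat.le_succ (m + 1))))
    refine IsSection.unique (r := f.rank m) ?_ (ha m)
    convert h using 1
    exact funext fun q ↦ (f.rank_comap hf m q).symm
  refine ⟨δ, (f.isDegree_iff hf δ).2 fun m ↦ (hδ m).symm ▸ ha m, fun δ' hδ' ↦ ?_⟩
  replace hδ' := (f.isDegree_iff hf δ').1 hδ'
  refine (IsHausdorff.eq_iff_smodEq (I := I)).2 fun n ↦ ?_
  rw [SModEq.sub_mem, smul_eq_mul, Ideal.mul_top]
  refine Ideal.pow_le_pow_right (Nat.le_succ n) (Ideal.Quotient.eq.1 ?_)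
  exact (hδ' n).unique ((hδ n).symm ▸ ha n)

end FormalGenEllCurve.Hom

/-! ### From finite group schemes to groups of points of algebras -/

section Transfer

variable {S : Scheme.{u}} {K : Over S}

/-- A finite scheme over an affine scheme is the spectrum of a finite algebra. -/
lemma exists_finiteAlgebra (K : Over S) [IsFinite K.hom] {A : Type u} [CommRing A]
    (j : Spec (.of A) ⟶ S) : ∃ (D : Type u) (_ : CommRing D) (_ : Algebra A D)
      (v : Spec (.of D) ⟶ K.left), Module.Finite A D ∧
        IsPullback v (Spec.map (CommRingCat.ofHom (algebraMap A D))) K.hom j := by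
  let P := pullback K.hom j
  have : IsAffine P := isAffine_of_isAffineHom (pullback.snd K.hom j)
  obtain ⟨φ, hφ⟩ := Spec.map_surjective (P.isoSpec.inv ≫ pullback.snd K.hom j)
  have hfin : IsFinite (Spec.map φ) := by rw [hφ]; infer_instance
  let := φ.hom.toAlgebra
  refine ⟨Γ(P, ⊤), inferInstance, inferInstance, P.isoSpec.inv ≫ pullback.fst K.hom j,
    (IsFinite.SpecMap_iff φ).1 hfin, ?_⟩
  refine (IsPullback.of_hasPullback K.hom j).of_iso P.isoSpec (Iso.refl _) (Iso.refl _)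
    (Iso.refl _) ?_ ?_ ?_ ?_
  · simp
  · have h1 : Spec.map (CommRingCat.ofHom (algebraMap A Γ(P, ⊤))) =
      P.isoSpec.inv ≫ pullback.snd K.hom j := hφ
    simp [h1]
  · simp
  · simp

variable {k C : Type u} [CommRing k] [CommRing C] [Algebra k C] {t : Spec (.of k) ⟶ S}
  {v : Spec (.of C) ⟶ K.left}
  {B B' : Type u} [CommRing B] [Algebra k B] [CommRing B'] [Algebra k B']

variable (t B) in
/-- The spectrum of a `k`-algebra, over `S`. -/
abbrev specOver : Over S := Over.mk (Spec.map (CommRingCat.ofHom (algebraMap k B)) ≫ t)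

variable (t) in
/-- The morphism over `S` given by a homomorphism of `k`-algebras. -/
def specOverMap (φ : B →ₐ[k] B') : specOver t B' ⟶ specOver t B :=
  Over.homMk (Spec.map (CommRingCat.ofHom φ.toRingHom)) (by
    change _ ≫ Spec.map _ ≫ t = Spec.map _ ≫ t
    rw [← Category.assoc, ← Spec.map_comp, ← CommRingCat.ofHom_comp]
    congr 3
    exact φ.comp_algebraMap)

variable (h : IsPullback v (Spec.map (CommRingCat.ofHom (algebraMap k C))) K.hom t)

/-- The universal point of a finite group scheme. -/
def univPoint : specOver t C ⟶ K := Over.homMk v h.w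

/-- The points of the fibre as points of `K`. -/
def toPoint (x : Points k C B) : specOver t B ⟶ K := specOverMap t x.hom ≫ univPoint h

/-- The universal property of the fibre product, read through the full faithfulness of `Spec`. -/
lemma toPoint_bijective : Function.Bijective (toPoint h : Points k C B → _) := by
  constructor
  · intro x y hxy
    have h1 : Spec.map (CommRingCat.ofHom x.hom.toRingHom) =
        Spec.map (CommRingCat.ofHom y.hom.toRingHom) := by
      refine h.hom_ext congr(($hxy).left) ?_
      rw [← Spec.map_comp, ← Spec.map_comp, ← CommRingCat.ofHom_comp, ← CommRingCat.ofHom_comp]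
      congr 2
      exact x.hom.comp_algebraMap.trans y.hom.comp_algebraMap.symm
    have h2 := congrArg CommRingCat.Hom.hom (Spec.map_injective h1)
    exact Points.ext fun c ↦ congr($h2 c)
  · intro g
    let l := h.lift g.left (Spec.map (CommRingCat.ofHom (algebraMap k B))) (Over.w g)
    obtain ⟨ψ, hψ⟩ := Spec.map_surjective l
    have h1 : CommRingCat.ofHom (algebraMap k C) ≫ ψ = CommRingCat.ofHom (algebraMap k B) := by
      apply Spec.map_injective
      rw [Spec.map_comp, hψ]
      exact h.lift_snd _ _ _
    let φ : C →ₐ[k] B := ⟨ψ.hom, fun r ↦ congr(($h1).hom r)⟩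
    refine ⟨Points.of φ, ?_⟩
    ext1
    change Spec.map ψ ≫ v = g.left
    rw [hψ]
    exact h.lift_fst _ _ _

lemma toPoint_map (φ : B →ₐ[k] B') (x : Points k C B) :
    toPoint h (Points.map φ x) = specOverMap t φ ≫ toPoint h x := by
  rw [toPoint, toPoint, ← Category.assoc]
  congr 1
  ext1
  change Spec.map _ = Spec.map _ ≫ Spec.map _
  rw [← Spec.map_comp]
  rfl

/-- The points of the fibre are the points of `K`. -/
def pointEquiv (B : Type u) [CommRing B] [Algebra k B] : Points k C B ≃ (specOver t B ⟶ K) :=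
  Equiv.ofBijective _ (toPoint_bijective h)

/-- The points of the fibres of a group scheme form groups. -/
@[reducible]
def fibrePointGroup [GrpObj K] : PointGroup k C where
  grp B _ _ := (pointEquiv h B).group
  grp_map_mul {B B'} _ _ _ _ φ x y := by
    apply (pointEquiv h B').injective
    let := (pointEquiv h B).group
    let := (pointEquiv h B').group
    have h1 (x y : Points k C B) : pointEquiv h B (x * y) = pointEquiv h B x * pointEquiv h B y :=
      (pointEquiv h B).apply_symm_apply _
    have h2 (x y : Points k C B') :
        pointEquiv h B' (x * y) = pointEquiv h B' x * pointEquiv h B' y :=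
      (pointEquiv h B').apply_symm_apply _
    have h3 (x : Points k C B) : pointEquiv h B' (Points.map φ x) =
      specOverMap t φ ≫ pointEquiv h B x := toPoint_map h φ x
    change pointEquiv h B' (Points.map φ (x * y)) =
      pointEquiv h B' (Points.map φ x * Points.map φ y)
    rw [h2, h3, h1, h3, h3, comp_mul]

lemma toPoint_pow [GrpObj K] (x : Points k C B) (n : ℕ) :
    letI := fibrePointGroup h
    toPoint h (x ^ n) = toPoint h x ^ n := by
  let := fibrePointGroup h
  exact map_pow ((pointEquiv h B).mulEquiv) x n

lemma toPoint_eq_one [GrpObj K] (x : Points k C B) :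
    letI := fibrePointGroup h
    toPoint h x = 1 ↔ x = 1 := by
  let := fibrePointGroup h
  exact map_eq_one_iff ((pointEquiv h B).mulEquiv) (pointEquiv h B).injective

end Transfer

section Field

variable {S : Scheme.{u}} {K : Over S} {k C : Type u} [Field k] [CommRing C] [Algebra k C]
  {t : Spec (.of k) ⟶ S} {v : Spec (.of C) ⟶ K.left}

lemma finrank_eq_finrank
    (h : IsPullback v (Spec.map (CommRingCat.ofHom (algebraMap k C))) K.hom t)
    [Module.Finite k C] [IsFinite K.hom] [Flat K.hom] (s : S) (hs : t (specPoint k) = s) :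
    K.hom.finrank s = Module.finrank k C := by
  rw [← hs, ← Scheme.Hom.finrank_of_isPullback _ _ _ _ h]
  exact (Scheme.Hom.finrank_SpecMap_algebraMap k C _).trans
    (congrFun (Module.rankAtStalk_eq_finrank_of_free) _)

/-- A finite flat group scheme without `p`-torsion has rank prime to `p` in characteristic `p`. -/
lemma not_dvd_finrank_of_torsion_trivial (p : ℕ) [Fact p.Prime] [CharP k p] [IsAlgClosed k]
    [GrpObj K] [IsFinite K.hom] [Flat K.hom] (s : S) (hs : t (specPoint k) = s)
    (hK : ∀ (T : Over S) (x : T ⟶ K), x ^ p = 1 → x = 1) : ¬ p ∣ K.hom.finrank s := by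
  obtain ⟨C, _, _, v, _, h⟩ := exists_finiteAlgebra K t
  let := fibrePointGroup h
  rw [finrank_eq_finrank h s hs]
  refine PointGroup.not_dvd_finrank p fun B _ _ x hx ↦ ?_
  refine (toPoint_eq_one h x).1 (hK _ _ ?_)
  rw [← toPoint_pow]
  exact (toPoint_eq_one h _).2 hx

end Field

/-! ### Closed subschemes of curves -/

section Unramified

lemma isPrincipal_maximalIdeal_of_surjective {A B : Type*} [CommRing A] [CommRing B]
    [IsLocalRing A] [IsLocalRing B] (φ : A →+* B) (hφ : Function.Surjective φ)
    (hA : (IsLocalRing.maximalIdeal A).IsPrincipal) :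
    (IsLocalRing.maximalIdeal B).IsPrincipal := by
  obtain ⟨a, ha⟩ := hA
  have : IsLocalHom φ := .of_surjective φ hφ
  refine ⟨φ a, ?_⟩
  rw [Ideal.submodule_span_eq] at ha ⊢
  rw [← Set.image_singleton, ← Ideal.map_span, ← ha]
  ext x
  rw [Ideal.mem_map_iff_of_surjective φ hφ]
  constructor
  · intro hx
    obtain ⟨y, rfl⟩ := hφ x
    exact ⟨y, (map_mem_nonunits_iff φ y).1 hx, rfl⟩
  · rintro ⟨y, hy, rfl⟩
    exact (map_mem_nonunits_iff φ y).2 hy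

/-- The local rings of a closed subscheme are quotients of those of the curve. It is through this
that the embedding of the kernel in a curve is used. -/
lemma isPrincipal_of_isClosedImmersion {Z : Scheme.{u}} {C : Type u} [CommRing C]
    (i : Spec (.of C) ⟶ Z) [IsClosedImmersion i] (hZ : ∀ z : Z, IsCurveStalk (Z.presheaf.stalk z))
    (P : Ideal C) [hP : P.IsPrime] :
    (IsLocalRing.maximalIdeal (Localization.AtPrime P)).IsPrincipal := by
  let x : Spec (.of C) := (⟨P, hP⟩ : PrimeSpectrum C)
  have h1 := i.stalkMap_surjective x
  let alg : Algebra C ((Spec (.of C)).presheaf.stalk x) :=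
    StructureSheaf.stalkAlgebra C (⟨P, hP⟩ : PrimeSpectrum C)
  have : IsLocalization.AtPrime ((Spec (.of C)).presheaf.stalk x) P :=
    StructureSheaf.IsLocalization.to_stalk C ⟨P, hP⟩
  let e : (Spec (.of C)).presheaf.stalk x ≃+* Localization.AtPrime P :=
    (IsLocalization.algEquiv P.primeCompl ((Spec (.of C)).presheaf.stalk x)
      (Localization.AtPrime P)).toRingEquiv
  exact isPrincipal_maximalIdeal_of_surjective ((e : _ →+* _).comp (i.stalkMap x).hom)
    (e.surjective.comp h1) (hZ _).isPrincipal

end Unramified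

/-! ### Bijectivity tested on geometric fibres -/

section Nakayama

lemma nontrivial_tensorProduct_of_field {F L V : Type*} [Field F] [Field L] [Algebra F L]
    [AddCommGroup V] [Module F V] [Nontrivial V] : Nontrivial (L ⊗[F] V) := inferInstance

variable {A D : Type u} [CommRing A] [CommRing D] [Algebra A D] [Module.Finite A D]

/-- A surjective endomorphism of a finite module is injective, and the cokernel, a finite module,
vanishes when its geometric fibres do. -/
lemma bijective_of_geometric_fibres (ψ : D →ₐ[A] D)
    (hψ : ∀ (k : Type u) [Field k] [IsAlgClosed k] [Algebra A k],
      Function.Surjective (ψ.toLinearMap.lTensor k)) : Function.Bijective ψ := by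
  suffices hs : Function.Surjective ψ.toLinearMap from
    ⟨OrzechProperty.injective_of_surjective_endomorphism ψ.toLinearMap hs, hs⟩
  rw [← LinearMap.range_eq_top, ← Submodule.Quotient.subsingleton_iff,
    ← Module.support_eq_empty_iff (R := A), Set.eq_empty_iff_forall_notMem]
  intro q hq
  rw [Module.mem_support_iff_nontrivial_residueField_tensorProduct] at hq
  let κ := q.asIdeal.ResidueField
  let Q := D ⧸ LinearMap.range ψ.toLinearMap
  let k := AlgebraicClosure κ
  have h1 : Nontrivial (k ⊗[κ] (κ ⊗[A] Q)) :=
    nontrivial_tensorProduct_of_field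
  have h2 : Nontrivial (k ⊗[A] Q) :=
    (TensorProduct.AlgebraTensorModule.cancelBaseChange A κ k k Q).symm.toEquiv.nontrivial
  have h3 := lTensor_exact k (LinearMap.exact_map_mkQ_range ψ.toLinearMap)
    (Submodule.mkQ_surjective _)
  refine not_subsingleton (k ⊗[A] Q) ⟨fun a b ↦ ?_⟩
  have h4 (a : k ⊗[A] Q) : a = 0 := by
    obtain ⟨c, rfl⟩ := LinearMap.lTensor_surjective k (Submodule.mkQ_surjective _) a
    exact (h3 c).2 (hψ k c)
  rw [h4 a, h4 b]

end Nakayama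

/-! ### Multiplication by `p` on the kernel -/

section MulByKernel

variable {S : Scheme.{u}}

lemma charP_of_isNilpotent {A k : Type*} [CommRing A] [Field k] [Algebra A k] (p : ℕ)
    [hp : Fact p.Prime] (h : IsNilpotent (p : A)) : CharP k p :=
  (CharP.charP_iff_prime_eq_zero hp.out).2 <| by
    rw [← map_natCast (algebraMap A k)]
    exact (h.map (algebraMap A k)).eq_zero

/-- The fibre of a finite group scheme over an affine scheme. -/
lemma isPullback_fibre {K : Over S} {A D : Type u} (k : Type u) [CommRing A] [CommRing D]
    [CommRing k] [Algebra A D] [Algebra A k] {j : Spec (.of A) ⟶ S} {v : Spec (.of D) ⟶ K.left}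
    (h : IsPullback v (Spec.map (CommRingCat.ofHom (algebraMap A D))) K.hom j) :
    IsPullback (Spec.map (CommRingCat.ofHom (S := k ⊗[A] D)
        Algebra.TensorProduct.includeRight.toRingHom) ≫ v)
      (Spec.map (CommRingCat.ofHom (algebraMap k (k ⊗[A] D)))) K.hom
      (Spec.map (CommRingCat.ofHom (algebraMap A k)) ≫ j) :=
  (isPullback_SpecMap_of_isPushout _ _ _ _
    (CommRingCat.isPushout_tensorProduct A k D)).flip.paste_horiz h

/-- The power of the universal point. -/
lemma toPoint_id_pow {K : Over S} [GrpObj K] {A D : Type u} [CommRing A] [CommRing D]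
    [Algebra A D] {j : Spec (.of A) ⟶ S} {v : Spec (.of D) ⟶ K.left}
    (h : IsPullback v (Spec.map (CommRingCat.ofHom (algebraMap A D))) K.hom j) (n : ℕ) :
    letI := fibrePointGroup h
    Spec.map (CommRingCat.ofHom (Points.of (AlgHom.id A D) ^ n).hom.toRingHom) ≫ v =
      v ≫ (mulBy K n).left := by
  let _ := fibrePointGroup h
  have h2 : toPoint h (Points.of (AlgHom.id A D) ^ n) = univPoint h ≫ mulBy K n := by
    rw [toPoint_pow, comp_mulBy]
    congr 1
    ext1
    change Spec.map (𝟙 _) ≫ v = v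
    rw [Spec.map_id, Category.id_comp]
  exact congr(($h2).left)

/-- The power of the universal point of a fibre is induced by that of the universal point. -/
lemma pow_hom_eq_map {K : Over S} [GrpObj K] {A D k : Type u} [CommRing A] [CommRing D]
    [CommRing k] [Algebra A D] [Algebra A k] {j : Spec (.of A) ⟶ S} {v : Spec (.of D) ⟶ K.left}
    (h : IsPullback v (Spec.map (CommRingCat.ofHom (algebraMap A D))) K.hom j) (n : ℕ) :
    letI := fibrePointGroup h
    letI := fibrePointGroup (isPullback_fibre k h)
    (Points.of (AlgHom.id k (k ⊗[A] D)) ^ n).hom =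
      Algebra.TensorProduct.map (AlgHom.id k k) (Points.of (AlgHom.id A D) ^ n).hom := by
  let _ := fibrePointGroup h
  let _ := fibrePointGroup (isPullback_fibre k h)
  set ψ := (Points.of (AlgHom.id A D) ^ n).hom
  refine (toPoint_bijective (isPullback_fibre k h)).1 (a₁ := Points.of (AlgHom.id k (k ⊗[A] D)) ^ n)
    (a₂ := Points.of (Algebra.TensorProduct.map (AlgHom.id k k) ψ)) ?_
  have h1 : Spec.map (CommRingCat.ofHom ψ.toRingHom) ≫ v = v ≫ (mulBy K n).left :=
    toPoint_id_pow h n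
  ext1
  change Spec.map _ ≫ _ = Spec.map (CommRingCat.ofHom
    (Algebra.TensorProduct.map (AlgHom.id k k) ψ).toRingHom) ≫
      Spec.map (CommRingCat.ofHom Algebra.TensorProduct.includeRight.toRingHom) ≫ v
  refine (toPoint_id_pow (isPullback_fibre k h) n).trans ?_
  rw [Category.assoc, ← h1, ← Category.assoc, ← Category.assoc,
    ← Spec.map_comp, ← Spec.map_comp, ← CommRingCat.ofHom_comp, ← CommRingCat.ofHom_comp]
  congr 3

namespace GenEllCurve.Hom

variable {X Y : GenEllCurve S} (f : X.Hom Y)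

lemma isClosedImmersion_kerι : IsClosedImmersion (kerι f.sm).left := by
  have : IsClosedImmersion η[Y.sm].left := by
    have : IsClosedImmersion (η[Y.sm].left ≫ Y.sm.hom) := by
      rw [Over.w]
      exact inferInstanceAs (IsClosedImmersion (𝟙 S))
    exact IsClosedImmersion.of_comp _ Y.sm.hom
  exact inferInstanceAs (IsClosedImmersion (pullback.fst f.sm.left η[Y.sm].left))

instance : GrpObj f.kernel := inferInstanceAs (GrpObj (ker f.sm))

/-- Multiplication by `p` is an automorphism of the kernel of an isogeny of degree prime to the
residue characteristic `p`. -/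
lemma isIso_mulBy_kernel (hf : f.IsIsogeny) {A : Type u} [CommRing A] (j : Spec (.of A) ⟶ S)
    [IsIso j] (p : ℕ) [Fact p.Prime] (hp : IsNilpotent (p : A))
    (hr : ∀ s : S, ¬ p ∣ f.kernel.hom.finrank s) : IsIso (mulBy f.kernel p) := by
  have := f.isFinite_kernel hf
  have := f.flat_kernel hf
  have hcl := f.isClosedImmersion_kerι
  obtain ⟨D, _, _, v, _, h⟩ := exists_finiteAlgebra f.kernel j
  have : IsIso v := h.isIso_fst_of_isIso
  let _ := fibrePointGroup h
  let ψ := (Points.of (AlgHom.id A D) ^ p).hom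
  have hψ : Function.Bijective ψ := by
    -- On a geometric fibre the kernel is closed in a smooth curve and has order prime to `p`, the
    -- characteristic of `k`: this is the setting of `bijective_pow`.
    refine bijective_of_geometric_fibres ψ fun k _ _ _ ↦ ?_
    have hk := isPullback_fibre k h
    let _ := fibrePointGroup hk
    have := charP_of_isNilpotent (k := k) p hp
    let t : Spec (.of k) ⟶ S := Spec.map (CommRingCat.ofHom (algebraMap A k)) ≫ j
    let ι₀ : f.kernel ⟶ X.sm := kerι f.sm
    have : IsClosedImmersion (fibreMap t ι₀) :=
      MorphismProperty.of_isPullback (P := @IsClosedImmersion) (isPullback_fibreMap t ι₀).flip hcl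
    have h1 := PointGroup.bijective_pow (k := k) (C := k ⊗[A] D) p
      (isPrincipal_of_isClosedImmersion (hk.isoPullback.hom ≫ fibreMap t ι₀)
        (fun z ↦ (isCurveStalk_of_smooth (pullback.snd X.sm.hom t) z).1) _)
      (by rw [← finrank_eq_finrank hk _ rfl]; exact hr _)
    have h2 := pow_hom_eq_map (k := k) h p
    rw [h2] at h1
    exact h1.2
  have h3 : v ≫ (mulBy f.kernel p).left = Spec.map (CommRingCat.ofHom ψ.toRingHom) ≫ v :=
    (toPoint_id_pow h p).symm
  have : IsIso (CommRingCat.ofHom ψ.toRingHom) :=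
    (ConcreteCategory.isIso_iff_bijective _).2 hψ
  have h4 : IsIso (v ≫ (mulBy f.kernel p).left) := by
    rw [h3]
    infer_instance
  have : IsIso ((Over.forget S).map (mulBy f.kernel p)) :=
    IsIso.of_isIso_comp_left v (mulBy f.kernel p).left
  exact isIso_of_reflects_iso _ (Over.forget S)

end GenEllCurve.Hom

end MulByKernel

/-! ### Torsion of source and target of a homomorphism -/

section Torsion

variable {S : Scheme.{u}} {G H : Over S} [GrpObj G] [GrpObj H] (f : G ⟶ H) [IsMonHom f]

lemma isIso_mulBy_pow (p : ℕ) [IsIso (mulBy G p)] (n : ℕ) : IsIso (mulBy G (p ^ n)) := by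
  induction n with
  | zero =>
    have h : mulBy G (p ^ 0) = 𝟙 G := by rw [mulBy, pow_zero, pow_one]
    rw [h]
    infer_instance
  | succ n ih =>
    have h : mulBy G (p ^ (n + 1)) = mulBy G (p ^ n) ≫ mulBy G p := by
      rw [comp_mulBy, mulBy, mulBy, ← pow_mul, pow_succ]
    rw [h]
    infer_instance

variable [IsCommMonObj G] [IsCommMonObj H]

/-- If `f` is injective on `N`-torsion, its kernel has no `N`-torsion. -/
lemma eq_one_of_mono_torsionMap (N : ℕ) [Mono (torsionMap f N)] {T : Over S} (x : T ⟶ ker f)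
    (hx : x ^ N = 1) : x = 1 := by
  have h1 : (x ≫ kerι f) ^ N = 1 := by rw [← pow_comp, hx, one_comp]
  have h2 : (x ≫ kerι f) ≫ f = 1 := by rw [Category.assoc, kerι_comp, comp_one]
  have h3 : torsionLift (x ≫ kerι f) h1 = torsionLift 1 (one_pow N) := by
    rw [← cancel_mono (torsionMap f N), ← cancel_mono (torsionι H N)]
    simp only [Category.assoc, torsionMap_ι]
    rw [← Category.assoc, torsionLift_ι, ← Category.assoc, torsionLift_ι, h2, one_comp]
  have h4 := congrArg (· ≫ torsionι G N) h3
  simp only [torsionLift_ι] at h4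
  rw [← cancel_mono (kerι f), h4, one_comp]

/-- Two `N`-torsion points with the same image differ by an `N`-torsion point of the kernel. -/
lemma mono_torsionMap (N : ℕ) (hK : Mono (mulBy (ker f) N)) : Mono (torsionMap f N) := by
  refine ⟨fun {T} x y hxy ↦ ?_⟩
  have h1 : (x ≫ torsionι G N) ≫ f = (y ≫ torsionι G N) ≫ f := by
    simp only [Category.assoc, ← torsionMap_ι, reassoc_of% hxy]
  have h2 (x : T ⟶ torsion G N) : (x ≫ torsionι G N) ^ N = 1 := by
    rw [← comp_pow, torsionι_pow, comp_one]
  let z : T ⟶ ker f := kerLift f ((x ≫ torsionι G N) / (y ≫ torsionι G N)) (by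
    rw [GrpObj.div_comp, h1, div_self'])
  have hz : z = 1 := by
    rw [← cancel_mono (mulBy (ker f) N), comp_mulBy, comp_mulBy, one_pow, ← cancel_mono (kerι f),
      pow_comp, kerLift_ι, div_pow, h2, h2, div_self', one_comp]
  have h3 : (x ≫ torsionι G N) / (y ≫ torsionι G N) = 1 := by
    have h4 : z ≫ kerι f = (x ≫ torsionι G N) / (y ≫ torsionι G N) := kerLift_ι _ _ _
    rw [← h4, hz, one_comp]
  rw [← cancel_mono (torsionι G N)]
  exact div_eq_one.1 h3

/-- If multiplication by `N` is an automorphism of the kernel of a faithfully flat homomorphism,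
this homomorphism induces an isomorphism on `N`-torsion. -/
lemma isIso_torsionMap [Surjective f.left] [Flat f.left] [QuasiCompact f.left] (N : ℕ)
    (hK : IsIso (mulBy (ker f) N)) : IsIso (torsionMap f N) := by
  have hmono := mono_torsionMap f N inferInstance
  -- On the faithfully flat cover `T` of `H[N]`, the pullback of `f`, the tautological point `c`
  -- lifts to a point `g` of `G`.
  let T : Over S := Over.mk (pullback.fst f.left (torsionι H N).left ≫ G.hom)
  let g : T ⟶ G := Over.homMk (pullback.fst f.left (torsionι H N).left) rfl
  let c : T ⟶ torsion H N := Over.homMk (pullback.snd f.left (torsionι H N).left) (by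
    rw [← Over.w (torsionι H N), ← pullback.condition_assoc, Over.w f]
    rfl)
  have hgc : g ≫ f = c ≫ torsionι H N := by
    ext1
    exact pullback.condition
  let z : T ⟶ ker f := kerLift f (g ^ N) (by
    rw [pow_comp, hgc, ← comp_pow, torsionι_pow, comp_one])
  -- The `N`-th root in the kernel of `g ^ N`; then `g / w` is an `N`-torsion point with the same
  -- image as `g`.
  let w : T ⟶ ker f := z ≫ inv (mulBy (ker f) N)
  have hw : (w ≫ kerι f) ^ N = g ^ N := by
    rw [← pow_comp, ← comp_mulBy w, Category.assoc z, IsIso.inv_hom_id, Category.comp_id]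
    exact kerLift_ι _ _ _
  let s : T ⟶ torsion G N := torsionLift (g / (w ≫ kerι f)) (by rw [div_pow, hw, div_self'])
  have hs : s ≫ torsionMap f N = c := by
    rw [← cancel_mono (torsionι H N), Category.assoc, torsionMap_ι, ← Category.assoc,
      torsionLift_ι, GrpObj.div_comp, Category.assoc, kerι_comp, comp_one, div_one, hgc]
  have hc : (@Surjective ⊓ @Flat ⊓ @QuasiCompact : MorphismProperty Scheme.{u}) c.left :=
    ⟨⟨inferInstanceAs (Surjective (pullback.snd f.left (torsionι H N).left)),
      inferInstanceAs (Flat (pullback.snd f.left (torsionι H N).left))⟩,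
      inferInstanceAs (QuasiCompact (pullback.snd f.left (torsionι H N).left))⟩
  have : Mono (torsionMap f N).left := inferInstance
  -- Pulled back to `T`, the monomorphism acquires a section and becomes an isomorphism; this
  -- descends along `c`, which is faithfully flat and quasi-compact.
  have hsplit : IsSplitEpi (pullback.snd (torsionMap f N).left c.left) :=
    ⟨⟨⟨pullback.lift s.left (𝟙 _) (by rw [← Over.comp_left, hs, Category.id_comp]),
      pullback.lift_snd _ _ _⟩⟩⟩
  have h1 : IsIso (pullback.snd (torsionMap f N).left c.left) := isIso_of_mono_of_isSplitEpi _
  have h2 : IsIso ((Over.forget S).map (torsionMap f N)) :=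
    MorphismProperty.of_pullback_snd_of_descendsAlong
      (P := MorphismProperty.isomorphisms Scheme.{u}) hc h1
  exact isIso_of_reflects_iso _ (Over.forget S)

end Torsion

/-- Used for the inverses of the torsion maps, against both the inclusions of the towers and the
transition maps over `Spf R`. -/
lemma comp_eq_comp_of_inverse {C : Type*} [Category C] {P Q P' Q' : C} {a : P ⟶ Q} {b : P' ⟶ Q'}
    {t : P ⟶ P'} {t' : Q ⟶ Q'} (h : a ≫ t' = t ≫ b) {a' : Q ⟶ P} {b' : Q' ⟶ P'}
    (ha : a' ≫ a = 𝟙 Q) (hb : b ≫ b' = 𝟙 P') : a' ≫ t = t' ≫ b' := by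
  rw [← Category.comp_id t, ← hb, ← reassoc_of% h, reassoc_of% ha]

/-! ### The two implications over `Spf R` -/

namespace FormalGenEllCurve.Hom

variable {R : Type u} [CommRing R] {I : Ideal R} {X Y : FormalGenEllCurve I} (f : X.Hom Y)

lemma isIso_torsionMap_of_isIso (p : ℕ) [IsIso (f.pTower p)] (m n : ℕ) :
    IsIso (torsionMap (f.app m).sm (p ^ (n + 1))) := by
  have h1 := IsIso.hom_inv_id (f.pTower p)
  have h2 := IsIso.inv_hom_id (f.pTower p)
  refine ⟨((inv (f.pTower p)).app m).app n, ?_, ?_⟩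
  · exact congrArg (fun g : FormalPTower.Hom _ _ ↦ (g.app m).app n) h1
  · exact congrArg (fun g : FormalPTower.Hom _ _ ↦ (g.app m).app n) h2

/-- Levelwise inverses are homomorphisms and commute with all structure maps because the maps they
invert do. -/
lemma isIso_pTower (p : ℕ)
    (h : ∀ m n, IsIso (torsionMap (f.app m).sm (p ^ (n + 1)))) : IsIso (f.pTower p) := by
  let ψ (m n : ℕ) : torsion (Y.curve m).sm (p ^ (n + 1)) ⟶ torsion (X.curve m).sm (p ^ (n + 1)) :=
    inv (torsionMap (f.app m).sm (p ^ (n + 1)))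
  have hψ (m n : ℕ) : torsionMap (f.app m).sm (p ^ (n + 1)) ≫ ψ m n = 𝟙 _ := IsIso.hom_inv_id _
  have hψ' (m n : ℕ) : ψ m n ≫ torsionMap (f.app m).sm (p ^ (n + 1)) = 𝟙 _ := IsIso.inv_hom_id _
  have hmon (m n : ℕ) : IsMonHom (ψ m n) := by
    have : IsMonHom (ψ m n ≫ torsionMap (f.app m).sm (p ^ (n + 1))) := by
      rw [hψ']
      infer_instance
    exact isMonHom_of_comp_mono _ (torsionMap (f.app m).sm (p ^ (n + 1)))
  let g : Y.pTower p ⟶ X.pTower p :=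
    { app m :=
        { app n := ψ m n
          isMonHom n := hmon m n
          comm n := comp_eq_comp_of_inverse (((f.pTower p).app m).comm n) (hψ' m n) (hψ m (n + 1)) }
      comm m n := comp_eq_comp_of_inverse ((f.pTower p).comm m n) congr(($(hψ' m n)).left)
        congr(($(hψ (m + 1) n)).left) }
  refine ⟨g, ?_, ?_⟩
  · refine FormalPTower.Hom.ext (funext fun m ↦ PTower.Hom.ext (funext fun n ↦ ?_))
    exact hψ m n
  · refine FormalPTower.Hom.ext (funext fun m ↦ PTower.Hom.ext (funext fun n ↦ ?_))
    exact hψ' m n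

lemma isNilpotent_natCast (p : ℕ) (hp : (p : R) ∈ I) (m : ℕ) :
    IsNilpotent (p : R ⧸ I ^ (m + 1)) := by
  refine ⟨m + 1, ?_⟩
  rw [← map_natCast (Ideal.Quotient.mk _), ← map_pow, Ideal.Quotient.eq_zero_iff_mem]
  exact Ideal.pow_mem_pow hp _

/-- Being nilpotent, `p` lies in every prime `q`; by Bézout an integer prime to `p` then lies in
none. -/
lemma isUnit_mk_iff (p : ℕ) [hpp : Fact p.Prime] (hp : (p : R) ∈ I) (hf : f.IsIsogeny) {δ : R}
    (hδ : f.IsDegree δ) (m : ℕ) : IsUnit (Ideal.Quotient.mk (I ^ (m + 1)) δ) ↔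
      ∀ q, ¬ p ∣ f.rank m q := by
  rw [((f.isDegree_iff hf δ).1 hδ m).isUnit]
  refine forall_congr' fun q ↦ not_congr ?_
  have hpq : (p : R ⧸ I ^ (m + 1)) ∈ q.asIdeal := by
    obtain ⟨n, hn⟩ := isNilpotent_natCast p hp m
    exact q.2.mem_of_pow_mem n (hn ▸ zero_mem _)
  constructor
  · intro hmem
    by_contra hdvd
    have h1 : IsCoprime ((f.rank m q : ℕ) : ℤ) (p : ℤ) :=
      Nat.isCoprime_iff_coprime.2 ((hpp.out.coprime_iff_not_dvd.2 hdvd).symm)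
    obtain ⟨a, b, hab⟩ := h1
    refine q.2.ne_top ((Ideal.eq_top_iff_one _).2 ?_)
    have h2 := congrArg (Int.cast (R := R ⧸ I ^ (m + 1))) hab
    push_cast at h2
    rw [← h2]
    exact add_mem (Ideal.mul_mem_left _ _ hmem) (Ideal.mul_mem_left _ _ hpq)
  · rintro ⟨c, hc⟩
    rw [hc, Nat.cast_mul]
    exact Ideal.mul_mem_right _ _ hpq

/-- By completeness `I` is contained in the Jacobson radical. -/
lemma isUnit_of_isUnit_mk [IsAdicComplete I R] {δ : R}
    (h : IsUnit (Ideal.Quotient.mk (I ^ (0 + 1)) δ)) : IsUnit δ := by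
  obtain ⟨b, hb⟩ := h.exists_right_inv
  obtain ⟨b, rfl⟩ := Ideal.Quotient.mk_surjective b
  rw [← _root_.map_mul, ← map_one (Ideal.Quotient.mk _), Ideal.Quotient.eq, zero_add,
    pow_one] at hb
  have h1 := Ideal.mem_jacobson_bot.1 (IsAdicComplete.le_jacobson_bot I hb) 1
  rw [_root_.mul_one, sub_add_cancel] at h1
  exact isUnit_of_mul_isUnit_left h1

lemma isIso_pTower_of_isUnit (p : ℕ) [Fact p.Prime] (hp : (p : R) ∈ I) (hf : f.IsIsogeny) {δ : R}
    (hδ : f.IsDegree δ) (hu : IsUnit δ) : IsIso (f.pTower p) := by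
  refine f.isIso_pTower p fun m n ↦ ?_
  have h1 := (f.isUnit_mk_iff p hp hf hδ m).1 (hu.map _)
  let j : Spec (.of (R ⧸ I ^ (m + 1))) ⟶ nbhd I m := 𝟙 (nbhd I m)
  have : IsIso j := inferInstanceAs (IsIso (𝟙 (nbhd I m)))
  have h2 : IsIso (mulBy (f.app m).kernel p) :=
    (f.app m).isIso_mulBy_kernel (hf m) j p (isNilpotent_natCast p hp m) h1
  have := (f.app m).isFinite_sm (hf m)
  have := ((f.app m).flat_sm (hf m)).1
  have := (f.app m).surjective_sm (hf m)
  exact isIso_torsionMap (f.app m).sm _ (isIso_mulBy_pow (G := (f.app m).kernel) p (n + 1))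

lemma isUnit_of_isIso_pTower [IsAdicComplete I R] (p : ℕ) [Fact p.Prime] (hp : (p : R) ∈ I)
    (hf : f.IsIsogeny) {δ : R} (hδ : f.IsDegree δ) [IsIso (f.pTower p)] : IsUnit δ := by
  -- Only `m = 0` and the first level of the tower, the `p`-torsion itself, are needed in this
  -- direction.
  refine isUnit_of_isUnit_mk ((f.isUnit_mk_iff p hp hf hδ 0).2 fun q ↦ ?_)
  obtain ⟨k, _, _, t, ht⟩ := exists_geometricPoint (Z := nbhd I 0) q
  have h1 := f.isIso_torsionMap_of_isIso p 0 0
  have := (f.app 0).isFinite_kernel (hf 0)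
  have := (f.app 0).flat_kernel (hf 0)
  have : CharP k p := by
    obtain ⟨φ, -⟩ := Spec.map_surjective (R := .of (R ⧸ I ^ (0 + 1))) t
    let := φ.hom.toAlgebra
    exact charP_of_isNilpotent (A := R ⧸ I ^ (0 + 1)) p (isNilpotent_natCast p hp 0)
  refine not_dvd_finrank_of_torsion_trivial (K := (f.app 0).kernel) (t := t) p q (ht _)
    fun T x hx ↦ ?_
  have h2 : IsIso (torsionMap (f.app 0).sm p) := by
    rwa [zero_add, pow_one] at h1
  exact eq_one_of_mono_torsionMap (f.app 0).sm p x hx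

end FormalGenEllCurve.Hom

end GenEll

theorem proposition1p8 (p : ℕ) [Fact p.Prime] {R : Type u} [CommRing R] (I : Ideal R)
    [IsAdicComplete I R] (hp : (p : R) ∈ I) (E E' : GenEll.FormalGenEllCurve I) (f : E.Hom E')
    (hf : f.IsIsogeny) :
    (∃! δ : R, f.IsDegree δ) ∧
      ∀ δ : R, f.IsDegree δ → (IsIso (f.pTower p) ↔ IsUnit δ) :=
  ⟨f.existsUnique_isDegree hf, fun _ hδ ↦
    ⟨fun _ ↦ f.isUnit_of_isIso_pTower p hp hf hδ, f.isIso_pTower_of_isUnit p hp hf hδ⟩⟩
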